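/- Let $(\phi_n)_{n\in\mathbb Z}$ be i.i.d. random variables with values in $[0,1]$, let $(Z_n)_{n\in\mathbb Z}$ be i.i.d. random variables with values in $\{0,1,2,\dots\}$, independent of $\Phi=(\phi_n)_{n\in\mathbb Z}$, and let $(B_{n,k})_{n\in\mathbb Z,\,k\ge 0}$ be a family of random variables that is independent of $(Z_n)_{n\in\mathbb Z}$ and such that, conditionally on $\Phi$, the $B_{n,k}$ are independent and $B_{n,k}$ is Bernoulli with parameter $\phi_n$. For an integer $x\ge 0$ write $\phi_n\circ x=\sum_{k=1}^{x}B_{n,k}$. Define the RCINAR(1) process started from $0$ by $$X_0=0,\qquad X_n=\phi_n\circ X_{n-1}+Z_n\quad(n\ge 1),$$ and denote the underlying probability by $P_0$. Let $\nu_0=1$ and $\nu_n=\inf\{i>\nu_{n-1}:\ \phi_i\circ X_{i-1}=0\}$ for $n\ge1$ (with $\inf\emptyset=\infty$), and let $$W_1=\sum_{\nu_0\le i<\nu_1}X_i$$ be the sum of the process over the first renewal epoch. A function $f$ is called regularly varying of index $\rho\in\mathbb R$ if $f(t)=t^{\rho}L(t)$ for $t>0$, where $\lim_{t\to\infty}L(\lambda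 t)/L(t)=1$ for every $\lambda>0$. **Lemma.** Assume that $P_0(\phi_0=1)<1$ and that, for some $\alpha>0$, there is a function $h$, regularly varying of index $\alpha$, with $\lim_{t\to\infty}h(t)\,P_0(Z_0>t)=1$. Then the limit $$\lim_{t\to\infty}h(t)\cdot P_0(W_1>t)$$ exists and is finite and strictly positive. In particular, $t\mapsto P_0(W_1>t)$ is regularly varying of index $-\alpha$. -/

import Mathlib

open MeasureTheory ProbabilityTheory Filter Topology
open scoped ENNReal

/-- `f` is regularly varying (at infinity) of index `α`: `f t = t ^ α * L t` with `L` slowly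
varying. Only the behaviour on `(0, ∞)` matters. -/
def RegularlyVarying (f : ℝ → ℝ) (α : ℝ) : Prop :=
  ∃ L : ℝ → ℝ, (∀ t : ℝ, 0 < t → f t = t ^ α * L t) ∧
    ∀ l : ℝ, 0 < l → Tendsto (fun t : ℝ => L (l * t) / L t) atTop (𝓝 1)

namespace RCINAR

/-- The weight that the Bernoulli law with parameter `p` gives to the integer `b`. -/
noncomputable def bernoulliWeight (p : ℝ) (b : ℕ) : ℝ :=
  if b = 1 then p else if b = 0 then 1 - p else 0

/-- The σ-algebra generated by the random environment `Φ = (φ_n)_{n ∈ ℤ}`. -/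
abbrev environmentSigma {Ω : Type*} (φ : ℤ → Ω → ℝ) : MeasurableSpace Ω :=
  MeasurableSpace.comap (fun ω n => φ n ω) MeasurableSpace.pi

/-- The standing assumptions on the random elements that drive an RCINAR(1) process: the
coefficients `φ`, the innovations `Z` and the thinning variables `B`. -/
structure Model {Ω : Type*} [MeasurableSpace Ω] (μ : Measure Ω)
    (φ : ℤ → Ω → ℝ) (Z : ℤ → Ω → ℕ) (B : ℤ → ℕ → Ω → ℕ) : Prop where
  measurable_coeff : ∀ n, Measurable (φ n)
  measurable_innov : ∀ n, Measurable (Z n)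
  measurable_thin : ∀ n k, Measurable (B n k)
  /-- `Φ` is an i.i.d. sequence with values in `[0, 1]`. -/
  coeff_mem : ∀ n ω, φ n ω ∈ Set.Icc (0 : ℝ) 1
  coeff_indep : iIndepFun φ μ
  coeff_ident : ∀ n, IdentDistrib (φ n) (φ 0) μ μ
  /-- `Z` is an i.i.d. sequence, independent of `Φ`. -/
  innov_indep : iIndepFun Z μ
  innov_ident : ∀ n, IdentDistrib (Z n) (Z 0) μ μ
  coeff_indep_innov : IndepFun (fun ω n => φ n ω) (fun ω n => Z n ω) μ
  /-- The family `B` is independent of `Z`. -/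
  thin_indep_innov :
    IndepFun (fun ω (i : ℤ × ℕ) => B i.1 i.2 ω) (fun ω n => Z n ω) μ
  /-- Given `Φ`, the variables `B n k` are independent and `B n k` is Bernoulli with parameter
  `φ n`: the conditional probabilities of all finite-dimensional cylinders are the products of
  the Bernoulli weights. -/
  thin_cond : ∀ (S : Finset (ℤ × ℕ)) (b : ℤ × ℕ → ℕ),
    μ[({ω | ∀ i ∈ S, B i.1 i.2 ω = b i}).indicator (fun _ => (1 : ℝ)) | environmentSigma φ]
      =ᵐ[μ] fun ω => ∏ i ∈ S, bernoulliWeight (φ i.1 ω) (b i)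

/-- The binomial thinning `φ_n ∘ x = ∑_{k=1}^x B_{n,k}`. -/
def thinning {Ω : Type*} (B : ℤ → ℕ → Ω → ℕ) (n : ℤ) (x : ℕ) (ω : Ω) : ℕ :=
  ∑ k ∈ Finset.Icc 1 x, B n k ω

/-- The process `X_0 = 0`, `X_{n+1} = φ_{n+1} ∘ X_n + Z_{n+1}`. -/
def process {Ω : Type*} (Z : ℤ → Ω → ℕ) (B : ℤ → ℕ → Ω → ℕ) : ℕ → Ω → ℕ
  | 0, _ => 0
  | n + 1, ω => thinning B ((n : ℤ) + 1) (process Z B n ω) ω + Z ((n : ℤ) + 1) ω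

/-- The regeneration times `ν_0 = 1`, `ν_{n+1} = inf {i > ν_n : φ_i ∘ X_{i-1} = 0}`, with
`inf ∅ = ∞`. -/
noncomputable def regenTime {Ω : Type*} (Z : ℤ → Ω → ℕ) (B : ℤ → ℕ → Ω → ℕ) : ℕ → Ω → ℕ∞
  | 0, _ => 1
  | n + 1, ω => sInf {m : ℕ∞ | ∃ i : ℕ, m = (i : ℕ∞) ∧ regenTime Z B n ω < (i : ℕ∞) ∧
      thinning B (i : ℤ) (process Z B (i - 1) ω) ω = 0}

open Classical in
/-- The sum of `X_i` over the `n`-th renewal epoch, `W_n = ∑_{ν_{n-1} ≤ i < ν_n} X_i`, for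
`n ≥ 1`, as a number in `[0, ∞]`. -/
noncomputable def epochSum {Ω : Type*} (Z : ℤ → Ω → ℕ) (B : ℤ → ℕ → Ω → ℕ) (n : ℕ) (ω : Ω) :
    ℝ≥0∞ :=
  ∑' i : ℕ, if regenTime Z B (n - 1) ω ≤ (i : ℕ∞) ∧ (i : ℕ∞) < regenTime Z B n ω
    then (process Z B i ω : ℝ≥0∞) else 0

end RCINAR

/-! The epoch sum has a heavy tail because a single innovation has one. A huge batch of `Z i`
newcomers contributes about `Z i` times the sum of its survival fractions, and two huge batches in
one epoch are too unlikely to matter. So the tail of `W_1` is compared with `F t = P(Z 0 > t)`, and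
the claim is that the quotient has a positive limit.

In the process the living are renumbered `1, …, X_n` at every step, so a batch cannot be followed in
time. But the thinning row of a new time is independent of the past and exchangeable, so population
sizes and survivor counts form a Markov chain with the same law for every adapted labelling
(`LabelProcess.measure_epoch_eq`). One may therefore let individual `j` of batch `i` keep the label
`Nat.pair i j` for ever. The epoch sum then becomes the double series over `(i, k)` of
`contribution`: the part of batch `i` alive at time `i + k`, provided that no regeneration occurred
up to time `i` (`iSup_partialEpochSum`). This proviso involves only innovations before time `i`,
hence is independent of `Z i`.

Three estimates give the limit. For one batch, a conditional law of large numbers (`Model.average`)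
and a Breiman-type lemma (`RegularTail.tail_subst`) show that its contribution over finitely many
ages has a tail asymptotic to a constant times `F`. Finitely many batches add up by the single big
jump principle (`RegularTail.tail_add`). Finally the contributions outside a large box are
negligible relative to `F` (`exists_remainder_bound`). Here decay in the age `k` comes from mean
survival, and decay in `i` from a geometric drift condition for a small power of the population size
(`exists_drift`), both combined with Potter bounds. `RegularTail.tendsto_of_truncation` then lets
the box grow. The limit is positive since batch 1 at age 0 already contributes `Z 1`. -/

/-! ### Regular variation and Potter bounds -/

/-- `F` is a positive nonincreasing function, bounded by one and regularly varying of
index `-α`. -/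
structure RegularTail (F : ℝ → ℝ) (α : ℝ) : Prop where
  anti : Antitone F
  pos : ∀ t, 0 < F t
  le_one : ∀ t, F t ≤ 1
  tendsto_ratio : ∀ l : ℝ, 0 < l → Tendsto (fun t => F (l * t) / F t) atTop (𝓝 (l ^ (-α)))

/-- A function asymptotically inverse to a regularly varying one varies regularly. -/
theorem RegularlyVarying.tendsto_ratio_of_mul {h G : ℝ → ℝ} {α c : ℝ} (hh : RegularlyVarying h α)
    (hc : 0 < c) (hG : Tendsto (fun t => h t * G t) atTop (𝓝 c)) {l : ℝ} (hl : 0 < l) :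
    Tendsto (fun t => G (l * t) / G t) atTop (𝓝 (l ^ (-α))) := by
  obtain ⟨L, hL, hL1⟩ := hh
  have hl' : Tendsto (fun t : ℝ => l * t) atTop atTop := tendsto_id.const_mul_atTop hl
  have h1 : Tendsto (fun t => (h (l * t) * G (l * t)) / (h t * G t) * (L (l * t) / L t)⁻¹ * l ^ (-α))
      atTop (𝓝 (c / c * 1⁻¹ * l ^ (-α))) :=
    (((hG.comp hl').div hG hc.ne').mul ((hL1 l hl).inv₀ one_ne_zero)).mul_const _
  rw [div_self hc.ne', inv_one, one_mul, one_mul] at h1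
  refine h1.congr' ?_
  have e1 : ∀ᶠ t in atTop, h t * G t ≠ 0 := hG.eventually_ne hc.ne'
  filter_upwards [e1, hl'.eventually e1, eventually_gt_atTop 0] with t h1 h2 ht
  rw [hL t ht] at h1 ⊢
  rw [hL (l * t) (by positivity)] at h2 ⊢
  rw [Real.mul_rpow hl.le ht.le] at h2 ⊢
  rw [Real.rpow_neg hl.le]
  have a1 : L t ≠ 0 := fun h => h1 (by simp [h])
  have a2 : L (l * t) ≠ 0 := fun h => h2 (by simp [h])
  have a3 : G t ≠ 0 := fun h => h1 (by simp [h])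
  have a4 : l ^ α ≠ 0 := (Real.rpow_pos_of_pos hl _).ne'
  have a5 : t ^ α ≠ 0 := (Real.rpow_pos_of_pos ht _).ne'
  field_simp

theorem RegularlyVarying.of_mul {h G : ℝ → ℝ} {α c : ℝ} (hh : RegularlyVarying h α)
    (hc : 0 < c) (hG : Tendsto (fun t => h t * G t) atTop (𝓝 c)) : RegularlyVarying G (-α) := by
  refine ⟨fun t => t ^ α * G t, fun t ht => ?_, fun l hl => ?_⟩
  · rw [← mul_assoc, ← Real.rpow_add ht, neg_add_cancel, Real.rpow_zero, one_mul]
  · have h1 := (hh.tendsto_ratio_of_mul hc hG hl).const_mul (l ^ α)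
    rw [← Real.rpow_add hl, add_neg_cancel, Real.rpow_zero] at h1
    refine h1.congr' ?_
    filter_upwards [eventually_gt_atTop 0] with t ht
    rw [Real.mul_rpow hl.le ht.le]
    have a5 : t ^ α ≠ 0 := (Real.rpow_pos_of_pos ht _).ne'
    field_simp

namespace RegularTail

variable {F : ℝ → ℝ} {α : ℝ}

/-- The ratio at scale 2 tends to `2 ^ (-α)`, which lies strictly between `2 ^ (-β)` and `2 ^ (-γ)`.
Powers of this one scale suffice for all others, since monotonicity of `F` fills the gaps. -/
theorem exists_doubling (hF : RegularTail F α) {γ β : ℝ} (hγ : γ < α) (hβ : α < β) :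
    ∃ t₀ : ℝ, 1 ≤ t₀ ∧ ∀ t, t₀ ≤ t → F (2 * t) ≤ 2 ^ (-γ) * F t ∧ F t ≤ 2 ^ β * F (2 * t) := by
  have h := hF.tendsto_ratio 2 two_pos
  have h1 := h.eventually_lt_const (u := (2 : ℝ) ^ (-γ))
    (Real.rpow_lt_rpow_of_exponent_lt one_lt_two (by linarith))
  have h2 := h.eventually_const_lt (u := (2 : ℝ) ^ (-β))
    (Real.rpow_lt_rpow_of_exponent_lt one_lt_two (by linarith))
  obtain ⟨t₀, ht₀⟩ := eventually_atTop.1 (h1.and h2)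
  refine ⟨max t₀ 1, le_max_right _ _, fun t ht => ?_⟩
  obtain ⟨a, b⟩ := ht₀ t (le_trans (le_max_left _ _) ht)
  rw [div_lt_iff₀ (hF.pos t)] at a
  rw [lt_div_iff₀ (hF.pos t), Real.rpow_neg two_pos.le, inv_mul_lt_iff₀ (by positivity)] at b
  exact ⟨a.le, b.le⟩

theorem iterate_doubling {t₀ γ β : ℝ} (h0 : 1 ≤ t₀)
    (h : ∀ t, t₀ ≤ t → F (2 * t) ≤ 2 ^ (-γ) * F t ∧ F t ≤ 2 ^ β * F (2 * t))
    (k : ℕ) {t : ℝ} (ht : t₀ ≤ t) :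
    F (2 ^ k * t) ≤ (2 ^ k) ^ (-γ) * F t ∧ F t ≤ (2 ^ k) ^ β * F (2 ^ k * t) := by
  induction k with
  | zero => simp
  | succ k ih =>
    have h2 : t₀ ≤ 2 ^ k * t := ht.trans (le_mul_of_one_le_left (by linarith) (one_le_pow₀ one_le_two))
    obtain ⟨a, b⟩ := h _ h2
    have e : (2 : ℝ) ^ (k + 1) * t = 2 * (2 ^ k * t) := by ring
    have e2 : ∀ x : ℝ, ((2 : ℝ) ^ (k + 1)) ^ x = (2 ^ k) ^ x * 2 ^ x := fun x => by
      rw [pow_succ, Real.mul_rpow (by positivity) (by positivity)]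
    rw [e, e2, e2]
    constructor
    · calc _ ≤ 2 ^ (-γ) * F (2 ^ k * t) := a
        _ ≤ 2 ^ (-γ) * ((2 ^ k) ^ (-γ) * F t) := by gcongr; exact ih.1
        _ = _ := by ring
    · calc _ ≤ (2 ^ k) ^ β * F (2 ^ k * t) := ih.2
        _ ≤ (2 ^ k) ^ β * (2 ^ β * F (2 * (2 ^ k * t))) := by gcongr
        _ = _ := by ring

/-- A Potter-type bound. -/
theorem potter (hF : RegularTail F α) {γ β : ℝ} (h0 : 0 < γ) (hγ : γ < α) (hβ : α < β) :
    ∃ C t₀ : ℝ, 0 < C ∧ 1 ≤ t₀ ∧ ∀ b t : ℝ, 0 < b → t₀ ≤ t →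
      F (b * t) ≤ C * (b ^ (-γ) + b ^ (-β)) * F t := by
  obtain ⟨t₀, h1, hd⟩ := hF.exists_doubling hγ hβ
  -- Doubling from `s` until `t` is passed overshoots by a factor of at most 2, which costs `2 ^ β`.
  have up : ∀ s t : ℝ, t₀ ≤ s → s ≤ t → F s ≤ 2 ^ β * (t / s) ^ β * F t := by
    intro s t hs hst
    have hs0 : 0 < s := by linarith
    obtain ⟨k, hk1, hk2⟩ := exists_nat_pow_near ((one_le_div hs0).2 hst) (one_lt_two (α := ℝ))
    have := (iterate_doubling h1 hd (k + 1) hs).2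
    calc F s ≤ _ := this
      _ ≤ (2 * (t / s)) ^ β * F t := by
        have h3 : t ≤ 2 ^ (k + 1) * s := by
          rw [div_lt_iff₀ hs0] at hk2; exact hk2.le
        have h4 : (2 : ℝ) ^ (k + 1) ≤ 2 * (t / s) := by rw [pow_succ]; linarith
        have h5 : 0 ≤ t / s := div_nonneg (hs0.le.trans hst) hs0.le
        exact mul_le_mul (Real.rpow_le_rpow (by positivity) h4 (by linarith)) (hF.anti h3)
          (hF.pos _).le (by positivity)
      _ = _ := by rw [Real.mul_rpow two_pos.le (div_nonneg (by linarith) hs0.le)]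
  -- One summand for each case: `b ≥ 1`, then `b ≤ 1` with `b * t ≥ t₀`, then `b ≤ 1` with `b * t ≤
  -- t₀`. In the last case doubling is not available at `b * t`, and `F ≤ 1` is compared with `F t₀`
  -- instead.
  refine ⟨2 ^ γ + 2 ^ β + 2 ^ β / F t₀, t₀, by have := hF.pos t₀; positivity, h1, fun b t hb ht => ?_⟩
  have ht0 : 0 < t := by linarith
  have hFt := hF.pos t
  have hFt0 := hF.pos t₀
  have p1 : 0 < b ^ (-γ) := Real.rpow_pos_of_pos hb _
  have p2 : 0 < b ^ (-β) := Real.rpow_pos_of_pos hb _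
  have key : F (b * t) ≤ 2 ^ γ * b ^ (-γ) * F t ∨ F (b * t) ≤ 2 ^ β * b ^ (-β) * F t ∨
      F (b * t) ≤ 2 ^ β / F t₀ * b ^ (-β) * F t := by
    rcases le_total 1 b with hb1 | hb1
    · left
      obtain ⟨k, hk1, hk2⟩ := exists_nat_pow_near hb1 (one_lt_two (α := ℝ))
      calc F (b * t) ≤ F (2 ^ k * t) := hF.anti (by gcongr)
        _ ≤ (2 ^ k) ^ (-γ) * F t := (iterate_doubling h1 hd k ht).1
        _ ≤ (b / 2) ^ (-γ) * F t := by
          gcongr ?_ * _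
          apply Real.rpow_le_rpow_of_nonpos (by positivity) _ (by linarith)
          rw [pow_succ] at hk2; linarith
        _ = _ := by
          rw [Real.div_rpow hb.le two_pos.le, Real.rpow_neg two_pos.le, div_inv_eq_mul]; ring
    · right
      have hbi : b ^ (-β) = (1 / b) ^ β := by
        rw [Real.rpow_neg hb.le, one_div, Real.inv_rpow hb.le]
      rcases le_total t₀ (b * t) with hs | hs
      · left
        have := up (b * t) t hs (mul_le_of_le_one_left ht0.le hb1)
        rwa [show t / (b * t) = 1 / b by field_simp, ← hbi] at this
      · right
        have h2 := up t₀ t le_rfl ht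
        have h3 : (t / t₀) ^ β ≤ b ^ (-β) := by
          rw [hbi]
          apply Real.rpow_le_rpow (by positivity) _ (by linarith)
          rw [div_le_div_iff₀ (by linarith) hb]; linarith
        calc F (b * t) ≤ 1 := hF.le_one _
          _ = F t₀ / F t₀ := (div_self hFt0.ne').symm
          _ ≤ (2 ^ β * (t / t₀) ^ β * F t) / F t₀ := by gcongr
          _ ≤ (2 ^ β * b ^ (-β) * F t) / F t₀ := by gcongr
          _ = _ := by ring
  have q1 : 0 < (2 : ℝ) ^ γ := by positivity
  have q2 : 0 < (2 : ℝ) ^ β := by positivity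
  have q3 : 0 < (2 : ℝ) ^ β / F t₀ := by positivity
  have r : ∀ x y : ℝ, 0 < x → 0 < y → 0 < x * y * F t := fun x y hx hy => by positivity
  have := r _ _ q1 p1; have := r _ _ q1 p2; have := r _ _ q2 p1; have := r _ _ q2 p2
  have := r _ _ q3 p1; have := r _ _ q3 p2
  have e : (2 ^ γ + 2 ^ β + 2 ^ β / F t₀) * (b ^ (-γ) + b ^ (-β)) * F t =
    2 ^ γ * b ^ (-γ) * F t + 2 ^ γ * b ^ (-β) * F t + 2 ^ β * b ^ (-γ) * F t + 2 ^ β * b ^ (-β) * F t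
    + 2 ^ β / F t₀ * b ^ (-γ) * F t + 2 ^ β / F t₀ * b ^ (-β) * F t := by ring
  rw [e]
  rcases key with h | h | h <;> linarith

/-- Potter's bound at the fixed point `t₀` with `b` tending to infinity. -/
theorem tendsto_zero (hF : RegularTail F α) (hα : 0 < α) : Tendsto F atTop (𝓝 0) := by
  obtain ⟨C, t₀, hC, h1, hp⟩ := hF.potter (γ := α / 2) (β := α + 1) (by linarith) (by linarith)
    (by linarith)
  have h2 : Tendsto (fun b : ℝ => C * (b ^ (-(α / 2)) + b ^ (-(α + 1))) * F t₀) atTop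
      (𝓝 (C * (0 + 0) * F t₀)) :=
    (((tendsto_rpow_neg_atTop (by linarith)).add
      (tendsto_rpow_neg_atTop (by linarith))).const_mul C).mul_const _
  simp only [add_zero, mul_zero, zero_mul] at h2
  have ht : 0 < t₀ := by linarith
  have h3 : Tendsto (fun t : ℝ => t / t₀) atTop atTop := tendsto_id.atTop_div_const ht
  refine squeeze_zero' (Eventually.of_forall fun t => (hF.pos t).le) ?_ (h2.comp h3)
  filter_upwards [eventually_gt_atTop 0] with t htt
  have := hp (t / t₀) t₀ (by positivity) le_rfl
  rwa [div_mul_cancel₀ _ ht.ne'] at this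

end RegularTail

/-! ### Limits of tail ratios: truncation, single big jump, random multipliers -/

namespace RegularTail

variable {F : ℝ → ℝ} {α : ℝ}

theorem tendsto_scale (hF : RegularTail F α) {p : ℝ → ℝ} {c l : ℝ} (hl : 0 < l)
    (hp : Tendsto (fun t => p t / F t) atTop (𝓝 c)) :
    Tendsto (fun t => p (l * t) / F t) atTop (𝓝 (c * l ^ (-α))) := by
  have hl' : Tendsto (fun t : ℝ => l * t) atTop atTop := tendsto_id.const_mul_atTop hl
  refine ((hp.comp hl').mul (hF.tendsto_ratio l hl)).congr fun t => ?_
  have := (hF.pos (l * t)).ne'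
  simp only [Function.comp]
  field_simp

theorem exists_shrink_lt (α c : ℝ) {e : ℝ} (he : 0 < e) :
    ∃ ε : ℝ, 0 < ε ∧ ε < 1 ∧ c * (1 - ε) ^ (-α) < c + e := by
  have h1 : Tendsto (fun ε : ℝ => c * (1 - ε) ^ (-α)) (𝓝[>] 0) (𝓝 (c * (1 - 0) ^ (-α))) := by
    apply tendsto_nhdsWithin_of_tendsto_nhds
    have : ContinuousAt (fun ε : ℝ => c * (1 - ε) ^ (-α)) 0 := by
      apply ContinuousAt.mul continuousAt_const
      exact ContinuousAt.rpow_const (by fun_prop) (by simp)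
    exact this
  rw [sub_zero, Real.one_rpow, mul_one] at h1
  have h2 := h1.eventually_lt_const (show c < c + e by linarith)
  have h3 : ∀ᶠ ε : ℝ in 𝓝[>] 0, ε < 1 :=
    eventually_nhdsWithin_of_eventually_nhds (eventually_lt_nhds one_pos)
  obtain ⟨ε, ⟨h4, h5⟩, h6⟩ := ((h2.and h3).and eventually_mem_nhdsWithin).exists
  exact ⟨ε, h6, h5, h4⟩

/-- Passage to the limit in an increasing family of tails. -/
theorem tendsto_of_truncation (hF : RegularTail F α) {p : ℝ → ℝ} {q : ℕ → ℝ → ℝ}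
    {c : ℕ → ℝ} (hmono : ∀ n t, q n t ≤ q (n + 1) t) (hle : ∀ n t, q n t ≤ p t)
    (hq : ∀ n, Tendsto (fun t => q n t / F t) atTop (𝓝 (c n)))
    (hp : ∀ ε : ℝ, 0 < ε → ε < 1 → ∃ δ : ℕ → ℝ, Tendsto δ atTop (𝓝 0) ∧
      ∀ n, ∀ᶠ t in atTop, p t ≤ q n ((1 - ε) * t) + δ n * F t) :
    ∃ c' : ℝ, (∀ n, c n ≤ c') ∧ Tendsto (fun t => p t / F t) atTop (𝓝 c') := by
  have hcm : Monotone c := monotone_nat_of_le_succ fun n =>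
    le_of_tendsto_of_tendsto' (hq n) (hq (n + 1)) fun t =>
      div_le_div_of_nonneg_right (hmono n t) (hF.pos t).le
  have hup : ∀ ε : ℝ, 0 < ε → ε < 1 → ∃ δ : ℕ → ℝ, Tendsto δ atTop (𝓝 0) ∧
      ∀ n, ∀ e > 0, ∀ᶠ t in atTop, p t / F t < c n * (1 - ε) ^ (-α) + δ n + e := by
    intro ε h0 h1
    obtain ⟨δ, hδ, h⟩ := hp ε h0 h1
    refine ⟨δ, hδ, fun n e he => ?_⟩
    have h2 := (hF.tendsto_scale (l := 1 - ε) (by linarith) (hq n)).eventually_lt_const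
      (lt_add_of_pos_right _ he)
    filter_upwards [h n, h2] with t h3 h4
    have h5 : p t / F t ≤ q n ((1 - ε) * t) / F t + δ n := by
      rw [div_add' _ _ _ (hF.pos t).ne']
      exact div_le_div_of_nonneg_right h3 (hF.pos t).le
    linarith
  -- Already the truncation `q 0` with `ε = 1 / 2` bounds `p / F` for large `t`, and every `c n`
  -- lies below such a bound.
  have hbdd : BddAbove (Set.range c) := by
    obtain ⟨δ, -, h⟩ := hup (1 / 2) (by norm_num) (by norm_num)
    refine ⟨c 0 * (1 - 1 / 2) ^ (-α) + δ 0 + 1, ?_⟩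
    rintro _ ⟨n, rfl⟩
    refine le_of_tendsto (hq n) ?_
    filter_upwards [h 0 1 one_pos] with t ht
    exact (div_le_div_of_nonneg_right (hle n t) (hF.pos t).le).trans ht.le
  have hlim := tendsto_atTop_ciSup hcm hbdd
  refine ⟨⨆ n, c n, fun n => le_ciSup hbdd n, ?_⟩
  set c' := ⨆ n, c n
  rw [Metric.tendsto_nhds]
  intro e he
  -- The lower estimate of `p / F` uses one good truncation `n₁`. For the upper one, `ε` is fixed
  -- first, and only then `n₂` is taken so large that the error `δ n₂` is small.
  obtain ⟨n₁, hn₁⟩ := (hlim.eventually_const_lt (show c' - e / 2 < c' by linarith)).exists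
  obtain ⟨ε, he0, he1, he2⟩ := exists_shrink_lt α c' (show 0 < e / 4 by linarith)
  obtain ⟨δ, hδ, h⟩ := hup ε he0 he1
  have h6 : ∀ᶠ n in atTop, c n * (1 - ε) ^ (-α) < c' * (1 - ε) ^ (-α) + e / 4 :=
    (hlim.mul_const _).eventually_lt_const (by linarith)
  obtain ⟨n₂, hn₂, hn₃⟩ := (h6.and (hδ.eventually_lt_const (show 0 < e / 4 by linarith))).exists
  filter_upwards [h n₂ (e / 4) (by linarith),
    (hq n₁).eventually_const_lt (show c n₁ - e / 2 < c n₁ by linarith)] with t h7 h8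
  have h9 := div_le_div_of_nonneg_right (hle n₁ t) (hF.pos t).le
  rw [Real.dist_eq, abs_lt]
  constructor <;> linarith

section Probability

variable {Ω : Type*} [MeasurableSpace Ω] {μ : Measure Ω} [IsProbabilityMeasure μ]

/-- The principle of a single big jump for two summands. -/
theorem tail_add (hF : RegularTail F α) {U V : Ω → ℝ} (hV : Measurable V)
    (hU0 : ∀ ω, 0 ≤ U ω) (hV0 : ∀ ω, 0 ≤ V ω) {a b : ℝ}
    (ha : Tendsto (fun t => μ.real {ω | t < U ω} / F t) atTop (𝓝 a))
    (hb : Tendsto (fun t => μ.real {ω | t < V ω} / F t) atTop (𝓝 b))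
    (hj : ∀ ε : ℝ, 0 < ε →
      Tendsto (fun t => μ.real {ω | ε * t < U ω ∧ ε * t < V ω} / F t) atTop (𝓝 0)) :
    Tendsto (fun t => μ.real {ω | t < U ω + V ω} / F t) atTop (𝓝 (a + b)) := by
  rw [Metric.tendsto_nhds]
  intro e he
  obtain ⟨ε, he0, he1, he2⟩ := exists_shrink_lt α (a + b) (show 0 < e / 2 by linarith)
  have hab := (hF.tendsto_scale (p := fun t => μ.real {ω | t < U ω}) (l := 1 - ε)
    (by linarith) ha).add (hF.tendsto_scale (p := fun t => μ.real {ω | t < V ω}) (l := 1 - ε)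
    (by linarith) hb)
  rw [← add_mul] at hab
  have h1 := hab.eventually_lt_const he2
  have h2 := (hj ε he0).eventually_lt_const (show 0 < e / 2 by linarith)
  have h3 := (ha.add hb).eventually_const_lt (show a + b - e / 2 < a + b by linarith)
  have h4 := (hj 1 one_pos).eventually_lt_const (show 0 < e / 2 by linarith)
  filter_upwards [h1, h2, h3, h4] with t h1 h2 h3 h4
  simp only [one_mul] at h4
  rw [← add_div, div_lt_iff₀ (hF.pos t)] at h1
  rw [← add_div, lt_div_iff₀ (hF.pos t)] at h3
  rw [div_lt_iff₀ (hF.pos t)] at h2 h4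
  -- If the sum exceeds `t`, then one summand exceeds `(1 - ε) * t` or both exceed `ε * t`.
  have hup : μ.real {ω | t < U ω + V ω} ≤ μ.real {ω | (1 - ε) * t < U ω} +
      μ.real {ω | (1 - ε) * t < V ω} + μ.real {ω | ε * t < U ω ∧ ε * t < V ω} := by
    refine le_trans ?_ (add_le_add_left (measureReal_union_le _ _) _)
    refine le_trans ?_ (measureReal_union_le _ _)
    refine measureReal_mono fun ω hω => ?_
    simp only [Set.mem_union, Set.mem_ofPred_eq] at hω ⊢
    by_contra! hcon
    obtain ⟨⟨c1, c2⟩, c3⟩ := hcon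
    rcases lt_or_ge (ε * t) (U ω) with c4 | c4
    · have := c3 c4; nlinarith
    · nlinarith
  have hdown : μ.real {ω | t < U ω} + μ.real {ω | t < V ω} ≤
      μ.real {ω | t < U ω + V ω} + μ.real {ω | t < U ω ∧ t < V ω} := by
    have hm : MeasurableSet {ω | t < V ω} := measurableSet_lt measurable_const hV
    rw [← measureReal_union_add_inter (s := {ω | t < U ω}) hm]
    refine add_le_add (measureReal_mono fun ω hω => ?_) (measureReal_mono fun ω hω => hω)
    simp only [Set.mem_union, Set.mem_ofPred_eq] at hω ⊢
    have := hU0 ω; have := hV0 ω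
    rcases hω with h | h <;> linarith
  rw [Real.dist_eq, abs_lt, lt_sub_iff_add_lt, sub_lt_iff_lt_add, lt_div_iff₀ (hF.pos t),
    div_lt_iff₀ (hF.pos t)]
  constructor <;> nlinarith

theorem measureReal_section_swap {E : Set (Ω × Ω)} (hE : MeasurableSet E) :
    ∫ x, μ.real {y | (x, y) ∈ E} ∂μ = ∫ y, μ.real {x | (x, y) ∈ E} ∂μ := by
  have h1 := Measure.prod_apply (μ := μ) (ν := μ) hE
  have h2 := Measure.prod_apply_symm (μ := μ) (ν := μ) hE
  have e1 : ∫ x, μ.real {y | (x, y) ∈ E} ∂μ = (∫⁻ x, μ (Prod.mk x ⁻¹' E) ∂μ).toReal :=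
    integral_toReal (measurable_measure_prodMk_left hE).aemeasurable
      (Eventually.of_forall fun _ => measure_lt_top _ _)
  have e2 : ∫ y, μ.real {x | (x, y) ∈ E} ∂μ = (∫⁻ y, μ ((fun x => (x, y)) ⁻¹' E) ∂μ).toReal :=
    integral_toReal (measurable_measure_prodMk_right hE).aemeasurable
      (Eventually.of_forall fun _ => measure_lt_top _ _)
  rw [e1, e2, ← h1, ← h2]

/-- Splitting over the countably many values of `Z` reduces the claim to the independence of `E z`
and `{Z = z}` for each single `z`. On the right, `Z` acts as an independent copy. -/
theorem measureReal_subst_eq_integral {Z : Ω → ℕ} (hZ : Measurable Z) {E : ℕ → Set Ω}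
    (hE : ∀ z, MeasurableSet (E z))
    (hind : ∀ z, μ (E z ∩ {ω | Z ω = z}) = μ (E z) * μ {ω | Z ω = z}) :
    μ.real {ω | ω ∈ E (Z ω)} = ∫ ω, μ.real (E (Z ω)) ∂μ := by
  have e1 : ∫ ω, μ.real (E (Z ω)) ∂μ = (∫⁻ ω, μ (E (Z ω)) ∂μ).toReal :=
    integral_toReal ((measurable_of_countable (fun z => μ (E z))).comp hZ).aemeasurable
      (Eventually.of_forall fun _ => measure_lt_top _ _)
  rw [e1, measureReal_def]
  congr 1
  have hs : ∀ z, MeasurableSet {ω | Z ω = z} := fun z => hZ (measurableSet_singleton z)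
  have e2 : {ω | ω ∈ E (Z ω)} = ⋃ z, E z ∩ {ω | Z ω = z} := by
    ext ω; simp
  rw [e2, measure_iUnion _ fun z => (hE z).inter (hs z)]
  · rw [← lintegral_map (f := fun z => μ (E z)) (measurable_of_countable _) hZ,
      lintegral_countable']
    refine tsum_congr fun z => ?_
    rw [hind, Measure.map_apply hZ (measurableSet_singleton z)]
    rfl
  · intro i j hij
    refine Set.disjoint_left.2 fun ω h1 h2 => hij ?_
    exact h1.2.symm.trans h2.2

/-- A Breiman-type lemma. -/
theorem tail_subst (hF : RegularTail F α) (hα : 0 < α) {Z : Ω → ℕ} (hZ : Measurable Z)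
    (hFZ : ∀ t, F t = μ.real {ω | t < (Z ω : ℝ)}) {g : ℕ → Ω → ℝ} (hg : ∀ z, Measurable (g z))
    {K : ℝ} (hK : 0 < K) (hg0 : ∀ z ω, 0 ≤ g z ω) (hgK : ∀ z ω, g z ω ≤ K * z)
    (hind : ∀ t z, μ ({ω | t < g z ω} ∩ {ω | Z ω = z}) = μ {ω | t < g z ω} * μ {ω | Z ω = z})
    {Λ : Ω → ℝ} (hΛ : Measurable Λ) (hΛ0 : ∀ ω, 0 ≤ Λ ω) (hΛK : ∀ ω, Λ ω ≤ K)
    (hlim : Tendsto (fun z : ℕ => ∫ ω, |g z ω / z - Λ ω| ∂μ) atTop (𝓝 0)) :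
    Tendsto (fun t => μ.real {ω | t < g (Z ω) ω} / F t) atTop (𝓝 (∫ ω, Λ ω ^ α ∂μ)) := by
  -- `N ε t` is the probability that `Z' * (Λ + ε) > t` with `Z'` an independent copy of `Z`, and `J
  -- ε` is the limit of `N ε / F`. The tail in question is squeezed between `N (-ε)` and `N ε`; the
  -- maximum with 0 in `J` is needed for negative shifts.
  set J : ℝ → ℝ := fun ε => ∫ ω, (max (Λ ω + ε) 0) ^ α ∂μ with hJ
  set N : ℝ → ℝ → ℝ := fun ε t => ∫ ω', μ.real {ω | t < Z ω' * (Λ ω + ε)} ∂μ with hN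
  have hmeasΛ : ∀ ε : ℝ, Measurable fun ω => max (Λ ω + ε) 0 := fun ε => by fun_prop
  have hJ0 : J 0 = ∫ ω, Λ ω ^ α ∂μ := by
    simp only [hJ, add_zero]
    exact integral_congr_ae (Eventually.of_forall fun ω => by simp [max_eq_left (hΛ0 ω)])
  have hJc : ContinuousAt J 0 := by
    apply continuousAt_of_dominated (bound := fun _ => (K + 1) ^ α)
    · exact Eventually.of_forall fun ε => ((hmeasΛ ε).pow_const α).aestronglyMeasurable
    · filter_upwards [eventually_lt_nhds (show (0 : ℝ) < 1 by norm_num)] with ε hε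
      refine Eventually.of_forall fun ω => ?_
      rw [Real.norm_of_nonneg (by positivity)]
      refine Real.rpow_le_rpow (by positivity) (max_le ?_ (by linarith)) hα.le
      linarith [hΛK ω]
    · exact integrable_const _
    · refine Eventually.of_forall fun ω => ?_
      exact ContinuousAt.rpow_const (by fun_prop) (Or.inr hα.le)
  have hNlim : ∀ ε : ℝ, ε < 1 → Tendsto (fun t => N ε t / F t) atTop (𝓝 (J ε)) := by
    intro ε hε
    have hE : ∀ t, MeasurableSet {p : Ω × Ω | t < Z p.2 * (Λ p.1 + ε)} := fun t => by
      have hZ' : Measurable fun ω => (Z ω : ℝ) := measurable_from_nat.comp hZ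
      exact measurableSet_lt measurable_const
        ((hZ'.comp measurable_snd).mul ((hΛ.comp measurable_fst).add_const _))
    have hNe : ∀ t, N ε t = ∫ ω, μ.real {ω' | t < Z ω' * (Λ ω + ε)} ∂μ := fun t =>
      (measureReal_section_swap (μ := μ) (hE t)).symm
    have hval : ∀ t : ℝ, 0 < t → ∀ ω, μ.real {ω' | t < Z ω' * (Λ ω + ε)} =
        if 0 < Λ ω + ε then F ((Λ ω + ε)⁻¹ * t) else 0 := by
      intro t ht ω
      split_ifs with hpos
      · rw [hFZ]
        congr 1
        ext ω'
        simp only [Set.mem_ofPred_eq]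
        rw [inv_mul_lt_iff₀ hpos, mul_comm]
      · have : {ω' | t < Z ω' * (Λ ω + ε)} = ∅ := by
          ext ω'
          simp only [Set.mem_ofPred_eq, Set.mem_empty_iff_false, iff_false, not_lt]
          exact (mul_nonpos_of_nonneg_of_nonpos (by positivity) (not_lt.1 hpos)).trans ht.le
        rw [this, measureReal_empty]
    -- For fixed `ω` the probability is `F (t / (Λ ω + ε))`, whose ratio to `F t` tends to `(Λ ω +
    -- ε) ^ α`; monotonicity of `F` bounds it by the ratio for the largest multiplier `K + 1`.
    have hdom : Tendsto (fun t => ∫ ω, μ.real {ω' | t < Z ω' * (Λ ω + ε)} / F t ∂μ) atTop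
        (𝓝 (J ε)) := by
      apply tendsto_integral_filter_of_dominated_convergence
        (bound := fun _ => ((K + 1)⁻¹) ^ (-α) + 1)
      · refine Eventually.of_forall fun t => Measurable.aestronglyMeasurable ?_
        exact ((measurable_measure_prodMk_left (hE t)).ennreal_toReal).div_const _
      · have h1 := (hF.tendsto_ratio (K + 1)⁻¹ (by positivity)).eventually_lt_const
          (lt_add_one _)
        filter_upwards [h1, eventually_gt_atTop 0] with t h1 ht
        refine Eventually.of_forall fun ω => ?_
        have hp := hF.pos t
        rw [Real.norm_of_nonneg (by positivity)]
        refine le_trans ?_ h1.le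
        rw [hval t ht]
        gcongr
        split_ifs with hpos
        · refine hF.anti ?_
          gcongr
          exact hΛK ω
        · exact (hF.pos _).le
      · exact integrable_const _
      · refine Eventually.of_forall fun ω => ?_
        by_cases hpos : 0 < Λ ω + ε
        · have h1 := hF.tendsto_ratio (Λ ω + ε)⁻¹ (inv_pos.2 hpos)
          rw [max_eq_left hpos.le]
          rw [Real.inv_rpow hpos.le, Real.rpow_neg hpos.le, inv_inv] at h1
          refine h1.congr' ?_
          filter_upwards [eventually_gt_atTop 0] with t ht
          rw [hval t ht, if_pos hpos]
        · rw [max_eq_right (not_lt.1 hpos), Real.zero_rpow hα.ne']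
          refine tendsto_const_nhds.congr' ?_
          filter_upwards [eventually_gt_atTop 0] with t ht
          rw [hval t ht, if_neg hpos, zero_div]
    refine hdom.congr fun t => ?_
    rw [hNe, integral_div]
  have hP : ∀ t, μ.real {ω | t < g (Z ω) ω} = ∫ ω', μ.real {ω | t < g (Z ω') ω} ∂μ := fun t =>
    measureReal_subst_eq_integral hZ (E := fun z => {ω | t < g z ω})
      (fun z => measurableSet_lt measurable_const (hg z)) (hind t)
  have hmk : ∀ ε η : ℝ, 0 < ε → 0 < η → ∀ᶠ z : ℕ in atTop,
      μ.real {ω | ε ≤ |g z ω / z - Λ ω|} ≤ η := by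
    intro ε η hε hη
    filter_upwards [hlim.eventually_lt_const (show 0 < ε * η by positivity)] with z hz
    have hint : Integrable (fun ω => |g z ω / z - Λ ω|) μ := by
      refine Integrable.of_bound (C := 2 * K)
        (Measurable.aestronglyMeasurable (by have := hg z; fun_prop))
        (Eventually.of_forall fun ω => ?_)
      have h1 : g z ω / z ≤ K := by
        rcases Nat.eq_zero_or_pos z with rfl | h
        · simpa using hK.le
        · rw [div_le_iff₀ (by positivity)]; exact hgK z ω
      have h2 : 0 ≤ g z ω / z := div_nonneg (hg0 z ω) (by positivity)
      rw [Real.norm_eq_abs, abs_abs, abs_le]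
      constructor <;> linarith [hΛ0 ω, hΛK ω]
    have h1 := mul_meas_ge_le_integral_of_nonneg (μ := μ)
      (Eventually.of_forall fun ω => abs_nonneg (g z ω / z - Λ ω)) hint ε
    have h2 := h1.trans hz.le
    exact le_of_mul_le_mul_left h2 hε
  have hmZ : ∀ f : ℕ → ℝ, (∀ z, 0 ≤ f z ∧ f z ≤ 1) → Integrable (fun ω => f (Z ω)) μ := by
    intro f hf
    refine Integrable.of_bound (C := 1)
      ((measurable_of_countable f).comp hZ).aestronglyMeasurable
      (Eventually.of_forall fun ω => ?_)
    rw [Real.norm_of_nonneg (hf _).1]; exact (hf _).2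
  have hpr : ∀ s : Set Ω, 0 ≤ μ.real s ∧ μ.real s ≤ 1 := fun s =>
    ⟨measureReal_nonneg, measureReal_le_one⟩
  -- Both `g z > t` and `z * (Λ - ε) > t` force `z > t / K`, so only large `z` matter. For these, `g
  -- z / z` is within `ε` of `Λ` outside an event of probability `η`, and the total error is `η *
  -- P(Z > t / K)`.
  have hcmp : ∀ ε η : ℝ, 0 < ε → 0 < η → ∀ᶠ t in atTop,
      μ.real {ω | t < g (Z ω) ω} ≤ N ε t + η * F (K⁻¹ * t) ∧
      N (-ε) t ≤ μ.real {ω | t < g (Z ω) ω} + η * F (K⁻¹ * t) := by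
    intro ε η hε hη
    obtain ⟨z₀, hz₀⟩ := eventually_atTop.1 (hmk ε η hε hη)
    filter_upwards [eventually_gt_atTop 0, eventually_ge_atTop (K * z₀)] with t ht htz
    have hpt : ∀ z : ℕ, t < K * z →
        μ.real {ω | ε ≤ |g z ω / z - Λ ω|} ≤ η := by
      intro z hz
      refine hz₀ z ?_
      have : K * z₀ < K * z := htz.trans_lt hz
      exact_mod_cast (lt_of_mul_lt_mul_left this hK.le).le
    have hzp : ∀ z : ℕ, t < K * z → (0 : ℝ) < z := fun z hz =>
      pos_of_mul_pos_right (ht.trans hz) hK.le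
    have hFi : η * F (K⁻¹ * t) = ∫ ω', (if t < K * (Z ω') then η else 0) ∂μ := by
      have : (fun ω' => if t < K * (Z ω') then η else 0) =
          Set.indicator {ω' | K⁻¹ * t < (Z ω' : ℝ)} (fun _ => η) := by
        ext ω'
        simp only [Set.indicator_apply, Set.mem_ofPred_eq, inv_mul_lt_iff₀ hK]
      rw [this, integral_indicator_const, smul_eq_mul, hFZ, mul_comm]
      exact measurableSet_lt measurable_const (measurable_from_nat.comp hZ)
    have hi1 : Integrable (fun ω' => if t < K * (Z ω') then η else 0) μ := by
      refine Integrable.of_bound (C := η) ?_ (Eventually.of_forall fun ω => ?_)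
      · exact ((measurable_of_countable
          (fun z : ℕ => if t < K * z then η else 0)).comp hZ).aestronglyMeasurable
      · split_ifs <;> simp [hη.le, abs_of_pos hη]
    rw [hP, hFi]
    constructor
    · rw [hN, ← integral_add (hmZ (fun z => μ.real {ω | t < z * (Λ ω + ε)}) fun z => hpr _) hi1]
      refine integral_mono (hmZ (fun z => μ.real {ω | t < g z ω}) fun z => hpr _)
        ((hmZ (fun z => μ.real {ω | t < z * (Λ ω + ε)}) fun z => hpr _).add hi1) fun ω' => ?_
      simp only
      generalize Z ω' = z
      split_ifs with hz
      · refine le_trans ?_ (add_le_add_right (hpt z hz) _)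
        refine le_trans (measureReal_mono fun ω hω => ?_) (measureReal_union_le _ _)
        simp only [Set.mem_union, Set.mem_ofPred_eq] at hω ⊢
        by_contra! hcon
        have h1 := (abs_lt.1 hcon.2).2
        have h2 : g z ω / z < Λ ω + ε := by linarith
        rw [div_lt_iff₀ (hzp z hz)] at h2
        linarith [hcon.1]
      · have : {ω | t < g z ω} = ∅ := by
          ext ω
          simp only [Set.mem_ofPred_eq, Set.mem_empty_iff_false, iff_false, not_lt]
          exact (hgK z ω).trans (not_lt.1 hz)
        rw [this, measureReal_empty, add_zero]
        exact measureReal_nonneg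
    · rw [hN, ← integral_add (hmZ (fun z => μ.real {ω | t < g z ω}) fun z => hpr _) hi1]
      refine integral_mono (hmZ (fun z => μ.real {ω | t < z * (Λ ω + -ε)}) fun z => hpr _)
        ((hmZ (fun z => μ.real {ω | t < g z ω}) fun z => hpr _).add hi1) fun ω' => ?_
      simp only
      generalize Z ω' = z
      split_ifs with hz
      · refine le_trans ?_ (add_le_add_right (hpt z hz) _)
        refine le_trans (measureReal_mono fun ω hω => ?_) (measureReal_union_le _ _)
        simp only [Set.mem_union, Set.mem_ofPred_eq] at hω ⊢
        by_contra! hcon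
        have h1 := (abs_lt.1 hcon.2).1
        have h2 : Λ ω + -ε < g z ω / z := by linarith
        rw [lt_div_iff₀ (hzp z hz)] at h2
        linarith [hcon.1]
      · have : {ω | t < z * (Λ ω + -ε)} = ∅ := by
          ext ω
          simp only [Set.mem_ofPred_eq, Set.mem_empty_iff_false, iff_false, not_lt]
          refine le_trans ?_ (not_lt.1 hz)
          rw [mul_comm K]
          gcongr
          linarith [hΛK ω]
        rw [this, measureReal_empty, add_zero]
        exact measureReal_nonneg
  rw [← hJ0, Metric.tendsto_nhds]
  intro e he
  have hJn : Tendsto J (𝓝 0) (𝓝 (J 0)) := hJc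
  have hJm : Tendsto (fun ε => J (-ε)) (𝓝 0) (𝓝 (J 0)) := by
    have h := hJn.comp (show Tendsto (fun ε : ℝ => -ε) (𝓝 0) (𝓝 0) by
      simpa using (continuous_neg (G := ℝ)).tendsto 0)
    exact h
  have hgt : Tendsto (fun ε : ℝ => ε) (𝓝[>] 0) (𝓝 0) := nhdsWithin_le_nhds
  obtain ⟨ε, ⟨⟨h1, h2⟩, h3⟩, h4⟩ := ((((hJn.comp hgt).eventually_lt_const
    (show J 0 < J 0 + e / 4 by linarith)).and ((hJm.comp hgt).eventually_const_lt
    (show J 0 - e / 4 < J 0 by linarith))).and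
    (hgt.eventually_lt_const (show (0 : ℝ) < 1 by norm_num))).and eventually_mem_nhdsWithin |>.exists
  simp only [Function.comp] at h1 h2
  have h4 : 0 < ε := h4
  -- Eventually `F (t / K) ≤ M * F t`, so `η = e / 4 / M` makes the error at most `e / 4 * F t`.
  set M : ℝ := (K⁻¹) ^ (-α) + 1
  have hM : 0 < M := by positivity
  have hr := (hF.tendsto_ratio K⁻¹ (by positivity)).eventually_lt_const (lt_add_one _)
  have hNp := (hNlim ε h3).eventually_lt_const (show J ε < J ε + e / 4 by linarith)
  have hNm := (hNlim (-ε) (by linarith)).eventually_const_lt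
    (show J (-ε) - e / 4 < J (-ε) by linarith)
  filter_upwards [hcmp ε (e / 4 / M) h4 (by positivity), hr, hNp, hNm] with t ⟨h5, h6⟩ h7 h8 h9
  have hFt := hF.pos t
  have h10 : e / 4 / M * F (K⁻¹ * t) ≤ e / 4 * F t := by
    rw [div_lt_iff₀ hFt] at h7
    calc e / 4 / M * F (K⁻¹ * t) ≤ e / 4 / M * (M * F t) := by gcongr
      _ = _ := by field_simp
  rw [div_lt_iff₀ hFt] at h8
  rw [lt_div_iff₀ hFt] at h9
  rw [Real.dist_eq, abs_lt, lt_sub_iff_add_lt, sub_lt_iff_lt_add, lt_div_iff₀ (hF.pos t),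
    div_lt_iff₀ (hF.pos t)]
  constructor <;> nlinarith

end Probability

end RegularTail

/-! ### Measurability of random finite sets -/

section RandomFinset

variable {Ω : Type*} {m : MeasurableSpace Ω}

/-- There are only countably many finite subsets of `ℕ`, so the membership events determine all
events about `A`. -/
theorem measurableSet_finset_pred {A : Ω → Finset ℕ} (hA : ∀ k, MeasurableSet {ω | k ∈ A ω})
    (P : Finset ℕ → Prop) : MeasurableSet {ω | P (A ω)} := by
  have h1 : ∀ a, MeasurableSet {ω | A ω = a} := fun a => by
    have : {ω | A ω = a} = ⋂ k, {ω | k ∈ A ω ↔ k ∈ a} := by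
      ext ω; simp [Finset.ext_iff]
    rw [this]
    refine MeasurableSet.iInter fun k => ?_
    by_cases hk : k ∈ a
    · simpa [hk] using hA k
    · simp only [hk, iff_false]
      exact (hA k).compl
  have : {ω | P (A ω)} = ⋃ a ∈ {a | P a}, {ω | A ω = a} := by
    ext ω; simp
  rw [this]
  exact MeasurableSet.biUnion (Set.to_countable _) fun a _ => h1 a

theorem measurable_finset_sum_random {A : Ω → Finset ℕ} (hA : ∀ k, MeasurableSet {ω | k ∈ A ω})
    {b : ℕ → Ω → ℕ} (hb : ∀ k, Measurable (b k)) : Measurable fun ω => ∑ k ∈ A ω, b k ω := by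
  refine measurable_to_countable' fun y => ?_
  have : (fun ω => ∑ k ∈ A ω, b k ω) ⁻¹' {y} =
      ⋃ a : Finset ℕ, {ω | A ω = a} ∩ {ω | ∑ k ∈ a, b k ω = y} := by
    ext ω; simp
  rw [this]
  refine MeasurableSet.iUnion fun a => (measurableSet_finset_pred hA (· = a)).inter ?_
  exact (Finset.measurable_sum a fun k _ => hb k) (measurableSet_singleton y)

end RandomFinset

/-! ### Driving noise, labelled populations and independence of the labelling -/

namespace RCINAR

variable {Ω : Type*}

/-- The rows of the thinning array and the innovations, as a single family. -/
def sources (B : ℕ → ℕ → Ω → ℕ) (Z : ℕ → Ω → ℕ) : ℕ ⊕ ℕ → Ω → ℕ → ℕ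
  | .inl n => fun ω k => B n k ω
  | .inr n => fun ω _ => Z n ω

/-- The σ-algebra generated by the sources with index in `S`. -/
abbrev history (B : ℕ → ℕ → Ω → ℕ) (Z : ℕ → Ω → ℕ) (S : Set (ℕ ⊕ ℕ)) : MeasurableSpace Ω :=
  ⨆ s ∈ S, MeasurableSpace.comap (sources B Z s) inferInstance

/-- The sources with time index at most `n`. -/
def past (n : ℕ) : Set (ℕ ⊕ ℕ) := {s | Sum.elim id id s ≤ n}

theorem past_mono {m n : ℕ} (h : m ≤ n) : past m ⊆ past n := fun _ hs => le_trans hs h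

variable {B : ℕ → ℕ → Ω → ℕ} {Z : ℕ → Ω → ℕ}

theorem history_mono {S T : Set (ℕ ⊕ ℕ)} (h : S ⊆ T) : history B Z S ≤ history B Z T :=
  biSup_mono h

theorem measurable_thin_history {S : Set (ℕ ⊕ ℕ)} {n : ℕ} (h : .inl n ∈ S) (k : ℕ) :
    Measurable[history B Z S] (B n k) := by
  have h1 : Measurable[history B Z S] (sources B Z (.inl n)) :=
    Measurable.mono (comap_measurable _)
      (le_biSup (fun s => MeasurableSpace.comap (sources B Z s) inferInstance) h) le_rfl
  exact (measurable_pi_apply k).comp h1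

theorem measurable_innov_history {S : Set (ℕ ⊕ ℕ)} {n : ℕ} (h : .inr n ∈ S) :
    Measurable[history B Z S] (Z n) := by
  have h1 : Measurable[history B Z S] (sources B Z (.inr n)) :=
    Measurable.mono (comap_measurable _)
      (le_biSup (fun s => MeasurableSpace.comap (sources B Z s) inferInstance) h) le_rfl
  exact (measurable_pi_apply 0).comp h1

theorem measurable_sum_thin_history {S : Set (ℕ ⊕ ℕ)} {n : ℕ} (h : .inl n ∈ S) (a : Finset ℕ) :
    Measurable[history B Z S] fun ω => ∑ k ∈ a, B n k ω :=
  @Finset.measurable_sum _ _ _ _ _ _ (history B Z S) _ a fun k _ => measurable_thin_history h k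

variable [MeasurableSpace Ω] {μ : Measure Ω}

/-- The properties of thinning variables with values in `{0, 1}` and innovations that govern the
law and the tail behaviour of the epoch sums. -/
structure Driving (μ : Measure Ω) (B : ℕ → ℕ → Ω → ℕ) (Z : ℕ → Ω → ℕ) : Prop where
  measurable_thin : ∀ n k, Measurable (B n k)
  measurable_innov : ∀ n, Measurable (Z n)
  thin_le_one : ∀ n k ω, B n k ω ≤ 1
  indep : iIndepFun (sources B Z) μ
  ident : ∀ n, IdentDistrib (Z n) (Z 0) μ μ
  exchangeable : ∀ n (A : Finset ℕ) y,
    μ {ω | ∑ k ∈ A, B n k ω = y} = μ {ω | ∑ k ∈ Finset.range A.card, B n k ω = y}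
  survival : ∃ m : ℝ, 0 < m ∧ m < 1 ∧ ∀ i K k,
    μ.real {ω | ∀ l ∈ Finset.Ioc i (i + K), B l k ω = 1} ≤ m ^ K
  extinction : ∀ x : ℕ, ∃ η : ℝ, 0 < η ∧ ∀ n,
    η ≤ μ.real {ω | ∑ k ∈ Finset.range x, B n k ω = 0}
  average : ∀ i K : ℕ, ∃ Λ : Ω → ℝ, Measurable Λ ∧ (∀ ω, 0 ≤ Λ ω) ∧ (∀ ω, Λ ω ≤ 1) ∧
    Tendsto (fun z : ℕ => ∫ ω, |(∑ j ∈ Finset.range z,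
      if ∀ l ∈ Finset.Ioc i (i + K), B l (Nat.pair i j) ω = 1 then (1 : ℝ) else 0) / z - Λ ω| ∂μ)
      atTop (𝓝 0)

namespace Driving

theorem measurable_sources (hD : Driving μ B Z) (s : ℕ ⊕ ℕ) : Measurable (sources B Z s) := by
  rcases s with n | n
  · exact measurable_pi_lambda _ fun k => hD.measurable_thin n k
  · exact measurable_pi_lambda _ fun _ => hD.measurable_innov n

theorem history_le (hD : Driving μ B Z) (S : Set (ℕ ⊕ ℕ)) :
    history B Z S ≤ (inferInstance : MeasurableSpace Ω) :=
  iSup₂_le fun s _ => (hD.measurable_sources s).comap_le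

theorem indep_history (hD : Driving μ B Z) {S T : Set (ℕ ⊕ ℕ)} (h : Disjoint S T) :
    Indep (history B Z S) (history B Z T) μ :=
  indep_iSup_of_disjoint (fun s => (hD.measurable_sources s).comap_le) hD.indep.iIndep h

theorem measure_inter (hD : Driving μ B Z) {S T : Set (ℕ ⊕ ℕ)} (h : Disjoint S T) {s t : Set Ω}
    (hs : MeasurableSet[history B Z S] s) (ht : MeasurableSet[history B Z T] t) :
    μ (s ∩ t) = μ s * μ t :=
  (Indep_iff _ _ _).1 (hD.indep_history h) s t hs ht

end Driving

/-- The expectation of `f` after one step of the chain from state `x` at time `n`. -/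
noncomputable def stepMean (μ : Measure Ω) (B : ℕ → ℕ → Ω → ℕ) (Z : ℕ → Ω → ℕ) (n : ℕ)
    (f : ℕ → ℕ → ℝ≥0∞) (x : ℕ) : ℝ≥0∞ :=
  ∫⁻ ω, f (∑ k ∈ Finset.range x, B n k ω) (Z n ω) ∂μ

namespace Driving

variable [IsProbabilityMeasure μ]

theorem measurable_sum_thin (hD : Driving μ B Z) (n : ℕ) (a : Finset ℕ) :
    Measurable fun ω => ∑ k ∈ a, B n k ω :=
  Finset.measurable_sum a fun k _ => hD.measurable_thin n k

/-- A thinning row is independent of the innovation of the same time, and exchangeability leaves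
only the size of `a` in the law of the sum. -/
theorem lintegral_step (hD : Driving μ B Z) (n : ℕ) (f : ℕ → ℕ → ℝ≥0∞) (a : Finset ℕ) :
    ∫⁻ ω, f (∑ k ∈ a, B n k ω) (Z n ω) ∂μ = stepMean μ B Z n f a.card := by
  have key : ∀ a : Finset ℕ, ∫⁻ ω, f (∑ k ∈ a, B n k ω) (Z n ω) ∂μ =
      ∑' p : ℕ × ℕ, f p.1 p.2 * (μ {ω | ∑ k ∈ a, B n k ω = p.1} * μ {ω | Z n ω = p.2}) := by
    intro a
    have hm := (hD.measurable_sum_thin n a).prodMk (hD.measurable_innov n)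
    have h1 := lintegral_map (μ := μ) (f := fun p : ℕ × ℕ => f p.1 p.2)
      (measurable_of_countable _) hm
    rw [← h1, lintegral_countable']
    refine tsum_congr fun p => ?_
    congr 1
    rw [Measure.map_apply hm (measurableSet_singleton p)]
    have h2 : (fun ω => (∑ k ∈ a, B n k ω, Z n ω)) ⁻¹' {p} =
        {ω | ∑ k ∈ a, B n k ω = p.1} ∩ {ω | Z n ω = p.2} := by
      ext ω; simp [Prod.ext_iff]
    rw [h2]
    refine hD.measure_inter (S := {.inl n}) (T := {.inr n}) (by simp) ?_ ?_
    · exact measurable_sum_thin_history (Set.mem_singleton _) a (measurableSet_singleton p.1)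
    · exact measurable_innov_history (Set.mem_singleton _) (measurableSet_singleton p.2)
  rw [stepMean, key, key]
  exact tsum_congr fun p => by rw [hD.exchangeable n a]

/-- The Markov property. -/
theorem setLIntegral_step (hD : Driving μ B Z) {n : ℕ} {A : Ω → Finset ℕ}
    (hA : ∀ k, MeasurableSet[history B Z (past n)] {ω | k ∈ A ω}) {G : Set Ω}
    (hG : MeasurableSet[history B Z (past n)] G) (f : ℕ → ℕ → ℝ≥0∞) :
    ∫⁻ ω in G, f (∑ k ∈ A ω, B (n + 1) k ω) (Z (n + 1) ω) ∂μ =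
      ∫⁻ ω in G, stepMean μ B Z (n + 1) f (A ω).card ∂μ := by
  -- On each piece where `A` has a fixed value `a`, the indicator belongs to the past and the
  -- integrand to the sources at time `n + 1`, so the integral factors.
  set H : Finset ℕ → Set Ω := fun a => G ∩ {ω | A ω = a} with hH
  have hHm : ∀ a, MeasurableSet[history B Z (past n)] (H a) := fun a =>
    hG.inter (measurableSet_finset_pred hA (· = a))
  have hHm' : ∀ a, MeasurableSet (H a) := fun a => hD.history_le _ _ (hHm a)
  have hGU : G = ⋃ a, H a := by ext ω; simp [hH]
  have hdisj : Pairwise (Function.onFun Disjoint H) := fun i j hij =>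
    Set.disjoint_left.2 fun ω h1 h2 => hij (h1.2.symm.trans h2.2)
  rw [hGU, lintegral_iUnion hHm' hdisj, lintegral_iUnion hHm' hdisj]
  refine tsum_congr fun a => ?_
  have e1 : ∫⁻ ω in H a, f (∑ k ∈ A ω, B (n + 1) k ω) (Z (n + 1) ω) ∂μ =
      ∫⁻ ω in H a, f (∑ k ∈ a, B (n + 1) k ω) (Z (n + 1) ω) ∂μ :=
    setLIntegral_congr_fun (hHm' a) fun ω hω => by
      have : A ω = a := hω.2
      simp only [this]
  have e2 : ∫⁻ ω in H a, stepMean μ B Z (n + 1) f (A ω).card ∂μ =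
      ∫⁻ ω in H a, stepMean μ B Z (n + 1) f a.card ∂μ :=
    setLIntegral_congr_fun (hHm' a) fun ω hω => by
      have : A ω = a := hω.2
      simp only [this]
  rw [e1, e2, setLIntegral_const, ← hD.lintegral_step, ← lintegral_indicator (hHm' a)]
  have hdj : Disjoint (past n) ({.inl (n + 1), .inr (n + 1)} : Set (ℕ ⊕ ℕ)) := by
    rw [Set.disjoint_left]
    rintro (s | s) h1 h2
    · simp only [Set.mem_insert_iff, Sum.inl.injEq, Set.mem_singleton_iff, reduceCtorEq,
        or_false] at h2
      simp [past, h2] at h1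
    · simp only [Set.mem_insert_iff, Sum.inr.injEq, Set.mem_singleton_iff, reduceCtorEq,
        false_or] at h2
      simp [past, h2] at h1
  have hf : Measurable[history B Z {.inl (n + 1), .inr (n + 1)}]
      fun ω => f (∑ k ∈ a, B (n + 1) k ω) (Z (n + 1) ω) := by
    have h3 : Measurable[history B Z {.inl (n + 1), .inr (n + 1)}]
        fun ω => ∑ k ∈ a, B (n + 1) k ω :=
      measurable_sum_thin_history (by simp) a
    have h4 : Measurable[history B Z {.inl (n + 1), .inr (n + 1)}] (Z (n + 1)) :=
      measurable_innov_history (by simp)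
    exact (measurable_of_countable (fun p : ℕ × ℕ => f p.1 p.2)).comp (h3.prodMk h4)
  have hi : Measurable[history B Z (past n)] ((H a).indicator fun _ => (1 : ℝ≥0∞)) := by
    refine Measurable.indicator ?_ (hHm a)
    exact measurable_const
  have h5 := lintegral_mul_eq_lintegral_mul_lintegral_of_independent_measurableSpace
    (hD.history_le _) (hD.history_le _) (hD.indep_history hdj)
    (f := (H a).indicator (fun _ => 1)) (g := fun ω => f (∑ k ∈ a, B (n + 1) k ω) (Z (n + 1) ω))
    hi hf
  rw [lintegral_indicator_const (hHm' a), one_mul, mul_comm (μ (H a))] at h5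
  rw [← h5]
  refine lintegral_congr fun ω => ?_
  by_cases hω : ω ∈ H a <;> simp [hω]

end Driving

/-- A process of sets of labels of living individuals: survivors are selected by the thinning
variables at their labels, and their number increases by the innovations. -/
structure LabelProcess (B : ℕ → ℕ → Ω → ℕ) (Z : ℕ → Ω → ℕ) (A : ℕ → Ω → Finset ℕ) : Prop where
  zero : ∀ ω, A 0 ω = ∅
  adapted : ∀ n k, MeasurableSet[history B Z (past n)] {ω | k ∈ A n ω}
  card_succ : ∀ n ω, (A (n + 1) ω).card = ∑ k ∈ A n ω, B (n + 1) k ω + Z (n + 1) ω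

/-- The number of individuals alive before the innovation at time `n` is added. -/
def survivors (B : ℕ → ℕ → Ω → ℕ) (A : ℕ → Ω → Finset ℕ) : ℕ → Ω → ℕ
  | 0, _ => 0
  | n + 1, ω => ∑ k ∈ A n ω, B (n + 1) k ω

/-- The path of population sizes, together with the numbers of survivors. -/
def path (B : ℕ → ℕ → Ω → ℕ) (A : ℕ → Ω → Finset ℕ) (n : ℕ) (ω : Ω) : ℕ × ℕ :=
  ((A n ω).card, survivors B A n ω)

/-- The sum of the first `N` sizes along a path before the first regeneration after time one. -/
noncomputable def partialEpochSum (s : ℕ → ℕ × ℕ) (N : ℕ) : ℕ :=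
  open Classical in
  ∑ n ∈ Finset.range (N + 1), if 1 ≤ n ∧ ∀ i, 2 ≤ i → i ≤ n → (s i).2 ≠ 0 then (s n).1 else 0

theorem partialEpochSum_congr {s s' : ℕ → ℕ × ℕ} {N : ℕ} (h : ∀ i ≤ N, s i = s' i) :
    partialEpochSum s N = partialEpochSum s' N := by
  refine Finset.sum_congr rfl fun n hn => ?_
  have hn' : n ≤ N := Nat.lt_succ_iff.1 (Finset.mem_range.1 hn)
  have : (∀ i, 2 ≤ i → i ≤ n → (s i).2 ≠ 0) ↔ ∀ i, 2 ≤ i → i ≤ n → (s' i).2 ≠ 0 :=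
    forall_congr' fun i => imp_congr_right fun _ => forall_congr' fun hi => by
      rw [h i (hi.trans hn')]
  rw [h n hn', this]

theorem partialEpochSum_mono (s : ℕ → ℕ × ℕ) : Monotone (partialEpochSum s) := fun _ _ h =>
  Finset.sum_le_sum_of_subset (Finset.range_mono (Nat.succ_le_succ h))

namespace LabelProcess

variable {A A' : ℕ → Ω → Finset ℕ}

theorem measurable_card (hA : LabelProcess B Z A) (n : ℕ) :
    Measurable[history B Z (past n)] fun ω => (A n ω).card :=
  @measurable_to_countable' _ _ _ _ (history B Z (past n)) _ fun x =>
    measurableSet_finset_pred (hA.adapted n) (fun a => a.card = x)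

theorem measurable_survivors (hA : LabelProcess B Z A) (n : ℕ) :
    Measurable[history B Z (past n)] (survivors B A n) := by
  cases n with
  | zero => exact @measurable_const _ _ _ (history B Z (past 0)) 0
  | succ n =>
    refine measurable_finset_sum_random (m := history B Z (past (n + 1))) (fun k => ?_)
      fun k => measurable_thin_history (by simp [past]) k
    exact history_mono (past_mono n.le_succ) _ (hA.adapted n k)

theorem measurable_path (hA : LabelProcess B Z A) (n : ℕ) :
    Measurable[history B Z (past n)] (path B A n) :=
  (hA.measurable_card n).prodMk (hA.measurable_survivors n)

theorem measurable_path_of_le (hA : LabelProcess B Z A) {i n : ℕ} (h : i ≤ n) :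
    Measurable[history B Z (past n)] (path B A i) :=
  (hA.measurable_path i).mono (history_mono (past_mono h)) le_rfl

theorem measurableSet_path (hA : LabelProcess B Z A) (n : ℕ) (p : ℕ → ℕ × ℕ) :
    MeasurableSet[history B Z (past n)] {ω | ∀ i ≤ n, path B A i ω = p i} := by
  have : {ω | ∀ i ≤ n, path B A i ω = p i} = ⋂ i ∈ {i | i ≤ n}, path B A i ⁻¹' {p i} := by
    ext ω; simp
  rw [this]
  refine MeasurableSet.biInter (Set.to_countable _) fun i hi => ?_
  exact (hA.measurable_path_of_le hi) (measurableSet_singleton _)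

variable [IsProbabilityMeasure μ]

/-- Given the path up to time `n`, the law of the next pair depends on the label set only through
its cardinality, which the path records. Survivor counts are part of the path because regeneration
is read off from them. -/
theorem measure_path_eq (hD : Driving μ B Z) (hA : LabelProcess B Z A)
    (hA' : LabelProcess B Z A') (n : ℕ) (p : ℕ → ℕ × ℕ) :
    μ {ω | ∀ i ≤ n, path B A i ω = p i} = μ {ω | ∀ i ≤ n, path B A' i ω = p i} := by
  induction n with
  | zero => simp [path, hA.zero, hA'.zero, survivors]
  | succ n ih =>
    set f : ℕ → ℕ → ℝ≥0∞ := fun y z => if (y + z, y) = p (n + 1) then 1 else 0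
    have key : ∀ A, LabelProcess B Z A → μ {ω | ∀ i ≤ n + 1, path B A i ω = p i} =
        stepMean μ B Z (n + 1) f (p n).1 * μ {ω | ∀ i ≤ n, path B A i ω = p i} := by
      intro A hA
      have hG := hA.measurableSet_path n p
      set G := {ω | ∀ i ≤ n, path B A i ω = p i}
      have hG' := hD.history_le _ _ hG
      have e1 : {ω | ∀ i ≤ n + 1, path B A i ω = p i} =
          path B A (n + 1) ⁻¹' {p (n + 1)} ∩ G := by
        ext ω
        simp only [Set.mem_inter_iff, Set.mem_preimage, Set.mem_singleton_iff, G,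
          Set.mem_ofPred_eq, Nat.le_succ_iff_eq_or_le]
        constructor
        · exact fun h => ⟨h _ (Or.inl rfl), fun i hi => h i (Or.inr hi)⟩
        · rintro ⟨h1, h2⟩ i (rfl | hi)
          · exact h1
          · exact h2 i hi
      have hm : MeasurableSet (path B A (n + 1) ⁻¹' {p (n + 1)}) :=
        hD.history_le _ _ ((hA.measurable_path (n + 1)) (measurableSet_singleton _))
      have e2 := hD.setLIntegral_step (hA.adapted n) hG f
      have e3 : ∫⁻ ω in G, stepMean μ B Z (n + 1) f (A n ω).card ∂μ =
          ∫⁻ _ in G, stepMean μ B Z (n + 1) f (p n).1 ∂μ :=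
        setLIntegral_congr_fun hG' fun ω hω => by
          have : path B A n ω = p n := hω n le_rfl
          rw [← this, path]
      rw [e3, setLIntegral_const] at e2
      rw [e1, ← e2, ← Measure.restrict_apply hm, ← lintegral_indicator_one hm]
      refine lintegral_congr fun ω => ?_
      have : f (∑ k ∈ A n ω, B (n + 1) k ω) (Z (n + 1) ω) =
          if path B A (n + 1) ω = p (n + 1) then 1 else 0 := by
        simp only [f, path, hA.card_succ, survivors]
      rw [this]
      by_cases hω : path B A (n + 1) ω = p (n + 1) <;> simp [hω]
    rw [key A hA, key A' hA', ih]

theorem measure_partialEpochSum_eq (hD : Driving μ B Z) (hA : LabelProcess B Z A)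
    (hA' : LabelProcess B Z A') (N : ℕ) (t : ℝ≥0∞) :
    μ {ω | t < partialEpochSum (fun n => path B A n ω) N} =
      μ {ω | t < partialEpochSum (fun n => path B A' n ω) N} := by
  -- Restricting to times up to `N` makes the path space countable, so point masses determine the
  -- law. The extension `e` repeats the last value, which is harmless since later times are never
  -- read.
  set E : (ℕ → ℕ × ℕ) → (Fin (N + 1) → ℕ × ℕ) := fun s i => s i
  set e : (Fin (N + 1) → ℕ × ℕ) → (ℕ → ℕ × ℕ) := fun q i => q ⟨min i N, by omega⟩
  have hmeas : ∀ A, LabelProcess B Z A → Measurable fun ω => E (fun n => path B A n ω) :=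
    fun A hA => measurable_pi_lambda _ fun i =>
      (hA.measurable_path i).mono (hD.history_le _) le_rfl
  have hfib : ∀ A q, (fun ω => E (fun n => path B A n ω)) ⁻¹' {q} =
      {ω | ∀ i ≤ N, path B A i ω = e q i} := by
    intro A q
    ext ω
    simp only [Set.mem_preimage, Set.mem_singleton_iff, funext_iff, E, e, Set.mem_ofPred_eq]
    constructor
    · intro h i hi
      simpa [min_eq_left hi] using h ⟨i, by omega⟩
    · intro h i
      have := h i (by omega)
      simpa [min_eq_left (show (i : ℕ) ≤ N by omega)] using this
  have hlaw : μ.map (fun ω => E (fun n => path B A n ω)) =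
      μ.map (fun ω => E (fun n => path B A' n ω)) := by
    refine Measure.ext_of_singleton fun q => ?_
    rw [Measure.map_apply (hmeas A hA) (measurableSet_singleton q),
      Measure.map_apply (hmeas A' hA') (measurableSet_singleton q), hfib, hfib]
    exact measure_path_eq hD hA hA' N _
  have hset : ∀ A, {ω | t < partialEpochSum (fun n => path B A n ω) N} =
      (fun ω => E (fun n => path B A n ω)) ⁻¹' {q | t < partialEpochSum (e q) N} := by
    intro A
    ext ω
    simp only [Set.mem_preimage, Set.mem_ofPred_eq]
    rw [partialEpochSum_congr (s' := e (E fun n => path B A n ω))]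
    intro i hi
    simp [E, e, min_eq_left hi]
  have hms : MeasurableSet {q : Fin (N + 1) → ℕ × ℕ | t < partialEpochSum (e q) N} :=
    (Set.to_countable _).measurableSet
  rw [hset, hset, ← Measure.map_apply (hmeas A hA) hms, ← Measure.map_apply (hmeas A' hA') hms,
    hlaw]

/-- The law of the total over the first epoch does not depend on the labelling. -/
theorem measure_epoch_eq (hD : Driving μ B Z) (hA : LabelProcess B Z A)
    (hA' : LabelProcess B Z A') (t : ℝ≥0∞) :
    μ {ω | t < ⨆ N, (partialEpochSum (fun n => path B A n ω) N : ℝ≥0∞)} =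
      μ {ω | t < ⨆ N, (partialEpochSum (fun n => path B A' n ω) N : ℝ≥0∞)} := by
  have h : ∀ A, μ {ω | t < ⨆ N, (partialEpochSum (fun n => path B A n ω) N : ℝ≥0∞)} =
      ⨆ N, μ {ω | t < partialEpochSum (fun n => path B A n ω) N} := by
    intro A
    have : {ω | t < ⨆ N, (partialEpochSum (fun n => path B A n ω) N : ℝ≥0∞)} =
        ⋃ N, {ω | t < partialEpochSum (fun n => path B A n ω) N} := by
      ext ω; simp [lt_iSup_iff]
    rw [this]
    refine Monotone.measure_iUnion fun N N' hN ω hω => ?_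
    refine lt_of_lt_of_le (b := (partialEpochSum (fun n => path B A n ω) N : ℝ≥0∞)) hω ?_
    exact_mod_cast partialEpochSum_mono _ hN
  rw [h, h]
  exact iSup_congr fun N => measure_partialEpochSum_eq hD hA hA' N t

end LabelProcess

end RCINAR

/-! ### Permanent labels and the decomposition of the epoch sum by batches -/

namespace RCINAR

variable {Ω : Type*} {B : ℕ → ℕ → Ω → ℕ} {Z : ℕ → Ω → ℕ}

/-- The number of individuals that entered at time `i` and are alive at time `n`, when the
individual `j` of this batch carries the label `Nat.pair i j` for ever. -/
def batch (B : ℕ → ℕ → Ω → ℕ) (Z : ℕ → Ω → ℕ) (i n : ℕ) (ω : Ω) : ℕ :=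
  ∑ j ∈ Finset.range (Z i ω), if ∀ l ∈ Finset.Ioc i n, B l (Nat.pair i j) ω = 1 then 1 else 0

/-- The labels of the living individuals, when labels are kept for ever. -/
def living (B : ℕ → ℕ → Ω → ℕ) (Z : ℕ → Ω → ℕ) (n : ℕ) (ω : Ω) : Finset ℕ :=
  (Finset.Icc 1 n).biUnion fun i => ((Finset.range (Z i ω)).image (Nat.pair i)).filter
    fun k => ∀ l ∈ Finset.Ioc i n, B l k ω = 1

theorem batch_self (i : ℕ) (ω : Ω) : batch B Z i i ω = Z i ω := by simp [batch]

theorem batch_anti (i : ℕ) (ω : Ω) {m n : ℕ} (h : m ≤ n) : batch B Z i n ω ≤ batch B Z i m ω := by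
  refine Finset.sum_le_sum fun j _ => ?_
  split_ifs with h1 h2
  · exact le_rfl
  · exact absurd (fun l hl => h1 l (Finset.Ioc_subset_Ioc_right h hl)) h2
  · exact zero_le
  · exact le_rfl

theorem batch_le (i n : ℕ) (ω : Ω) : batch B Z i n ω ≤ Z i ω := by
  refine (Finset.sum_le_card_nsmul _ _ 1 fun j _ => ?_).trans (by simp)
  split_ifs <;> simp

theorem sum_living (n : ℕ) (ω : Ω) (f : ℕ → ℕ) :
    ∑ k ∈ living B Z n ω, f k = ∑ i ∈ Finset.Icc 1 n, ∑ j ∈ Finset.range (Z i ω),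
      if ∀ l ∈ Finset.Ioc i n, B l (Nat.pair i j) ω = 1 then f (Nat.pair i j) else 0 := by
  rw [living, Finset.sum_biUnion]
  · refine Finset.sum_congr rfl fun i _ => ?_
    rw [Finset.sum_filter, Finset.sum_image]
    intro a _ b _ h
    exact (Nat.pair_eq_pair.1 h).2
  · intro i _ i' _ hne
    refine Finset.disjoint_left.2 fun k hk hk' => hne ?_
    simp only [Finset.mem_filter, Finset.mem_image] at hk hk'
    obtain ⟨⟨j, -, rfl⟩, -⟩ := hk
    obtain ⟨⟨j', -, h⟩, -⟩ := hk'
    exact (Nat.pair_eq_pair.1 h).1.symm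

theorem card_living (n : ℕ) (ω : Ω) :
    (living B Z n ω).card = ∑ i ∈ Finset.Icc 1 n, batch B Z i n ω := by
  rw [Finset.card_eq_sum_ones, sum_living]
  rfl

/-- An individual survives the step to `n + 1` exactly when its own thinning variable is 1, which
only prolongs the run of ones along its permanent label. -/
theorem survivors_living (hB : ∀ n k ω, B n k ω ≤ 1) (n : ℕ) (ω : Ω) :
    survivors B (living B Z) (n + 1) ω = ∑ i ∈ Finset.Icc 1 n, batch B Z i (n + 1) ω := by
  rw [survivors, sum_living]
  refine Finset.sum_congr rfl fun i hi => Finset.sum_congr rfl fun j _ => ?_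
  have hi' : i ≤ n := (Finset.mem_Icc.1 hi).2
  have : (∀ l ∈ Finset.Ioc i (n + 1), B l (Nat.pair i j) ω = 1) ↔
      (∀ l ∈ Finset.Ioc i n, B l (Nat.pair i j) ω = 1) ∧ B (n + 1) (Nat.pair i j) ω = 1 := by
    constructor
    · exact fun h => ⟨fun l hl => h l (Finset.Ioc_subset_Ioc_right n.le_succ hl),
        h _ (Finset.mem_Ioc.2 ⟨by omega, le_rfl⟩)⟩
    · rintro ⟨h1, h2⟩ l hl
      obtain ⟨a, b⟩ := Finset.mem_Ioc.1 hl
      rcases Nat.le_succ_iff_eq_or_le.1 b with rfl | b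
      · exact h2
      · exact h1 l (Finset.mem_Ioc.2 ⟨a, b⟩)
  simp only [this]
  have := hB (n + 1) (Nat.pair i j) ω
  by_cases h1 : ∀ l ∈ Finset.Ioc i n, B l (Nat.pair i j) ω = 1
  · by_cases h2 : B (n + 1) (Nat.pair i j) ω = 1
    · rw [if_pos h1, if_pos ⟨h1, h2⟩, h2]
    · rw [if_pos h1, if_neg fun h => h2 h.2]; omega
  · rw [if_neg h1, if_neg fun h => h1 h.1]

theorem measurableSet_alive {S : Set (ℕ ⊕ ℕ)} {i n : ℕ} (h : ∀ l ∈ Finset.Ioc i n, .inl l ∈ S)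
    (k : ℕ) : MeasurableSet[history B Z S] {ω | ∀ l ∈ Finset.Ioc i n, B l k ω = 1} := by
  have : {ω | ∀ l ∈ Finset.Ioc i n, B l k ω = 1} =
      ⋂ l ∈ Finset.Ioc i n, B l k ⁻¹' {1} := by ext ω; simp
  rw [this]
  exact Finset.measurableSet_biInter _ fun l hl =>
    measurable_thin_history (h l hl) k (measurableSet_singleton 1)

theorem measurable_batch {S : Set (ℕ ⊕ ℕ)} {i n : ℕ} (h : ∀ l ∈ Finset.Ioc i n, .inl l ∈ S)
    (hi : .inr i ∈ S) : Measurable[history B Z S] (batch B Z i n) := by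
  refine measurable_finset_sum_random (m := history B Z S) (fun j => ?_) fun j => ?_
  · simp only [Finset.mem_range]
    exact measurable_innov_history hi (measurableSet_Ioi (a := j))
  · refine Measurable.ite (measurableSet_alive h _) ?_ ?_ <;> exact measurable_const

/-- The inequality for innovations is strict: survivors at time `n` are counted before the newcomers
of that time arrive. This makes `NoRegen` at time `n` independent of `Z n`. -/
theorem measurable_survivors_living (hB : ∀ n k ω, B n k ω ≤ 1) {S : Set (ℕ ⊕ ℕ)} {n : ℕ}
    (h : ∀ l ≤ n, .inl l ∈ S) (h' : ∀ l < n, .inr l ∈ S) :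
    Measurable[history B Z S] (survivors B (living B Z) n) := by
  cases n with
  | zero => exact @measurable_const _ _ _ (history B Z S) 0
  | succ n =>
    have : survivors B (living B Z) (n + 1) =
        fun ω => ∑ i ∈ Finset.Icc 1 n, batch B Z i (n + 1) ω :=
      funext fun ω => survivors_living hB n ω
    rw [this]
    refine @Finset.measurable_sum _ _ _ _ _ _ (history B Z S) _ _ fun i hi => ?_
    refine measurable_batch (fun l hl => h l (Finset.mem_Ioc.1 hl).2) (h' i ?_)
    exact Nat.lt_succ_of_le (Finset.mem_Icc.1 hi).2

theorem labelProcess_living (hB : ∀ n k ω, B n k ω ≤ 1) : LabelProcess B Z (living B Z) where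
  zero ω := by simp [living]
  adapted n k := by
    have : {ω | k ∈ living B Z n ω} = ⋃ i ∈ Finset.Icc 1 n, ⋃ j ∈ {j | Nat.pair i j = k},
        {ω | j < Z i ω} ∩ {ω | ∀ l ∈ Finset.Ioc i n, B l k ω = 1} := by
      ext ω
      simp only [living, Finset.mem_biUnion, Finset.mem_filter, Finset.mem_image,
        Finset.mem_range, Set.mem_ofPred_eq, Set.mem_iUnion, Set.mem_inter_iff, exists_prop]
      constructor
      · rintro ⟨i, hi, ⟨j, hj, hk⟩, h⟩
        exact ⟨i, hi, j, hk, hj, h⟩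
      · rintro ⟨i, hi, j, hk, hj, h⟩
        exact ⟨i, hi, ⟨j, hj, hk⟩, h⟩
    rw [this]
    refine Finset.measurableSet_biUnion _ fun i hi => MeasurableSet.biUnion (Set.to_countable _)
      fun j _ => MeasurableSet.inter ?_ (measurableSet_alive (fun l hl => ?_) k)
    · exact measurable_innov_history (show .inr i ∈ past n from (Finset.mem_Icc.1 hi).2)
        (measurableSet_Ioi (a := j))
    · exact (Finset.mem_Ioc.1 hl).2
  card_succ n ω := by
    have h := survivors_living (Z := Z) hB n ω
    rw [survivors] at h
    rw [h, card_living, Finset.sum_Icc_succ_top (by omega), batch_self]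

/-- There is no regeneration in `[2, n]`. -/
def NoRegen (B : ℕ → ℕ → Ω → ℕ) (Z : ℕ → Ω → ℕ) (n : ℕ) (ω : Ω) : Prop :=
  ∀ i, 2 ≤ i → i ≤ n → survivors B (living B Z) i ω ≠ 0

theorem measurableSet_noRegen (hB : ∀ n k ω, B n k ω ≤ 1) {S : Set (ℕ ⊕ ℕ)} {n : ℕ}
    (h : ∀ l ≤ n, .inl l ∈ S) (h' : ∀ l < n, .inr l ∈ S) :
    MeasurableSet[history B Z S] {ω | NoRegen B Z n ω} := by
  have : {ω | NoRegen B Z n ω} =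
      ⋂ i ∈ Finset.Icc 2 n, (survivors B (living B Z) i ⁻¹' {0})ᶜ := by
    ext ω
    simp [NoRegen]
  rw [this]
  refine Finset.measurableSet_biInter _ fun i hi => MeasurableSet.compl ?_
  have hi := (Finset.mem_Icc.1 hi).2
  exact measurable_survivors_living hB (fun l hl => h l (hl.trans hi))
    (fun l hl => h' l (hl.trans_le hi)) (measurableSet_singleton 0)

open Classical in
/-- The contribution to the epoch sum of batch `i` after `k` steps. -/
noncomputable def contribution (B : ℕ → ℕ → Ω → ℕ) (Z : ℕ → Ω → ℕ) (i k : ℕ) (ω : Ω) : ℕ :=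
  if 1 ≤ i ∧ NoRegen B Z i ω then batch B Z i (i + k) ω else 0

theorem contribution_le (i k : ℕ) (ω : Ω) : contribution B Z i k ω ≤ Z i ω := by
  rw [contribution]
  split_ifs
  · exact batch_le _ _ _
  · exact zero_le

-- A regeneration at a time in `(i, n]` means that batch `i` is extinct by then, so it contributes
-- nothing at time `n`. Hence the test up to time `i` in `contribution` has the same effect as the
-- test up to time `n`, while staying independent of `Z i`.
open Classical in
theorem sum_contribution (hB : ∀ n k ω, B n k ω ≤ 1) (n : ℕ) (ω : Ω) :
    ∑ p ∈ Finset.HasAntidiagonal.antidiagonal n, contribution B Z p.1 p.2 ω =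
      if 1 ≤ n ∧ NoRegen B Z n ω then (living B Z n ω).card else 0 := by
  have key : ∀ i ≤ n, contribution B Z i (n - i) ω =
      if 1 ≤ i ∧ NoRegen B Z n ω then batch B Z i n ω else 0 := by
    intro i hi
    rw [contribution, Nat.add_sub_cancel' hi]
    by_cases h1 : 1 ≤ i
    swap
    · rw [if_neg fun h => h1 h.1, if_neg fun h => h1 h.1]
    by_cases h2 : NoRegen B Z n ω
    · rw [if_pos ⟨h1, fun j hj hj' => h2 j hj (hj'.trans hi)⟩, if_pos ⟨h1, h2⟩]
    rw [if_neg (fun h => h2 h.2 : ¬(1 ≤ i ∧ NoRegen B Z n ω))]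
    split_ifs with h3
    · simp only [NoRegen, not_forall] at h2
      obtain ⟨j, hj2, hjn, hj0⟩ := h2
      rw [ne_eq, not_not] at hj0
      have hij : i < j := by
        by_contra hji
        exact h3.2 j hj2 (not_lt.1 hji) hj0
      obtain ⟨j, rfl⟩ : ∃ j', j = j' + 1 := ⟨j - 1, by omega⟩
      rw [survivors_living hB, Finset.sum_eq_zero_iff] at hj0
      have := hj0 i (Finset.mem_Icc.2 ⟨h1, by omega⟩)
      exact Nat.eq_zero_of_le_zero (this ▸ batch_anti i ω hjn)
    · rfl
  rw [Finset.Nat.sum_antidiagonal_eq_sum_range_succ (fun i k => contribution B Z i k ω)]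
  rw [Finset.sum_congr rfl fun i hi => key i (Nat.lt_succ_iff.1 (Finset.mem_range.1 hi))]
  rw [card_living]
  by_cases h : NoRegen B Z n ω
  · simp only [h, and_true]
    have hI : (Finset.range (n + 1)).filter (1 ≤ ·) = Finset.Icc 1 n := by
      ext i; simp only [Finset.mem_filter, Finset.mem_range, Finset.mem_Icc]; omega
    rw [← Finset.sum_filter, hI]
    split_ifs with hn
    · rfl
    · obtain rfl : n = 0 := by omega
      simp
  · simp [h]

/-- Time `n` corresponds to the antidiagonal `i + k = n`, and a series of nonnegative terms may be
summed along antidiagonals. -/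
theorem iSup_partialEpochSum (hB : ∀ n k ω, B n k ω ≤ 1) (ω : Ω) :
    ⨆ N, (partialEpochSum (fun n => path B (living B Z) n ω) N : ℝ≥0∞) =
      ∑' p : ℕ × ℕ, (contribution B Z p.1 p.2 ω : ℝ≥0∞) := by
  classical
  have h1 : ∀ N, (partialEpochSum (fun n => path B (living B Z) n ω) N : ℝ≥0∞) =
      ∑ n ∈ Finset.range (N + 1), (if 1 ≤ n ∧ NoRegen B Z n ω
        then ((living B Z n ω).card : ℝ≥0∞) else 0) := by
    intro N
    rw [partialEpochSum, Nat.cast_sum]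
    refine Finset.sum_congr rfl fun n _ => ?_
    rw [Nat.cast_ite, Nat.cast_zero]
    rfl
  simp only [h1]
  rw [← Equiv.tsum_eq (Finset.HasAntidiagonal.sigmaAntidiagonalEquivProd (A := ℕ))
    (fun p : ℕ × ℕ => (contribution B Z p.1 p.2 ω : ℝ≥0∞)), ENNReal.tsum_sigma',
    ENNReal.tsum_eq_iSup_nat]
  have hadd : ∀ f : ℕ → ℝ≥0∞, ⨆ N, ∑ n ∈ Finset.range N, f n =
      ⨆ N, ∑ n ∈ Finset.range (N + 1), f n := fun f =>
    (Monotone.iSup_nat_add (fun a b h => Finset.sum_le_sum_of_subset (Finset.range_mono h)) 1).symm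
  rw [hadd]
  · refine iSup_congr fun N => Finset.sum_congr rfl fun n _ => ?_
    rw [tsum_fintype]
    have := sum_contribution (Z := Z) hB n ω
    have h2 := congrArg (Nat.cast (R := ℝ≥0∞)) this
    rw [Nat.cast_ite, Nat.cast_zero, Nat.cast_sum] at h2
    rw [← h2, ← Finset.sum_coe_sort]
    rfl

end RCINAR

/-! ### Small moments, geometric drift and exponential decay of the epoch length -/

/-- A regularly varying tail has finite moments of small order. -/
theorem RegularTail.exists_moment {Ω : Type*} [MeasurableSpace Ω] {μ : Measure Ω}
    [IsProbabilityMeasure μ] {F : ℝ → ℝ} {α : ℝ} (hF : RegularTail F α) (hα : 0 < α)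
    {Z : Ω → ℕ} (hZ : Measurable Z) (hFZ : ∀ t, F t = μ.real {ω | t < (Z ω : ℝ)}) :
    ∃ δ : ℝ, 0 < δ ∧ δ < 1 ∧ ∫⁻ ω, ENNReal.ofReal ((Z ω : ℝ) ^ δ) ∂μ ≠ ∞ := by
  obtain ⟨C, t₀, hC, h1, hp⟩ := hF.potter (γ := α / 2) (β := α + 1) (by linarith) (by linarith)
    (by linarith)
  -- Below `α / 2` for integrability against the Potter bound at infinity, and below 1 so that `x ↦
  -- x ^ δ` is concave and subadditive.
  set δ := min 1 (α / 2) / 2 with hδ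
  have hδ0 : 0 < δ := by positivity
  have hδ1 : δ < 1 := by have := min_le_left 1 (α / 2); linarith
  have hδα : δ < α / 2 := by have := min_le_right 1 (α / 2); have : 0 < min 1 (α / 2) := by positivity
                             linarith
  have ht0 : 0 < t₀ := by linarith
  refine ⟨δ, hδ0, hδ1, ?_⟩
  rw [lintegral_rpow_eq_lintegral_meas_lt_mul μ (Eventually.of_forall fun ω => Nat.cast_nonneg _)
    (measurable_from_nat.comp hZ).aemeasurable hδ0]
  refine ENNReal.mul_ne_top ENNReal.ofReal_ne_top ?_
  rw [← Set.Ioc_union_Ioi_eq_Ioi ht0.le]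
  refine ne_top_of_le_ne_top ?_ (lintegral_union_le _ _ _)
  refine ENNReal.add_ne_top.2 ⟨?_, ?_⟩
  · have hi : IntegrableOn (fun t : ℝ => t ^ (δ - 1)) (Set.Ioc 0 t₀) :=
      (intervalIntegrable_iff_integrableOn_Ioc_of_le ht0.le).1
        (intervalIntegral.intervalIntegrable_rpow' (by linarith))
    refine ne_top_of_le_ne_top hi.lintegral_lt_top.ne ?_
    refine lintegral_mono fun t => ?_
    exact (mul_le_mul_left (prob_le_one) _).trans (one_mul _).le
  · have hi : IntegrableOn (fun t : ℝ => C * 2 * t₀ ^ (α / 2) * t ^ (δ - 1 - α / 2)) (Set.Ioi t₀) :=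
      (integrableOn_Ioi_rpow_of_lt (by linarith) ht0).const_mul _
    refine ne_top_of_le_ne_top hi.lintegral_lt_top.ne ?_
    refine setLIntegral_mono' measurableSet_Ioi fun t ht => ?_
    have ht : t₀ < t := ht
    have htp : 0 < t := by linarith
    have e1 : μ {ω | t < (Z ω : ℝ)} = ENNReal.ofReal (F t) := by
      rw [hFZ, ofReal_measureReal]
    rw [e1, ← ENNReal.ofReal_mul (hF.pos t).le]
    refine ENNReal.ofReal_le_ofReal ?_
    have h2 := hp (t / t₀) t₀ (by positivity) le_rfl
    rw [div_mul_cancel₀ _ ht0.ne'] at h2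
    have hb : 1 ≤ t / t₀ := (one_le_div ht0).2 ht.le
    have h3 : (t / t₀) ^ (-(α + 1)) ≤ (t / t₀) ^ (-(α / 2)) :=
      Real.rpow_le_rpow_of_exponent_le hb (by linarith)
    have h4 : F t ≤ C * 2 * (t / t₀) ^ (-(α / 2)) := by
      have h5 : 0 ≤ (t / t₀) ^ (-(α + 1)) := by positivity
      calc F t ≤ _ := h2
        _ ≤ C * ((t / t₀) ^ (-(α / 2)) + (t / t₀) ^ (-(α + 1))) * 1 := by
          gcongr; exact hF.le_one _
        _ ≤ C * ((t / t₀) ^ (-(α / 2)) + (t / t₀) ^ (-(α / 2))) * 1 := by gcongr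
        _ = _ := by ring
    calc F t * t ^ (δ - 1) ≤ C * 2 * (t / t₀) ^ (-(α / 2)) * t ^ (δ - 1) := by gcongr
      _ = _ := by
        rw [Real.div_rpow htp.le ht0.le, Real.rpow_neg ht0.le, div_inv_eq_mul,
          show δ - 1 - α / 2 = -(α / 2) + (δ - 1) by ring, Real.rpow_add htp]
        ring

/-- The right side is the tangent at `c` of a concave function; the bound follows from weighted
AM–GM. Integrated with `c` a bound on the mean, it yields Jensen's inequality for the power `δ`. -/
theorem rpow_le_tangent {δ c y : ℝ} (h0 : 0 < δ) (h1 : δ < 1) (hc : 0 < c) (hy : 0 ≤ y) :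
    y ^ δ ≤ c ^ δ * (1 - δ) + c ^ δ * (δ / c) * y := by
  have h := Real.geom_mean_le_arith_mean2_weighted h0.le (sub_nonneg.2 h1.le)
    (div_nonneg hy hc.le) zero_le_one (by ring)
  rw [Real.one_rpow, mul_one, mul_one, Real.div_rpow hy hc.le, div_le_iff₀ (by positivity)] at h
  calc y ^ δ ≤ _ := h
    _ = _ := by ring

namespace RCINAR

variable {Ω : Type*} [MeasurableSpace Ω] {μ : Measure Ω} [IsProbabilityMeasure μ]
  {B : ℕ → ℕ → Ω → ℕ} {Z : ℕ → Ω → ℕ}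

theorem Driving.lintegral_sum_le (hD : Driving μ B Z) {m : ℝ}
    (hm : ∀ i K k, μ.real {ω | ∀ l ∈ Finset.Ioc i (i + K), B l k ω = 1} ≤ m ^ K) (n x : ℕ) :
    ∫⁻ ω, ((∑ k ∈ Finset.range x, B (n + 1) k ω : ℕ) : ℝ≥0∞) ∂μ ≤ ENNReal.ofReal (m * x) := by
  have h1 : ∀ k, ∫⁻ ω, (B (n + 1) k ω : ℝ≥0∞) ∂μ ≤ ENNReal.ofReal m := by
    intro k
    have hs : MeasurableSet (B (n + 1) k ⁻¹' {1}) :=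
      hD.measurable_thin _ _ (measurableSet_singleton 1)
    have h2 : ∫⁻ ω, (B (n + 1) k ω : ℝ≥0∞) ∂μ = μ (B (n + 1) k ⁻¹' {1}) := by
      rw [← lintegral_indicator_one hs]
      refine lintegral_congr fun ω => ?_
      have := hD.thin_le_one (n + 1) k ω
      rcases Nat.le_one_iff_eq_zero_or_eq_one.1 this with h | h <;> simp [h]
    have h3 : B (n + 1) k ⁻¹' {1} = {ω | ∀ l ∈ Finset.Ioc n (n + 1), B l k ω = 1} := by
      ext ω; simp
    rw [h2, h3, ← ofReal_measureReal]
    refine ENNReal.ofReal_le_ofReal ((hm n 1 k).trans_eq (pow_one m))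
  simp only [Nat.cast_sum]
  have hmk : ∀ k ∈ Finset.range x, Measurable fun ω => (B (n + 1) k ω : ℝ≥0∞) := fun k _ =>
    measurable_from_nat.comp (hD.measurable_thin _ _)
  rw [lintegral_finsetSum _ hmk]
  calc _ ≤ ∑ k ∈ Finset.range x, ENNReal.ofReal m := Finset.sum_le_sum fun k _ => h1 k
    _ = _ := by
      rw [Finset.sum_const, Finset.card_range, nsmul_eq_mul, mul_comm m,
        ENNReal.ofReal_mul (Nat.cast_nonneg _), ENNReal.ofReal_natCast]

theorem Driving.lintegral_rpow_sum_le (hD : Driving μ B Z) {m δ : ℝ} (hm0 : 0 < m)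
    (hm : ∀ i K k, μ.real {ω | ∀ l ∈ Finset.Ioc i (i + K), B l k ω = 1} ≤ m ^ K)
    (h0 : 0 < δ) (h1 : δ < 1) (n x : ℕ) :
    ∫⁻ ω, ENNReal.ofReal (((∑ k ∈ Finset.range x, B (n + 1) k ω : ℕ) : ℝ) ^ δ) ∂μ ≤
      ENNReal.ofReal (m ^ δ * (x : ℝ) ^ δ) := by
  rcases Nat.eq_zero_or_pos x with rfl | hx
  · simp [Real.zero_rpow h0.ne']
  have hc : 0 < m * x := by positivity
  have ha : 0 ≤ (m * x) ^ δ * (1 - δ) := mul_nonneg (by positivity) (by linarith)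
  have hb : 0 ≤ (m * x) ^ δ * (δ / (m * x)) := by positivity
  calc _ ≤ ∫⁻ ω, (ENNReal.ofReal ((m * x) ^ δ * (1 - δ)) +
        ENNReal.ofReal ((m * x) ^ δ * (δ / (m * x))) *
          ((∑ k ∈ Finset.range x, B (n + 1) k ω : ℕ) : ℝ≥0∞)) ∂μ := by
        refine lintegral_mono fun ω => ?_
        rw [← ENNReal.ofReal_natCast, ← ENNReal.ofReal_mul hb, ← ENNReal.ofReal_add ha (by positivity)]
        exact ENNReal.ofReal_le_ofReal (rpow_le_tangent h0 h1 hc (Nat.cast_nonneg _))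
    _ = ENNReal.ofReal ((m * x) ^ δ * (1 - δ)) + ENNReal.ofReal ((m * x) ^ δ * (δ / (m * x))) *
          ∫⁻ ω, ((∑ k ∈ Finset.range x, B (n + 1) k ω : ℕ) : ℝ≥0∞) ∂μ := by
        have hmeas : Measurable fun ω => ((∑ k ∈ Finset.range x, B (n + 1) k ω : ℕ) : ℝ≥0∞) :=
          measurable_from_nat.comp (hD.measurable_sum_thin _ _)
        rw [lintegral_add_left measurable_const, lintegral_const_mul _ hmeas, lintegral_const,
          measure_univ, mul_one]
    _ ≤ ENNReal.ofReal ((m * x) ^ δ * (1 - δ)) + ENNReal.ofReal ((m * x) ^ δ * (δ / (m * x))) *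
          ENNReal.ofReal (m * x) := by
        gcongr; exact hD.lintegral_sum_le hm n x
    _ = _ := by
        rw [← ENNReal.ofReal_mul hb, ← ENNReal.ofReal_add ha (by positivity),
          ← Real.mul_rpow hm0.le (Nat.cast_nonneg _)]
        congr 1
        field_simp
        ring

/-- A geometric drift condition for the chain killed at regeneration. -/
theorem Driving.exists_drift (hD : Driving μ B Z) {δ : ℝ} (h0 : 0 < δ) (h1 : δ < 1)
    (hmom : ∫⁻ ω, ENNReal.ofReal ((Z 0 ω : ℝ) ^ δ) ∂μ ≠ ∞) :
    ∃ ε r : ℝ, 0 < ε ∧ 0 < r ∧ r < 1 ∧ ∀ n x, stepMean μ B Z (n + 1)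
      (fun y z => if y = 0 then 0 else ENNReal.ofReal (1 + ε * ((y + z : ℕ) : ℝ) ^ δ)) x ≤
        ENNReal.ofReal r * ENNReal.ofReal (1 + ε * (x : ℝ) ^ δ) := by
  obtain ⟨m, hm0, hm1, hm⟩ := hD.survival
  set d := (∫⁻ ω, ENNReal.ofReal ((Z 0 ω : ℝ) ^ δ) ∂μ).toReal with hd
  have hd0 : 0 ≤ d := ENNReal.toReal_nonneg
  set M := m ^ δ with hM
  have hM0 : 0 < M := by positivity
  have hM1 : M < 1 := Real.rpow_lt_one hm0.le hm1 h0
  -- `K` separates small from large values of `x ^ δ`: beyond it the contraction gap `(1 - M) / 2`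
  -- outweighs `d + 1`. Below it, all individuals die in one step with probability at least `η`.
  set K := 2 * (d + 1) / (1 - M) with hK
  have hK0 : 0 < K := div_pos (by linarith) (by linarith)
  obtain ⟨η, hη, hex⟩ := hD.extinction ⌈K ^ (1 / δ)⌉₊
  have hη1 : η ≤ 1 := (hex 0).trans measureReal_le_one
  -- On small states the moment part then costs at most `η / 2`, half of what extinction gains.
  set ε := η / (2 * (K + d)) with hε
  have hε0 : 0 < ε := by positivity
  have hεη : ε * (K + d) = η / 2 := by rw [hε]; field_simp
  -- Small states need `1 - η / 2`; large states need `(1 + M) / 2` together with `1 - ε`.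
  set r := max (max ((1 + M) / 2) (1 - η / 2)) (1 - ε) with hr
  have r1 : (1 + M) / 2 ≤ r := (le_max_left _ _).trans (le_max_left _ _)
  have r2 : 1 - η / 2 ≤ r := (le_max_right _ _).trans (le_max_left _ _)
  have r3 : 1 - ε ≤ r := le_max_right _ _
  have r0 : 0 < r := by linarith
  refine ⟨ε, r, hε0, r0, max_lt (max_lt (by linarith) (by linarith)) (by linarith), fun n x => ?_⟩
  set q := μ.real {ω | ∑ k ∈ Finset.range x, B (n + 1) k ω ≠ 0} with hq
  have hq0 : 0 ≤ q := measureReal_nonneg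
  have hq1 : q ≤ 1 := measureReal_le_one
  have hz : MeasurableSet {ω | ∑ k ∈ Finset.range x, B (n + 1) k ω = 0} :=
    hD.measurable_sum_thin _ _ (measurableSet_singleton 0)
  have hqη : (x : ℝ) ^ δ ≤ K → q ≤ 1 - η := by
    intro hx
    have e : q = 1 - μ.real {ω | ∑ k ∈ Finset.range x, B (n + 1) k ω = 0} :=
      probReal_compl_eq_one_sub hz
    rw [e]
    refine sub_le_sub_left ((hex (n + 1)).trans (measureReal_mono fun ω hω => ?_)) 1
    have hω : ∑ k ∈ Finset.range ⌈K ^ (1 / δ)⌉₊, B (n + 1) k ω = 0 := hω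
    rw [Finset.sum_eq_zero_iff] at hω
    refine Finset.sum_eq_zero fun k hk => hω k (Finset.range_mono ?_ hk)
    have : (x : ℝ) ≤ K ^ (1 / δ) := by
      have h2 := Real.rpow_le_rpow (by positivity) hx (show 0 ≤ 1 / δ by positivity)
      rwa [← Real.rpow_mul (Nat.cast_nonneg _), mul_one_div_cancel h0.ne', Real.rpow_one] at h2
    exact_mod_cast this.trans (Nat.le_ceil _)
  have hZd : ∫⁻ ω, ENNReal.ofReal ((Z (n + 1) ω : ℝ) ^ δ) ∂μ = ENNReal.ofReal d := by
    rw [hd, ENNReal.ofReal_toReal hmom]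
    exact ((hD.ident (n + 1)).comp (u := fun z : ℕ => ENNReal.ofReal ((z : ℝ) ^ δ))
      (measurable_of_countable _)).lintegral_eq
  have hmS : Measurable fun ω => ∑ k ∈ Finset.range x, B (n + 1) k ω :=
    hD.measurable_sum_thin _ _
  have hup : stepMean μ B Z (n + 1)
      (fun y z => if y = 0 then 0 else ENNReal.ofReal (1 + ε * ((y + z : ℕ) : ℝ) ^ δ)) x ≤
      ENNReal.ofReal q + ENNReal.ofReal ε * (ENNReal.ofReal (M * (x : ℝ) ^ δ) + ENNReal.ofReal d) := by
    rw [stepMean]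
    calc _ ≤ ∫⁻ ω, ({ω | ∑ k ∈ Finset.range x, B (n + 1) k ω = 0}ᶜ.indicator 1 ω +
          ENNReal.ofReal ε * (ENNReal.ofReal (((∑ k ∈ Finset.range x, B (n + 1) k ω : ℕ) : ℝ) ^ δ) +
            ENNReal.ofReal ((Z (n + 1) ω : ℝ) ^ δ))) ∂μ := by
          refine lintegral_mono fun ω => ?_
          simp only
          split_ifs with h
          · exact zero_le
          · rw [Set.indicator_of_mem (by exact h), Pi.one_apply, ← ENNReal.ofReal_add (by positivity)
              (by positivity), ← ENNReal.ofReal_mul hε0.le, ← ENNReal.ofReal_one,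
              ← ENNReal.ofReal_add zero_le_one (by positivity)]
            refine ENNReal.ofReal_le_ofReal ?_
            gcongr
            rw [Nat.cast_add]
            exact Real.rpow_add_le_add_rpow (Nat.cast_nonneg _) (Nat.cast_nonneg _) h0.le h1.le
      _ = μ {ω | ∑ k ∈ Finset.range x, B (n + 1) k ω = 0}ᶜ + ENNReal.ofReal ε *
          (∫⁻ ω, ENNReal.ofReal (((∑ k ∈ Finset.range x, B (n + 1) k ω : ℕ) : ℝ) ^ δ) ∂μ +
            ∫⁻ ω, ENNReal.ofReal ((Z (n + 1) ω : ℝ) ^ δ) ∂μ) := by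
          have m1 : Measurable fun ω =>
              ENNReal.ofReal (((∑ k ∈ Finset.range x, B (n + 1) k ω : ℕ) : ℝ) ^ δ) :=
            (measurable_from_nat (f := fun y : ℕ => ENNReal.ofReal ((y : ℝ) ^ δ))).comp hmS
          have m2 : Measurable fun ω => ENNReal.ofReal ((Z (n + 1) ω : ℝ) ^ δ) :=
            (measurable_from_nat (f := fun y : ℕ => ENNReal.ofReal ((y : ℝ) ^ δ))).comp
              (hD.measurable_innov _)
          rw [lintegral_add_left (measurable_one.indicator hz.compl),
            lintegral_indicator_one hz.compl, lintegral_const_mul' _ _ ENNReal.ofReal_ne_top,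
            lintegral_add_left m1]
      _ ≤ _ := by
          rw [hZd, hq, ofReal_measureReal]
          gcongr
          · exact fun ω hω => hω
          · exact hD.lintegral_rpow_sum_le hm0 hm h0 h1 n x
  refine hup.trans ?_
  rw [← ENNReal.ofReal_add (by positivity) hd0, ← ENNReal.ofReal_mul hε0.le,
    ← ENNReal.ofReal_add hq0 (by positivity), ← ENNReal.ofReal_mul r0.le]
  refine ENNReal.ofReal_le_ofReal ?_
  set u := (x : ℝ) ^ δ with hu
  have hu0 : 0 ≤ u := by positivity
  rcases le_total u K with h | h
  · have h2 := hqη h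
    have h3 : ε * (M * u + d) ≤ ε * (K + d) := by
      gcongr
      exact (mul_le_of_le_one_left hu0 hM1.le).trans h
    have h4 : 0 ≤ r * (ε * u) := by positivity
    nlinarith
  · have h2 : d + 1 ≤ (r - M) * u := by
      have h5 : (1 - M) / 2 ≤ r - M := by linarith
      calc d + 1 = (1 - M) / 2 * K := by
            rw [hK]; field_simp [(by linarith : (1 - M) ≠ 0)]
        _ ≤ _ := by
            apply mul_le_mul h5 h hK0.le
            linarith
    nlinarith

/-- The regeneration time has an exponential tail. -/
theorem Driving.exists_noRegen_decay (hD : Driving μ B Z) {F : ℝ → ℝ} {α : ℝ}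
    (hF : RegularTail F α) (hα : 0 < α) (hFZ : ∀ t, F t = μ.real {ω | t < (Z 0 ω : ℝ)}) :
    ∃ C r : ℝ, 0 < C ∧ 0 < r ∧ r < 1 ∧ ∀ n, μ.real {ω | NoRegen B Z n ω} ≤ C * r ^ n := by
  obtain ⟨δ, h0, h1, hmom⟩ := hF.exists_moment hα (hD.measurable_innov 0) hFZ
  obtain ⟨ε, r, hε, hr0, hr1, hdrift⟩ := hD.exists_drift h0 h1 hmom
  set V : ℕ → ℝ≥0∞ := fun x => ENNReal.ofReal (1 + ε * (x : ℝ) ^ δ) with hV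
  have hA := labelProcess_living (Z := Z) hD.thin_le_one
  have hG : ∀ n, MeasurableSet[history B Z (past n)] {ω | NoRegen B Z n ω} := fun n =>
    measurableSet_noRegen hD.thin_le_one (fun l hl => hl) (fun l hl => hl.le)
  have hG' : ∀ n, MeasurableSet {ω | NoRegen B Z n ω} := fun n => hD.history_le _ _ (hG n)
  set I : ℕ → ℝ≥0∞ := fun n => ∫⁻ ω in {ω | NoRegen B Z n ω}, V (living B Z n ω).card ∂μ with hI
  have hcard : ∀ n, Measurable fun ω => (living B Z n ω).card := fun n =>
    (hA.measurable_card n).mono (hD.history_le _) le_rfl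
  -- The recursion starts at time 1: there are never survivors at time 1, but regenerations count
  -- only from time 2 on.
  have hstep : ∀ n, I (n + 2) ≤ ENNReal.ofReal r * I (n + 1) := by
    intro n
    set f : ℕ → ℕ → ℝ≥0∞ := fun y z => if y = 0 then 0 else V (y + z)
    have e1 : I (n + 2) = ∫⁻ ω in {ω | NoRegen B Z (n + 1) ω},
        f (∑ k ∈ living B Z (n + 1) ω, B (n + 1 + 1) k ω) (Z (n + 1 + 1) ω) ∂μ := by
      rw [hI]
      simp only
      rw [← lintegral_indicator (hG' _), ← lintegral_indicator (hG' _)]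
      refine lintegral_congr fun ω => ?_
      have hiff : NoRegen B Z (n + 2) ω ↔ NoRegen B Z (n + 1) ω ∧
          survivors B (living B Z) (n + 2) ω ≠ 0 := by
        constructor
        · exact fun h => ⟨fun i hi hi' => h i hi (by omega), h _ (by omega) le_rfl⟩
        · rintro ⟨h1, h2⟩ i hi hi'
          rcases Nat.le_succ_iff_eq_or_le.1 hi' with rfl | h
          · exact h2
          · exact h1 i hi h
      have hs : survivors B (living B Z) (n + 2) ω =
        ∑ k ∈ living B Z (n + 1) ω, B (n + 1 + 1) k ω := rfl
      have hc : (living B Z (n + 2) ω).card = _ := hA.card_succ (n + 1) ω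
      rw [hs] at hiff
      simp only [Set.indicator, Set.mem_ofPred_eq, hc, f]
      by_cases h1 : NoRegen B Z (n + 1) ω <;>
        by_cases h2 : ∑ k ∈ living B Z (n + 1) ω, B (n + 1 + 1) k ω = 0 <;>
        [have h3 := mt hiff.1 fun h => h.2 h2; have h3 := hiff.2 ⟨h1, h2⟩;
          have h3 := mt hiff.1 fun h => h1 h.1; have h3 := mt hiff.1 fun h => h1 h.1] <;>
        simp [h1, h2, h3]
    rw [e1, hD.setLIntegral_step (hA.adapted (n + 1)) (hG (n + 1)) f, hI, ← lintegral_const_mul]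
    · exact lintegral_mono fun ω => hdrift (n + 1) _
    · exact (measurable_from_nat (f := V)).comp (hcard _)
  have hI1 : I 1 ≠ ∞ := by
    refine ne_top_of_le_ne_top ?_ (setLIntegral_le_lintegral _ _)
    have e1 : ∀ ω, (living B Z 1 ω).card = Z 1 ω := fun ω => by
      rw [card_living, Finset.Icc_self, Finset.sum_singleton, batch_self]
    simp only [e1, hV]
    have e3 := ((hD.ident 1).comp (u := fun z : ℕ => ENNReal.ofReal (1 + ε * (z : ℝ) ^ δ))
      (measurable_of_countable _)).lintegral_eq
    simp only [Function.comp_def] at e3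
    rw [e3]
    have e2 : ∀ ω, ENNReal.ofReal (1 + ε * (Z 0 ω : ℝ) ^ δ) =
        1 + ENNReal.ofReal ε * ENNReal.ofReal ((Z 0 ω : ℝ) ^ δ) := fun ω => by
      rw [ENNReal.ofReal_add zero_le_one (by positivity), ENNReal.ofReal_one,
        ENNReal.ofReal_mul hε.le]
    simp only [e2]
    rw [lintegral_add_left measurable_const, lintegral_const_mul']
    · simp [ENNReal.mul_ne_top, hmom]
    · exact ENNReal.ofReal_ne_top
  have hIn : ∀ n, I (n + 1) ≤ ENNReal.ofReal r ^ n * I 1 := by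
    intro n
    induction n with
    | zero => simp
    | succ n ih =>
      calc I (n + 2) ≤ ENNReal.ofReal r * I (n + 1) := hstep n
        _ ≤ ENNReal.ofReal r * (ENNReal.ofReal r ^ n * I 1) := by gcongr
        _ = _ := by ring
  refine ⟨max 1 ((I 1).toReal / r), r, by positivity, hr0, hr1, fun n => ?_⟩
  rcases n with _ | n
  · exact measureReal_le_one.trans (by simp)
  · have h2 : μ {ω | NoRegen B Z (n + 1) ω} ≤ I (n + 1) := by
      rw [← setLIntegral_one]
      refine lintegral_mono fun ω => ?_
      rw [hV, ← ENNReal.ofReal_one]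
      exact ENNReal.ofReal_le_ofReal (by simp; positivity)
    have h3 := ENNReal.toReal_mono (ENNReal.mul_ne_top (by simp) hI1) (h2.trans (hIn n))
    rw [ENNReal.toReal_mul, ENNReal.toReal_pow, ENNReal.toReal_ofReal hr0.le] at h3
    calc μ.real {ω | NoRegen B Z (n + 1) ω} ≤ r ^ n * (I 1).toReal := h3
      _ = (I 1).toReal / r * r ^ (n + 1) := by field_simp; ring
      _ ≤ _ := by gcongr; exact le_max_right _ _

end RCINAR

/-! ### Summable tail bounds for the contributions -/

namespace RCINAR

variable {Ω : Type*} [MeasurableSpace Ω] {μ : Measure Ω} [IsProbabilityMeasure μ]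
  {B : ℕ → ℕ → Ω → ℕ} {Z : ℕ → Ω → ℕ}

/-- The number of the first `z` potential members of batch `i` that survive until time `n`. -/
def potentialBatch (B : ℕ → ℕ → Ω → ℕ) (i n z : ℕ) (ω : Ω) : ℕ :=
  ∑ j ∈ Finset.range z, if ∀ l ∈ Finset.Ioc i n, B l (Nat.pair i j) ω = 1 then 1 else 0

omit [MeasurableSpace Ω] in
theorem potentialBatch_le (i n z : ℕ) (ω : Ω) : potentialBatch B i n z ω ≤ z := by
  refine (Finset.sum_le_card_nsmul _ _ 1 fun j _ => ?_).trans (by simp)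
  split_ifs <;> simp

omit [MeasurableSpace Ω] in
theorem measurable_potentialBatch {S : Set (ℕ ⊕ ℕ)} {i n : ℕ}
    (h : ∀ l ∈ Finset.Ioc i n, .inl l ∈ S) (z : ℕ) :
    Measurable[history B Z S] (potentialBatch B i n z) := by
  refine @Finset.measurable_sum _ _ _ _ _ _ (history B Z S) _ _ fun j _ => ?_
  refine Measurable.ite (measurableSet_alive h _) ?_ ?_ <;> exact measurable_const

namespace Driving

theorem measure_innov_lt (hD : Driving μ B Z) {F : ℝ → ℝ}
    (hFZ : ∀ t, F t = μ.real {ω | t < (Z 0 ω : ℝ)}) (i : ℕ) (t : ℝ) :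
    F t = μ.real {ω | t < (Z i ω : ℝ)} := by
  rw [hFZ, measureReal_def, measureReal_def]
  congr 1
  exact ((hD.ident i).measure_mem_eq (s := {z : ℕ | t < (z : ℝ)})
    (Set.to_countable _).measurableSet).symm

theorem measure_inter_innov (hD : Driving μ B Z) {i : ℕ} {G : Set Ω}
    (hG : MeasurableSet[history B Z {.inr i}ᶜ] G) (P : ℕ → Prop) :
    μ (G ∩ {ω | P (Z i ω)}) = μ G * μ {ω | P (Z i ω)} := by
  have h : MeasurableSet[history B Z {.inr i}] {ω | P (Z i ω)} :=
    measurable_innov_history (Set.mem_singleton _) ((Set.to_countable {x | P x}).measurableSet)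
  exact hD.measure_inter disjoint_compl_left hG h

theorem measureReal_potentialBatch_le (hD : Driving μ B Z) {m : ℝ}
    (hm : ∀ i K k, μ.real {ω | ∀ l ∈ Finset.Ioc i (i + K), B l k ω = 1} ≤ m ^ K)
    (i k z : ℕ) {s : ℝ} (hs : 0 < s) :
    μ.real {ω | s < (potentialBatch B i (i + k) z ω : ℝ)} ≤ z * m ^ k / s := by
  have hmeas : Measurable (potentialBatch B i (i + k) z) :=
    (measurable_potentialBatch (Z := Z) (S := Set.univ) (fun _ _ => Set.mem_univ _) z).mono
      (hD.history_le _) le_rfl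
  have hset : ∀ j, MeasurableSet {ω | ∀ l ∈ Finset.Ioc i (i + k), B l (Nat.pair i j) ω = 1} :=
    fun j => hD.history_le Set.univ _ (measurableSet_alive (fun _ _ => Set.mem_univ _) _)
  have hint : Integrable (fun ω => (potentialBatch B i (i + k) z ω : ℝ)) μ := by
    refine Integrable.of_bound (C := z) (measurable_from_nat.comp hmeas).aestronglyMeasurable
      (Eventually.of_forall fun ω => ?_)
    rw [Real.norm_of_nonneg (Nat.cast_nonneg _)]
    exact Nat.cast_le.2 (potentialBatch_le i (i + k) z ω)
  have hE : ∫ ω, (potentialBatch B i (i + k) z ω : ℝ) ∂μ ≤ z * m ^ k := by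
    have e : ∀ ω, (potentialBatch B i (i + k) z ω : ℝ) = ∑ j ∈ Finset.range z,
        {ω | ∀ l ∈ Finset.Ioc i (i + k), B l (Nat.pair i j) ω = 1}.indicator (fun _ => 1) ω := by
      intro ω
      rw [potentialBatch, Nat.cast_sum]
      refine Finset.sum_congr rfl fun j _ => ?_
      rw [Nat.cast_ite]
      simp [Set.indicator]
    simp only [e]
    rw [integral_finsetSum _ fun j _ => (integrable_const (1 : ℝ)).indicator (hset j)]
    calc _ ≤ ∑ j ∈ Finset.range z, m ^ k := Finset.sum_le_sum fun j _ => by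
          rw [integral_indicator_const _ (hset j), smul_eq_mul, mul_one]; exact hm i k _
      _ = _ := by simp
  have h1 := mul_meas_ge_le_integral_of_nonneg (μ := μ)
    (Eventually.of_forall fun ω => Nat.cast_nonneg (potentialBatch B i (i + k) z ω)) hint s
  rw [le_div_iff₀ hs, mul_comm]
  refine le_trans ?_ (h1.trans hE)
  refine mul_le_mul_of_nonneg_left (measureReal_mono fun ω hω => ?_) hs.le
  have hω : s < (potentialBatch B i (i + k) z ω : ℝ) := hω
  exact hω.le

/-- Either the batch is larger than `A * s`, or its size lies in `(s, A * s]` and Markov's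
inequality for the number of survivors gives the factor `A * m ^ k`. The free level `A` serves to
balance the two terms. -/
theorem measureReal_batch_le (hD : Driving μ B Z) {F : ℝ → ℝ} {m : ℝ} (hm0 : 0 < m)
    (hm : ∀ i K k, μ.real {ω | ∀ l ∈ Finset.Ioc i (i + K), B l k ω = 1} ≤ m ^ K)
    (hFZ : ∀ t, F t = μ.real {ω | t < (Z 0 ω : ℝ)}) (i k : ℕ) {s A : ℝ} (hs : 0 < s)
    (hA : 0 < A) :
    μ.real {ω | s < (batch B Z i (i + k) ω : ℝ)} ≤ F (A * s) + A * m ^ k * F s := by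
  have hmS : ∀ z, MeasurableSet[history B Z {.inr i}ᶜ]
      {ω | s < (potentialBatch B i (i + k) z ω : ℝ)} := fun z =>
    measurable_potentialBatch (fun l _ => by simp) z
      ((Set.to_countable {x : ℕ | s < (x : ℝ)}).measurableSet)
  have h1 := RegularTail.measureReal_subst_eq_integral (μ := μ) (hD.measurable_innov i)
    (E := fun z => {ω | s < (potentialBatch B i (i + k) z ω : ℝ)})
    (fun z => hD.history_le _ _ (hmS z)) fun z => hD.measure_inter_innov (hmS z) (· = z)
  have e0 : {ω | s < (batch B Z i (i + k) ω : ℝ)} =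
      {ω | ω ∈ {ω' | s < (potentialBatch B i (i + k) (Z i ω) ω' : ℝ)}} := rfl
  have hmZ : ∀ t : ℝ, MeasurableSet {ω | t < (Z i ω : ℝ)} := fun t =>
    hD.measurable_innov i ((Set.to_countable {x : ℕ | t < (x : ℝ)}).measurableSet)
  rw [e0, h1, hD.measure_innov_lt hFZ i, hD.measure_innov_lt hFZ i s]
  have e1 : μ.real {ω | A * s < (Z i ω : ℝ)} + A * m ^ k * μ.real {ω | s < (Z i ω : ℝ)} =
      ∫ ω, ({ω | A * s < (Z i ω : ℝ)}.indicator (fun _ => (1 : ℝ)) ω +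
        {ω | s < (Z i ω : ℝ)}.indicator (fun _ => A * m ^ k) ω) ∂μ := by
    rw [integral_add ((integrable_const _).indicator (hmZ _))
      ((integrable_const _).indicator (hmZ _)), integral_indicator_const _ (hmZ _),
      integral_indicator_const _ (hmZ _), smul_eq_mul, smul_eq_mul, mul_one, mul_comm (A * m ^ k)]
  rw [e1]
  refine integral_mono_of_nonneg (Eventually.of_forall fun ω => measureReal_nonneg)
    (((integrable_const _).indicator (hmZ _)).add ((integrable_const _).indicator (hmZ _)))
    (Eventually.of_forall fun ω => ?_)
  simp only [Set.indicator_apply, Set.mem_ofPred_eq]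
  have hAm : 0 ≤ A * m ^ k := by positivity
  by_cases c1 : A * s < (Z i ω : ℝ)
  · rw [if_pos c1]
    refine measureReal_le_one.trans (le_add_of_nonneg_right ?_)
    split_ifs <;> simp [hAm]
  rw [if_neg c1, zero_add]
  split_ifs with c2
  · refine (hD.measureReal_potentialBatch_le hm i k (Z i ω) hs).trans ?_
    rw [div_le_iff₀ hs]
    have : (Z i ω : ℝ) * m ^ k ≤ A * s * m ^ k := by
      gcongr
      exact not_lt.1 c1
    linarith
  · have : {ω' | s < (potentialBatch B i (i + k) (Z i ω) ω' : ℝ)} = ∅ := by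
      ext ω'
      simp only [Set.mem_ofPred_eq, Set.mem_empty_iff_false, iff_false, not_lt]
      refine le_trans ?_ (not_lt.1 c2)
      exact Nat.cast_le.2 (potentialBatch_le i (i + k) (Z i ω) ω')
    rw [this, measureReal_empty]

/-- A positive contribution needs both a large `Z i` and no regeneration up to time `i`, and these
events are independent. -/
theorem measureReal_contribution_le (hD : Driving μ B Z) {F : ℝ → ℝ}
    (hFZ : ∀ t, F t = μ.real {ω | t < (Z 0 ω : ℝ)}) (i k : ℕ) {s : ℝ} (hs : 0 < s) :
    μ.real {ω | s < (contribution B Z i k ω : ℝ)} ≤ μ.real {ω | NoRegen B Z i ω} * F s := by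
  have h1 : μ.real ({ω | NoRegen B Z i ω} ∩ {ω | s < (Z i ω : ℝ)}) =
      μ.real {ω | NoRegen B Z i ω} * F s := by
    rw [hD.measure_innov_lt hFZ i, measureReal_def, measureReal_def, measureReal_def,
      ← ENNReal.toReal_mul]
    congr 1
    refine hD.measure_inter_innov (measurableSet_noRegen hD.thin_le_one (by simp) fun l hl => ?_)
      (fun z => s < z)
    simp [hl.ne]
  rw [← h1]
  refine measureReal_mono fun ω hω => ?_
  have hω : s < (contribution B Z i k ω : ℝ) := hω
  refine ⟨?_, hω.trans_le (by exact_mod_cast contribution_le i k ω)⟩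
  rw [contribution] at hω
  split_ifs at hω with h
  · exact h.2
  · simp at hω; linarith

theorem contribution_le_batch (i k : ℕ) (ω : Ω) :
    contribution B Z i k ω ≤ batch B Z i (i + k) ω := by
  rw [contribution]
  split_ifs
  · exact le_rfl
  · exact zero_le

/-- A bound for the tails of the contributions that is summable over batches and ages. -/
theorem exists_contribution_bound (hD : Driving μ B Z) {F : ℝ → ℝ} {α : ℝ}
    (hF : RegularTail F α) (hα : 0 < α) (hFZ : ∀ t, F t = μ.real {ω | t < (Z 0 ω : ℝ)}) :
    ∃ C ρ t₀ : ℝ, 0 < C ∧ 0 < ρ ∧ ρ < 1 ∧ 1 ≤ t₀ ∧ ∀ i k : ℕ, ∀ lam t : ℝ, 0 < lam → lam ≤ 1 →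
      t₀ ≤ t → μ.real {ω | lam * t < (contribution B Z i k ω : ℝ)} ≤
        C * ρ ^ (i + k) * lam ^ (-(α + 1)) * F t := by
  obtain ⟨m, hm0, hm1, hm⟩ := hD.survival
  obtain ⟨C₁, r, hC₁, hr0, hr1, hNR⟩ := hD.exists_noRegen_decay hF hα hFZ
  -- Below `α` for Potter's bound, and below 1 so that `a ≤ a ^ γ` for `a ≤ 1`.
  set γ := min α 1 / 2 with hγ
  have hγ0 : 0 < γ := by positivity
  have hγα : γ < α := by have := min_le_left α 1; linarith
  have hγ1 : γ < 1 := by have := min_le_right α 1; linarith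
  set β := α + 1 with hβ
  obtain ⟨C, t₀, hC, ht₀, hp⟩ := hF.potter hγ0 hγα (show α < β by linarith)
  set σ := Real.sqrt m with hσ
  have hσ0 : 0 < σ := Real.sqrt_pos.2 hm0
  have hσ1 : σ < 1 := by rw [hσ, Real.sqrt_lt' one_pos]; simpa using hm1
  have hσm : σ ^ 2 = m := Real.sq_sqrt hm0.le
  set s₁ := σ ^ γ with hs₁
  have hs₁0 : 0 < s₁ := by positivity
  have hs₁1 : s₁ < 1 := Real.rpow_lt_one hσ0.le hσ1 hγ0
  set ρ₀ := max r s₁ with hρ₀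
  have hρ₀0 : 0 < ρ₀ := hr0.trans_le (le_max_left _ _)
  have hρ₀1 : ρ₀ < 1 := max_lt hr1 hs₁1
  set ρ := Real.sqrt ρ₀ with hρ
  have hρ0 : 0 < ρ := Real.sqrt_pos.2 hρ₀0
  have hρ1 : ρ < 1 := by rw [hρ, Real.sqrt_lt' one_pos]; simpa using hρ₀1
  have hρ2 : ρ ^ 2 = ρ₀ := Real.sq_sqrt hρ₀0.le
  set C' := max (2 * C * C₁) (4 * C) with hC'
  have hC'0 : 0 < C' := lt_max_of_lt_right (by positivity)
  refine ⟨C', ρ, t₀, hC'0, hρ0, hρ1, ht₀, fun i k lam t hl0 hl1 ht => ?_⟩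
  have ht0 : 0 < t := by linarith
  have hFt := hF.pos t
  set D := lam ^ (-β) * F t with hDdef
  have hD0 : 0 < D := by positivity
  have hlγ : lam ^ (-γ) ≤ lam ^ (-β) := Real.rpow_le_rpow_of_exponent_ge hl0 hl1 (by linarith)
  have hFl : F (lam * t) ≤ 2 * C * D := by
    refine (hp lam t hl0 ht).trans ?_
    calc C * (lam ^ (-γ) + lam ^ (-β)) * F t ≤ C * (lam ^ (-β) + lam ^ (-β)) * F t := by gcongr
      _ = _ := by rw [hDdef]; ring
  set P := μ.real {ω | lam * t < (contribution B Z i k ω : ℝ)} with hP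
  have hP0 : 0 ≤ P := measureReal_nonneg
  have ha : P ≤ C' * r ^ i * D := by
    calc P ≤ _ := hD.measureReal_contribution_le hFZ i k (by positivity)
      _ ≤ (C₁ * r ^ i) * (2 * C * D) := by
        gcongr
        · exact (hF.pos _).le
        · exact hNR i
      _ = (2 * C * C₁) * r ^ i * D := by ring
      _ ≤ _ := by gcongr; exact le_max_left _ _
  have hb : P ≤ C' * s₁ ^ k * D := by
    -- Here `a = m ^ (k / 2)`. The level `A = a⁻¹` turns `A * m ^ k` into `a`, so both terms of the
    -- batch bound decay at least like `a ^ γ`.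
    set a := σ ^ k with hadef
    have ha0 : 0 < a := by positivity
    have ha1 : a ≤ 1 := pow_le_one₀ hσ0.le hσ1.le
    have haγ : a ^ γ = s₁ ^ k := by
      rw [hadef, hs₁, ← Real.rpow_natCast, ← Real.rpow_natCast, ← Real.rpow_mul hσ0.le,
        ← Real.rpow_mul hσ0.le, mul_comm]
    have haa : a⁻¹ * m ^ k = a := by
      rw [← hσm, ← pow_mul, mul_comm 2 k, pow_mul, ← hadef]
      field_simp
    have haγ' : a ≤ a ^ γ := by
      simpa using Real.rpow_le_rpow_of_exponent_ge ha0 ha1 hγ1.le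
    have haβ : a ^ β ≤ a ^ γ := Real.rpow_le_rpow_of_exponent_ge ha0 ha1 (by linarith)
    have hF2 : F (a⁻¹ * (lam * t)) ≤ 2 * C * a ^ γ * D := by
      rw [← mul_assoc]
      refine (hp (a⁻¹ * lam) t (by positivity) ht).trans ?_
      rw [Real.mul_rpow (by positivity) hl0.le, Real.mul_rpow (by positivity) hl0.le,
        Real.inv_rpow ha0.le, Real.inv_rpow ha0.le, Real.rpow_neg ha0.le, Real.rpow_neg ha0.le,
        inv_inv, inv_inv]
      calc C * (a ^ γ * lam ^ (-γ) + a ^ β * lam ^ (-β)) * F t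
          ≤ C * (a ^ γ * lam ^ (-β) + a ^ γ * lam ^ (-β)) * F t := by gcongr
        _ = _ := by rw [hDdef]; ring
    calc P ≤ μ.real {ω | lam * t < (batch B Z i (i + k) ω : ℝ)} := by
          refine measureReal_mono fun ω hω => ?_
          have hω : lam * t < (contribution B Z i k ω : ℝ) := hω
          exact hω.trans_le (Nat.cast_le.2 (contribution_le_batch i k ω))
      _ ≤ F (a⁻¹ * (lam * t)) + a⁻¹ * m ^ k * F (lam * t) :=
          hD.measureReal_batch_le hm0 hm hFZ i k (by positivity) (by positivity)
      _ ≤ 2 * C * a ^ γ * D + a ^ γ * (2 * C * D) := by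
          rw [haa]
          have := (hF.pos (lam * t)).le
          gcongr
      _ = (4 * C) * s₁ ^ k * D := by rw [haγ]; ring
      _ ≤ _ := by gcongr; exact le_max_right _ _
  -- One bound decays in `i` only, the other in `k` only; their geometric mean decays in both,
  -- whence the square root in `ρ`.
  have hgoal : P ≤ C' * ρ ^ (i + k) * D := by
    rw [← pow_le_pow_iff_left₀ hP0 (by positivity) two_ne_zero]
    calc P ^ 2 = P * P := sq P
      _ ≤ (C' * r ^ i * D) * (C' * s₁ ^ k * D) := by gcongr
      _ ≤ (C' * ρ₀ ^ i * D) * (C' * ρ₀ ^ k * D) := by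
          gcongr
          · exact le_max_left _ _
          · exact le_max_right _ _
      _ = _ := by rw [← hρ2]; ring
  rw [hDdef] at hgoal
  linarith

/-- The total contribution outside large boxes is negligible. -/
theorem exists_remainder_bound (hD : Driving μ B Z) {F : ℝ → ℝ} {α : ℝ}
    (hF : RegularTail F α) (hα : 0 < α) (hFZ : ∀ t, F t = μ.real {ω | t < (Z 0 ω : ℝ)})
    {ε : ℝ} (hε0 : 0 < ε) (hε1 : ε < 1) :
    ∃ δ : Finset (ℕ × ℕ) → ℝ, Tendsto δ atTop (𝓝 0) ∧ ∀ s, ∀ᶠ t in atTop,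
      μ.real {ω | ENNReal.ofReal (ε * t) <
        ∑' p : {p // p ∉ s}, (contribution B Z p.1.1 p.1.2 ω : ℝ≥0∞)} ≤ δ s * F t := by
  obtain ⟨C, ρ, t₀, hC, hρ0, hρ1, ht₀, hbd⟩ := hD.exists_contribution_bound hF hα hFZ
  set β := α + 1 with hβ
  have hβ0 : 0 < β := by linarith
  -- The level `ε * t` is shared among the pairs `(i, k)` with weights proportional to `θ ^ (i +
  -- k)`, normalised by `κ`. Since `θ ^ β = ρ'`, the loss `w ^ (-β)` uses up half of the geometric
  -- decay `ρ ^ (i + k)`, and `ρ' ^ (i + k)` remains summable.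
  set ρ' := Real.sqrt ρ with hρ'
  have hρ'0 : 0 < ρ' := Real.sqrt_pos.2 hρ0
  have hρ'1 : ρ' < 1 := by rw [hρ', Real.sqrt_lt' one_pos]; simpa using hρ1
  have hρ'2 : ρ' ^ 2 = ρ := Real.sq_sqrt hρ0.le
  set θ := ρ' ^ (1 / β) with hθ
  have hθ0 : 0 < θ := by positivity
  have hθ1 : θ < 1 := Real.rpow_lt_one hρ'0.le hρ'1 (by positivity)
  have hθβ : θ ^ β = ρ' := by
    rw [hθ, ← Real.rpow_mul hρ'0.le, one_div_mul_cancel hβ0.ne', Real.rpow_one]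
  set κ := (1 - θ) ^ 2 with hκ
  have hκ0 : 0 < κ := by have : 0 < 1 - θ := by linarith
                         positivity
  have hκ1 : κ ≤ 1 := pow_le_one₀ (by linarith) (by linarith)
  set w : ℕ × ℕ → ℝ := fun p => κ * (θ ^ p.1 * θ ^ p.2) with hw
  have hw0 : ∀ p, 0 < w p := fun p => by positivity
  have hw1 : ∀ p, w p ≤ 1 := fun p =>
    mul_le_one₀ hκ1 (by positivity) (mul_le_one₀ (pow_le_one₀ hθ0.le hθ1.le) (by positivity)
      (pow_le_one₀ hθ0.le hθ1.le))
  have hsθ := summable_geometric_of_lt_one hθ0.le hθ1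
  have hws : Summable w := (hsθ.mul_of_nonneg hsθ (fun _ => by positivity)
    (fun _ => by positivity)).mul_left κ
  have hwt : ∑' p, w p = 1 := by
    rw [hw, tsum_mul_left, ← hsθ.tsum_mul_tsum hsθ (hsθ.mul_of_nonneg hsθ (fun _ => by positivity)
      (fun _ => by positivity)), tsum_geometric_of_lt_one hθ0.le hθ1, hκ]
    have : 1 - θ ≠ 0 := by linarith
    field_simp
  set M := C * (ε * κ) ^ (-β) with hM
  have hM0 : 0 < M := by positivity
  set u : ℕ × ℕ → ℝ := fun p => M * (ρ' ^ p.1 * ρ' ^ p.2) with hu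
  have hu0 : ∀ p, 0 ≤ u p := fun p => by positivity
  have hsρ := summable_geometric_of_lt_one hρ'0.le hρ'1
  have hus : Summable u := (hsρ.mul_of_nonneg hsρ (fun _ => by positivity)
    (fun _ => by positivity)).mul_left M
  refine ⟨fun s => ∑' p : {p // p ∉ s}, u p, tendsto_tsum_compl_atTop_zero u, fun s => ?_⟩
  filter_upwards [eventually_ge_atTop t₀] with t ht
  have ht0 : 0 < t := by linarith
  have hFt := hF.pos t
  -- If every contribution stays below its share `ε * w p * t`, the sum stays below `ε * t`, because
  -- the weights add up to 1.
  have hsub : {ω | ENNReal.ofReal (ε * t) <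
      ∑' p : {p // p ∉ s}, (contribution B Z p.1.1 p.1.2 ω : ℝ≥0∞)} ⊆
      ⋃ p : {p // p ∉ s}, {ω | ε * w p * t < (contribution B Z p.1.1 p.1.2 ω : ℝ)} := by
    intro ω hω
    by_contra hcon
    simp only [Set.mem_iUnion, Set.mem_ofPred_eq, not_exists, not_lt] at hcon
    have hω : ENNReal.ofReal (ε * t) <
      ∑' p : {p // p ∉ s}, (contribution B Z p.1.1 p.1.2 ω : ℝ≥0∞) := hω
    refine hω.not_ge ?_
    calc ∑' p : {p // p ∉ s}, (contribution B Z p.1.1 p.1.2 ω : ℝ≥0∞)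
        ≤ ∑' p : {p // p ∉ s}, ENNReal.ofReal (ε * t * w p) := by
          refine ENNReal.tsum_le_tsum fun p => ?_
          rw [← ENNReal.ofReal_natCast]
          exact ENNReal.ofReal_le_ofReal ((hcon p).trans_eq (by ring))
      _ ≤ ∑' p, ENNReal.ofReal (ε * t * w p) :=
          ENNReal.tsum_comp_le_tsum_of_injective Subtype.val_injective _
      _ = ENNReal.ofReal (∑' p, ε * t * w p) :=
          (ENNReal.ofReal_tsum_of_nonneg (fun p => by have := hw0 p; positivity)
            (hws.mul_left _)).symm
      _ = _ := by rw [tsum_mul_left, hwt, mul_one]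
  have hterm : ∀ p : ℕ × ℕ, μ.real {ω | ε * w p * t < (contribution B Z p.1 p.2 ω : ℝ)} ≤
      u p * F t := by
    intro p
    have h1 := hbd p.1 p.2 (ε * w p) t (mul_pos hε0 (hw0 p))
      (mul_le_one₀ hε1.le (hw0 p).le (hw1 p)) ht
    refine h1.trans_eq ?_
    have e1 : ε * w p = (ε * κ) * θ ^ (p.1 + p.2) := by rw [hw, pow_add]; ring
    have e2 : (θ ^ (p.1 + p.2)) ^ (-β) = (ρ' ^ (p.1 + p.2))⁻¹ := by
      rw [Real.rpow_neg (by positivity), ← hθβ, ← Real.rpow_natCast, ← Real.rpow_natCast,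
        ← Real.rpow_mul hθ0.le, ← Real.rpow_mul hθ0.le, mul_comm β]
    rw [e1, Real.mul_rpow (by positivity) (by positivity), e2, ← hρ'2, hu, hM]
    simp only
    rw [← pow_add ρ', ← pow_mul, mul_comm 2, pow_mul]
    field_simp
  have husub : Summable fun p : {p // p ∉ s} => u p := hus.subtype _
  rw [measureReal_def]
  have hU0 : 0 ≤ ∑' p : {p // p ∉ s}, u p := tsum_nonneg fun p => hu0 p
  refine ENNReal.toReal_le_of_le_ofReal (mul_nonneg hU0 hFt.le) ?_
  calc _ ≤ _ := measure_mono hsub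
    _ ≤ ∑' p : {p // p ∉ s}, μ {ω | ε * w p * t < (contribution B Z p.1.1 p.1.2 ω : ℝ)} :=
        measure_iUnion_le _
    _ ≤ ∑' p : {p // p ∉ s}, ENNReal.ofReal (u p * F t) := by
        refine ENNReal.tsum_le_tsum fun p => ?_
        rw [← ofReal_measureReal]
        exact ENNReal.ofReal_le_ofReal (hterm p)
    _ = ENNReal.ofReal (∑' p : {p // p ∉ s}, u p * F t) :=
        (ENNReal.ofReal_tsum_of_nonneg (f := fun p : {p // p ∉ s} => u p * F t)
          (fun p => mul_nonneg (hu0 p) hFt.le)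
          (husub.mul_right _)).symm
    _ = _ := by rw [tsum_mul_right]

end Driving

end RCINAR

/-! ### Tail asymptotics of the decomposed epoch sum -/

theorem measurable_real_sum {Ω : Type*} {m : MeasurableSpace Ω} (s : Finset ℕ) {f : ℕ → Ω → ℝ}
    (hf : ∀ i ∈ s, Measurable (f i)) : Measurable fun ω => ∑ i ∈ s, f i ω :=
  Finset.measurable_sum s hf

theorem measurable_real_natCast {Ω : Type*} {m : MeasurableSpace Ω} {f : Ω → ℕ} (hf : Measurable f) :
    Measurable fun ω => (f ω : ℝ) :=
  measurable_from_nat.comp hf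

namespace RCINAR

variable {Ω : Type*} [MeasurableSpace Ω] {μ : Measure Ω} [IsProbabilityMeasure μ]
  {B : ℕ → ℕ → Ω → ℕ} {Z : ℕ → Ω → ℕ}

/-- The contribution of batch `i` at ages less than `n`. -/
noncomputable def youngContribution (B : ℕ → ℕ → Ω → ℕ) (Z : ℕ → Ω → ℕ) (n i : ℕ) (ω : Ω) : ℝ :=
  ∑ k ∈ Finset.range n, (contribution B Z i k ω : ℝ)

namespace Driving

theorem youngContribution_nonneg (n i : ℕ) (ω : Ω) : 0 ≤ youngContribution B Z n i ω :=
  Finset.sum_nonneg fun _ _ => Nat.cast_nonneg _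

theorem youngContribution_le (n i : ℕ) (ω : Ω) : youngContribution B Z n i ω ≤ n * Z i ω := by
  calc youngContribution B Z n i ω ≤ ∑ k ∈ Finset.range n, (Z i ω : ℝ) :=
        Finset.sum_le_sum fun k _ => Nat.cast_le.2 (contribution_le i k ω)
    _ = _ := by simp

theorem measurableSet_noRegen_past (hD : Driving μ B Z) (i : ℕ) :
    MeasurableSet[history B Z {.inr i}ᶜ] {ω | NoRegen B Z i ω} :=
  measurableSet_noRegen hD.thin_le_one (by simp) fun l hl => by simp [hl.ne]

theorem measurable_youngContribution (hD : Driving μ B Z) {S : Set (ℕ ⊕ ℕ)} (n : ℕ) {i : ℕ}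
    (hS : ∀ l, .inl l ∈ S) (hS' : ∀ l ≤ i, .inr l ∈ S) :
    Measurable[history B Z S] (youngContribution B Z n i) := by
  refine measurable_real_sum (m := history B Z S) _ fun k _ => ?_
  have h1 : Measurable[history B Z S] (contribution B Z i k) := by
    refine Measurable.ite ?_ (measurable_batch (fun l _ => hS l) (hS' i le_rfl)) ?_
    · have h2 : MeasurableSet[history B Z S] {ω | NoRegen B Z i ω} :=
        measurableSet_noRegen hD.thin_le_one (fun l _ => hS l) fun l hl => hS' l hl.le
      by_cases h : 1 ≤ i
      · simpa only [h, true_and] using h2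
      · simp only [h, false_and]
        exact @MeasurableSet.empty _ (history B Z S)
    · exact measurable_const
  exact measurable_real_natCast h1

theorem measurable_sum_youngContribution (hD : Driving μ B Z) {S : Set (ℕ ⊕ ℕ)} (n N : ℕ)
    (hS : ∀ l, .inl l ∈ S) (hS' : ∀ l < N, .inr l ∈ S) :
    Measurable[history B Z S] fun ω => ∑ i ∈ Finset.range N, youngContribution B Z n i ω :=
  measurable_real_sum (m := history B Z S) _ fun _ hi =>
    hD.measurable_youngContribution n hS fun l hl => hS' l (hl.trans_lt (Finset.mem_range.1 hi))

theorem measurable_sum_potentialBatch {S : Set (ℕ ⊕ ℕ)} (hS : ∀ l, .inl l ∈ S) (i n z : ℕ) :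
    Measurable[history B Z S] fun ω =>
      ∑ k ∈ Finset.range n, (potentialBatch B i (i + k) z ω : ℝ) :=
  measurable_real_sum (m := history B Z S) _ fun _ _ =>
    measurable_real_natCast (measurable_potentialBatch (fun l _ => hS l) z)

/-- The fraction of a large batch that survives `k` steps is close to `Λ k`, and the event of no
earlier regeneration is independent of `Z i`. So `tail_subst` applies with the sum of the `Λ k`
restricted to this event as multiplier. -/
theorem exists_tail_youngContribution (hD : Driving μ B Z) {F : ℝ → ℝ} {α : ℝ}
    (hF : RegularTail F α) (hα : 0 < α) (hFZ : ∀ t, F t = μ.real {ω | t < (Z 0 ω : ℝ)})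
    (n i : ℕ) : ∃ a : ℝ, Tendsto (fun t => μ.real {ω | t < youngContribution B Z n i ω} / F t)
      atTop (𝓝 a) := by
  classical
  choose Λ hΛm hΛ0 hΛ1 hΛ using fun k => hD.average i k
  have hEm := hD.measurableSet_noRegen_past i
  by_cases hi : 1 ≤ i
  swap
  · refine ⟨0, tendsto_const_nhds.congr' ?_⟩
    filter_upwards [eventually_ge_atTop 0] with t ht
    have : {ω | t < youngContribution B Z n i ω} = ∅ := by
      ext ω
      simp only [youngContribution, contribution, hi, false_and, if_false, Nat.cast_zero,
        Finset.sum_const_zero, Set.mem_ofPred_eq, Set.mem_empty_iff_false, iff_false, not_lt, ht]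
    rw [this, measureReal_empty, zero_div]
  set E : Set Ω := {ω | NoRegen B Z i ω} with hE
  set g : ℕ → Ω → ℝ := fun z => E.indicator fun ω =>
    ∑ k ∈ Finset.range n, (potentialBatch B i (i + k) z ω : ℝ) with hg
  set L : Ω → ℝ := E.indicator fun ω => ∑ k ∈ Finset.range n, Λ k ω with hL
  have hgm : ∀ z, Measurable[history B Z {.inr i}ᶜ] (g z) := fun z => by
    refine Measurable.indicator ?_ hEm
    exact measurable_sum_potentialBatch (by simp) i n z
  have hLm : Measurable L :=
    (Finset.measurable_sum _ fun k _ => hΛm k).indicator (hD.history_le _ _ hEm)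
  have hgZ : ∀ ω, youngContribution B Z n i ω = g (Z i ω) ω := by
    intro ω
    simp only [youngContribution, contribution, hi, true_and, hg, Set.indicator, hE,
      Set.mem_ofPred_eq]
    split_ifs
    · rfl
    · simp
  have hpn : ∀ z ω, 0 ≤ ∑ k ∈ Finset.range n, (potentialBatch B i (i + k) z ω : ℝ) := fun z ω =>
    Finset.sum_nonneg fun _ _ => Nat.cast_nonneg _
  have hpl : ∀ z ω, ∑ k ∈ Finset.range n, (potentialBatch B i (i + k) z ω : ℝ) ≤ (n + 1) * z := by
    intro z ω
    calc _ ≤ ∑ k ∈ Finset.range n, (z : ℝ) :=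
          Finset.sum_le_sum fun k _ => Nat.cast_le.2 (potentialBatch_le _ _ _ _)
      _ = n * z := by simp
      _ ≤ _ := by nlinarith [Nat.cast_nonneg (α := ℝ) z]
  have hmP : ∀ k z, Measurable (potentialBatch B i (i + k) z) := fun k z =>
    (measurable_potentialBatch (Z := Z) (S := Set.univ) (fun _ _ => Set.mem_univ _) z).mono
      (hD.history_le _) le_rfl
  have hlim : Tendsto (fun z : ℕ => ∫ ω, |g z ω / z - L ω| ∂μ) atTop (𝓝 0) := by
    have h1 : Tendsto (fun z : ℕ => ∑ k ∈ Finset.range n,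
        ∫ ω, |(potentialBatch B i (i + k) z ω : ℝ) / z - Λ k ω| ∂μ) atTop
        (𝓝 (∑ k ∈ Finset.range n, 0)) := by
      refine tendsto_finsetSum _ fun k _ => (hΛ k).congr fun z => ?_
      refine integral_congr_ae (Eventually.of_forall fun ω => ?_)
      simp [potentialBatch]
    rw [Finset.sum_const_zero] at h1
    refine squeeze_zero (fun z => integral_nonneg fun ω => abs_nonneg _) (fun z => ?_) h1
    have hint : ∀ k ∈ Finset.range n,
        Integrable (fun ω => |(potentialBatch B i (i + k) z ω : ℝ) / z - Λ k ω|) μ := by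
      intro k _
      refine Integrable.of_bound (C := 2) (Measurable.aestronglyMeasurable ?_)
        (Eventually.of_forall fun ω => ?_)
      · have h2 : Measurable fun ω => (potentialBatch B i (i + k) z ω : ℝ) :=
          measurable_real_natCast (hmP k z)
        have := hΛm k
        fun_prop
      · have h2 : (potentialBatch B i (i + k) z ω : ℝ) / z ≤ 1 :=
          div_le_one_of_le₀ (Nat.cast_le.2 (potentialBatch_le _ _ _ _)) (Nat.cast_nonneg _)
        have h3 : 0 ≤ (potentialBatch B i (i + k) z ω : ℝ) / z := by positivity
        rw [Real.norm_eq_abs, abs_abs, abs_le]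
        constructor <;> linarith [hΛ0 k ω, hΛ1 k ω]
    rw [← integral_finsetSum _ hint]
    refine integral_mono_of_nonneg (Eventually.of_forall fun ω => abs_nonneg _)
      (integrable_finsetSum _ hint) (Eventually.of_forall fun ω => ?_)
    simp only [hg, hL, Set.indicator]
    split_ifs
    · rw [Finset.sum_div, ← Finset.sum_sub_distrib]
      exact Finset.abs_sum_le_sum_abs _ _
    · rw [zero_div, sub_zero, abs_zero]
      exact Finset.sum_nonneg fun _ _ => abs_nonneg _
  refine ⟨∫ ω, L ω ^ α ∂μ, ?_⟩
  simp only [hgZ]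
  -- The bound is `n + 1` rather than `n` because `tail_subst` needs a positive constant also for `n
  -- = 0`.
  refine hF.tail_subst hα (hD.measurable_innov i) (hD.measure_innov_lt hFZ i)
    (fun z => (hgm z).mono (hD.history_le _) le_rfl) (K := n + 1) (by positivity) ?_ ?_ ?_ hLm ?_ ?_
    hlim
  · exact fun z ω => Set.indicator_nonneg (fun ω _ => hpn z ω) ω
  · exact fun z ω => Set.indicator_le' (fun ω _ => hpl z ω) (fun ω _ => by positivity) ω
  · exact fun t z => hD.measure_inter_innov (hgm z measurableSet_Ioi) (· = z)
  · exact fun ω => Set.indicator_nonneg (fun ω _ => Finset.sum_nonneg fun k _ => hΛ0 k ω) ω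
  · intro ω
    have hn : (0 : ℝ) ≤ n + 1 := by positivity
    refine Set.indicator_apply_le' (fun _ => ?_) fun _ => hn
    calc ∑ k ∈ Finset.range n, Λ k ω ≤ ∑ k ∈ Finset.range n, 1 :=
          Finset.sum_le_sum fun k _ => hΛ1 k ω
      _ ≤ _ := by simp

/-- Batches share thinning variables, so they are not independent. But batch `N` contributes at most
`n * Z N`, and `Z N` is independent of all earlier batches; joint exceedance therefore has
probability `o(F t)`, and the tails add. -/
theorem exists_tail_sum_youngContribution (hD : Driving μ B Z) {F : ℝ → ℝ} {α : ℝ}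
    (hF : RegularTail F α) (hα : 0 < α) (hFZ : ∀ t, F t = μ.real {ω | t < (Z 0 ω : ℝ)})
    (n N : ℕ) : ∃ a : ℝ, Tendsto (fun t => μ.real
      {ω | t < ∑ i ∈ Finset.range N, youngContribution B Z n i ω} / F t) atTop (𝓝 a) := by
  induction N with
  | zero =>
    refine ⟨0, tendsto_const_nhds.congr' ?_⟩
    filter_upwards [eventually_ge_atTop 0] with t ht
    simp [not_lt.2 ht]
  | succ N ih =>
    obtain ⟨a, ha⟩ := ih
    obtain ⟨b, hb⟩ := hD.exists_tail_youngContribution hF hα hFZ n N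
    refine ⟨a + b, ?_⟩
    simp only [Finset.sum_range_succ]
    have hUm : Measurable[history B Z {.inr N}ᶜ]
        fun ω => ∑ i ∈ Finset.range N, youngContribution B Z n i ω :=
      hD.measurable_sum_youngContribution n N (by simp) fun l hl => by simp [hl.ne]
    refine hF.tail_add ?_ (fun ω => Finset.sum_nonneg fun i _ => youngContribution_nonneg n i ω)
      (fun ω => youngContribution_nonneg n N ω) ha hb fun ε hε => ?_
    · exact (hD.measurable_youngContribution n (S := Set.univ) (by simp) (by simp)).mono
        (hD.history_le _) le_rfl
    · set U := fun ω => ∑ i ∈ Finset.range N, youngContribution B Z n i ω with hU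
      set l : ℝ := ε / (n + 1) with hl
      have hl0 : 0 < l := by positivity
      have hU0 : Tendsto (fun t => μ.real {ω | ε * t < U ω}) atTop (𝓝 0) := by
        have h1 : Tendsto (fun t : ℝ => ε * t) atTop atTop := tendsto_id.const_mul_atTop hε
        have h2 := (ha.mul (hF.tendsto_zero hα)).comp h1
        rw [mul_zero] at h2
        refine h2.congr fun t => ?_
        have := (hF.pos (ε * t)).ne'
        simp only [Function.comp]
        field_simp
        rfl
      have h3 := hU0.mul (hF.tendsto_ratio l hl0)
      rw [zero_mul] at h3
      refine squeeze_zero (fun t => div_nonneg measureReal_nonneg (hF.pos t).le) (fun t => ?_) h3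
      rw [← mul_div_assoc]
      refine div_le_div_of_nonneg_right ?_ (hF.pos t).le
      have h4 := hD.measure_inter_innov (i := N) (G := {ω | ε * t < U ω}) (hUm measurableSet_Ioi)
        (fun z => l * t < (z : ℝ))
      rw [hD.measure_innov_lt hFZ N, measureReal_def, measureReal_def, measureReal_def,
        ← ENNReal.toReal_mul, ← h4]
      refine measureReal_mono fun ω hω => ?_
      obtain ⟨h5, h6⟩ : ε * t < U ω ∧ ε * t < youngContribution B Z n N ω := hω
      refine ⟨h5, ?_⟩
      have h7 := h6.trans_le (youngContribution_le n N ω)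
      have h8 : ε * t < (n + 1) * (Z N ω : ℝ) := by
        nlinarith [Nat.cast_nonneg (α := ℝ) (Z N ω)]
      show l * t < (Z N ω : ℝ)
      rw [hl, div_mul_eq_mul_div, div_lt_iff₀ (by positivity)]
      linarith

/-- The tail of the epoch sum is comparable to the tail of the innovations. -/
theorem exists_tail_contribution (hD : Driving μ B Z) {F : ℝ → ℝ} {α : ℝ}
    (hF : RegularTail F α) (hα : 0 < α) (hFZ : ∀ t, F t = μ.real {ω | t < (Z 0 ω : ℝ)}) :
    ∃ c : ℝ, 0 < c ∧ Tendsto (fun t => μ.real {ω | ENNReal.ofReal t <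
      ∑' p : ℕ × ℕ, (contribution B Z p.1 p.2 ω : ℝ≥0∞)} / F t) atTop (𝓝 c) := by
  set box : ℕ → Finset (ℕ × ℕ) := fun n => Finset.range n ×ˢ Finset.range n with hbox
  have hboxm : Monotone box := fun a b h =>
    Finset.product_subset_product (Finset.range_mono h) (Finset.range_mono h)
  have hboxt : Tendsto box atTop atTop := by
    refine tendsto_atTop_finset_of_monotone hboxm fun p => ⟨p.1 + p.2 + 1, ?_⟩
    simp only [hbox, Finset.mem_product, Finset.mem_range]
    omega
  set W : ℕ → Ω → ℝ≥0∞ := fun n ω => ∑ p ∈ box n, (contribution B Z p.1 p.2 ω : ℝ≥0∞) with hW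
  have hWy : ∀ n ω, W n ω =
      ENNReal.ofReal (∑ i ∈ Finset.range n, youngContribution B Z n i ω) := by
    intro n ω
    simp only [hW, hbox, youngContribution, Finset.sum_product]
    rw [ENNReal.ofReal_sum_of_nonneg fun i _ => Finset.sum_nonneg fun _ _ => Nat.cast_nonneg _]
    refine Finset.sum_congr rfl fun i _ => ?_
    rw [ENNReal.ofReal_sum_of_nonneg fun _ _ => Nat.cast_nonneg _]
    exact Finset.sum_congr rfl fun k _ => (ENNReal.ofReal_natCast _).symm
  choose a ha using fun n => hD.exists_tail_sum_youngContribution hF hα hFZ n n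
  have hq : ∀ n, Tendsto (fun t => μ.real {ω | ENNReal.ofReal t < W n ω} / F t) atTop
      (𝓝 (a n)) := by
    intro n
    refine (ha n).congr' ?_
    filter_upwards [eventually_ge_atTop 0] with t ht
    congr 2
    ext ω
    simp only [Set.mem_ofPred_eq, hWy]
    rw [ENNReal.ofReal_lt_ofReal_iff_of_nonneg ht]
  set p : ℝ → ℝ := fun t => μ.real {ω | ENNReal.ofReal t <
    ∑' p : ℕ × ℕ, (contribution B Z p.1 p.2 ω : ℝ≥0∞)} with hpdef
  set q : ℕ → ℝ → ℝ := fun n t => μ.real {ω | ENNReal.ofReal t < W n ω} with hqdef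
  have hmono : ∀ n t, q n t ≤ q (n + 1) t := by
    refine fun n t => measureReal_mono fun ω hω => ?_
    have hω : ENNReal.ofReal t < W n ω := hω
    exact hω.trans_le (Finset.sum_le_sum_of_subset (hboxm n.le_succ))
  have hle : ∀ n t, q n t ≤ p t := by
    refine fun n t => measureReal_mono fun ω hω => ?_
    have hω : ENNReal.ofReal t < W n ω := hω
    exact hω.trans_le (ENNReal.sum_le_tsum _)
  have hp : ∀ ε : ℝ, 0 < ε → ε < 1 → ∃ δ : ℕ → ℝ, Tendsto δ atTop (𝓝 0) ∧
      ∀ n, ∀ᶠ t in atTop, p t ≤ q n ((1 - ε) * t) + δ n * F t := by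
    intro ε hε0 hε1
    obtain ⟨δ, hδ, hR⟩ := hD.exists_remainder_bound hF hα hFZ hε0 hε1
    refine ⟨fun n => δ (box n), hδ.comp hboxt, fun n => ?_⟩
    filter_upwards [hR (box n), eventually_ge_atTop 0] with t h1 ht
    refine le_trans ?_ (add_le_add_right h1 _)
    refine le_trans (measureReal_mono fun ω hω => ?_) (measureReal_union_le _ _)
    have hω : ENNReal.ofReal t < ∑' p : ℕ × ℕ, (contribution B Z p.1 p.2 ω : ℝ≥0∞) := hω
    have hsplit : W n ω + ∑' p : {p // p ∉ box n}, (contribution B Z p.1.1 p.1.2 ω : ℝ≥0∞) =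
        ∑' p : ℕ × ℕ, (contribution B Z p.1 p.2 ω : ℝ≥0∞) :=
      ENNReal.sum_add_tsum_compl (box n) fun p : ℕ × ℕ => (contribution B Z p.1 p.2 ω : ℝ≥0∞)
    rw [← hsplit] at hω
    by_contra hcon
    simp only [Set.mem_union, Set.mem_ofPred_eq, not_or, not_lt] at hcon
    refine hω.not_ge ((add_le_add hcon.1 hcon.2).trans_eq ?_)
    rw [← ENNReal.ofReal_add (by nlinarith) (by positivity), ← add_mul, sub_add_cancel, one_mul]
  obtain ⟨c, hc, hlim⟩ := hF.tendsto_of_truncation hmono hle hq hp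
  refine ⟨c, zero_lt_one.trans_le (le_trans ?_ (hc 2)), hlim⟩
  -- The box of side 2 contains the pair `(1, 0)`, whose contribution is `Z 1`, so the truncated
  -- tail is at least `F`.
  refine ge_of_tendsto (hq 2) ?_
  filter_upwards [eventually_ge_atTop 0] with t ht
  rw [one_le_div (hF.pos t), hD.measure_innov_lt hFZ 1]
  refine measureReal_mono fun ω hω => ?_
  have hω : t < (Z 1 ω : ℝ) := hω
  have h1 : contribution B Z 1 0 ω = Z 1 ω := by
    rw [contribution, if_pos ⟨le_rfl, fun i hi hi' => by omega⟩, add_zero, batch_self]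
  have h2 : (contribution B Z 1 0 ω : ℝ≥0∞) ≤ W 2 ω :=
    Finset.single_le_sum (f := fun p : ℕ × ℕ => (contribution B Z p.1 p.2 ω : ℝ≥0∞))
      (a := (1, 0)) (fun _ _ => zero_le) (by simp [hbox])
  refine lt_of_lt_of_le ?_ h2
  rw [h1, ← ENNReal.ofReal_natCast]
  exact (ENNReal.ofReal_lt_ofReal_iff_of_nonneg ht).2 hω

end Driving

end RCINAR

/-! ### From conditional Bernoulli laws to independent sources -/

theorem ProbabilityTheory.iIndepFun.integral_finset_prod {Ω ι : Type*} [MeasurableSpace Ω]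
    {μ : Measure Ω} {X : ι → Ω → ℝ} (h : iIndepFun X μ) (hm : ∀ i, Measurable (X i))
    (s : Finset ι) : ∫ ω, ∏ i ∈ s, X i ω ∂μ = ∏ i ∈ s, ∫ ω, X i ω ∂μ := by
  have h1 := (h.precomp (g := fun i : s => (i : ι)) Subtype.val_injective)
  have h2 := h1.integral_fun_prod_eq_prod_integral fun i => (hm i).aestronglyMeasurable
  rw [← Finset.prod_coe_sort s, ← h2]
  refine integral_congr_ae (Eventually.of_forall fun ω => ?_)
  exact (Finset.prod_coe_sort s fun i => X i ω).symm

namespace RCINAR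

theorem measurable_bernoulliWeight (b : ℕ) : Measurable fun p => bernoulliWeight p b := by
  unfold bernoulliWeight
  split_ifs <;> fun_prop

variable {Ω : Type*} [MeasurableSpace Ω] {μ : Measure Ω} [IsProbabilityMeasure μ]
  {φ : ℤ → Ω → ℝ} {Z : ℤ → Ω → ℕ} {B : ℤ → ℕ → Ω → ℕ}

namespace Model

theorem measurableSet_cylinder (hM : Model μ φ Z B) (S : Finset (ℤ × ℕ)) (b : ℤ × ℕ → ℕ) :
    MeasurableSet {ω | ∀ i ∈ S, B i.1 i.2 ω = b i} := by
  have : {ω | ∀ i ∈ S, B i.1 i.2 ω = b i} = ⋂ i ∈ S, B i.1 i.2 ⁻¹' {b i} := by ext ω; simp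
  rw [this]
  exact Finset.measurableSet_biInter _ fun i _ => hM.measurable_thin _ _ (measurableSet_singleton _)

theorem environmentSigma_le (hM : Model μ φ Z B) :
    environmentSigma φ ≤ (inferInstance : MeasurableSpace Ω) :=
  (measurable_pi_lambda _ hM.measurable_coeff).comap_le

theorem measurable_coeff_environment (n : ℤ) : Measurable[environmentSigma φ] (φ n) := by
  have h : Measurable[environmentSigma φ] (fun ω n => φ n ω) := comap_measurable _
  exact (measurable_pi_apply n).comp h

/-- Integration of a function of the environment over a cylinder. -/
theorem integral_cylinder (hM : Model μ φ Z B) (S : Finset (ℤ × ℕ)) (b : ℤ × ℕ → ℕ) {g : Ω → ℝ}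
    (hg : Measurable[environmentSigma φ] g) {C : ℝ} (hC : ∀ ω, |g ω| ≤ C) :
    ∫ ω, g ω * ({ω | ∀ i ∈ S, B i.1 i.2 ω = b i}).indicator (fun _ => (1 : ℝ)) ω ∂μ =
      ∫ ω, g ω * ∏ i ∈ S, bernoulliWeight (φ i.1 ω) (b i) ∂μ := by
  have hint : Integrable (({ω | ∀ i ∈ S, B i.1 i.2 ω = b i}).indicator fun _ => (1 : ℝ)) μ :=
    (integrable_const _).indicator (hM.measurableSet_cylinder S b)
  have h1 := condExp_stronglyMeasurable_mul_of_bound hM.environmentSigma_le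
    (Measurable.stronglyMeasurable hg) hint C (Eventually.of_forall hC)
  have h2 := integral_condExp (μ := μ) (m := environmentSigma φ) hM.environmentSigma_le
    (f := g * ({ω | ∀ i ∈ S, B i.1 i.2 ω = b i}).indicator fun _ => (1 : ℝ))
  rw [integral_congr_ae h1] at h2
  refine h2.symm.trans (integral_congr_ae ?_)
  filter_upwards [hM.thin_cond S b] with ω hω
  rw [Pi.mul_apply, hω]

theorem measureReal_cylinder (hM : Model μ φ Z B) (S : Finset (ℤ × ℕ)) (b : ℤ × ℕ → ℕ) :
    μ.real {ω | ∀ i ∈ S, B i.1 i.2 ω = b i} =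
      ∫ ω, ∏ i ∈ S, bernoulliWeight (φ i.1 ω) (b i) ∂μ := by
  have h := hM.integral_cylinder S b (g := fun _ => 1) measurable_const (C := 1) (by simp)
  simp only [one_mul] at h
  rw [← h, integral_indicator_const _ (hM.measurableSet_cylinder S b), smul_eq_mul, mul_one]

/-- Values of at least 2 have Bernoulli weight zero. The model only forces this almost surely,
whence the clipping below. -/
theorem ae_thin_le_one (hM : Model μ φ Z B) : ∀ᵐ ω ∂μ, ∀ n k, B n k ω ≤ 1 := by
  rw [ae_all_iff]
  intro n
  rw [ae_all_iff]
  intro k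
  have h : ∀ b : ℕ, 2 ≤ b → ∀ᵐ ω ∂μ, B n k ω ≠ b := by
    intro b hb
    have h1 := hM.measureReal_cylinder {(n, k)} fun _ => b
    simp only [Finset.mem_singleton, forall_eq, Finset.prod_singleton, bernoulliWeight,
      show b ≠ 1 by omega, show b ≠ 0 by omega, if_false, integral_zero] at h1
    rw [measureReal_eq_zero_iff] at h1
    exact measure_eq_zero_iff_ae_notMem.1 h1
  have h2 : ∀ᵐ ω ∂μ, ∀ b : ℕ, 2 ≤ b → B n k ω ≠ b := by
    rw [ae_all_iff]
    intro b
    by_cases hb : 2 ≤ b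
    · filter_upwards [h b hb] with ω hω _ using hω
    · exact Eventually.of_forall fun ω h => absurd h hb
  filter_upwards [h2] with ω hω
  by_contra hcon
  exact hω (B n k ω) (by omega) rfl

/-- The thinning variables may be assumed to be at most one everywhere. -/
theorem clip (hM : Model μ φ Z B) : Model μ φ Z fun n k ω => min (B n k ω) 1 := by
  have hae : ∀ᵐ ω ∂μ, ∀ n k, min (B n k ω) 1 = B n k ω := by
    filter_upwards [hM.ae_thin_le_one] with ω hω n k using min_eq_left (hω n k)
  refine { hM with
    measurable_thin := fun n k => (hM.measurable_thin n k).min measurable_const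
    thin_indep_innov := ?_
    thin_cond := fun S b => ?_ }
  · refine hM.thin_indep_innov.comp (φ := fun (f : ℤ × ℕ → ℕ) i => min (f i) 1) (ψ := id) ?_
      measurable_id
    exact measurable_pi_lambda _ fun i => (measurable_pi_apply i).min measurable_const
  · refine EventuallyEq.trans (condExp_congr_ae ?_) (hM.thin_cond S b)
    filter_upwards [hae] with ω hω
    simp only [Set.indicator, Set.mem_ofPred_eq, hω]

/-- Cylinders generate each row. The probability of a joint cylinder is the mean of a product over
times of functions of the separate `φ n`, which factors as the coefficients are independent. -/
theorem iIndepFun_rows (hM : Model μ φ Z B) : iIndepFun (fun (n : ℤ) ω k => B n k ω) μ := by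
  classical
  set π : ℤ → Set (Set Ω) := fun n =>
    {s | ∃ (A : Finset ℕ) (b : ℕ → ℕ), s = {ω | ∀ k ∈ A, B n k ω = b k}} with hπ
  have hrow : ∀ n, Measurable fun ω k => B n k ω := fun n =>
    measurable_pi_lambda _ fun k => hM.measurable_thin n k
  rw [iIndepFun_iff_iIndep]
  refine iIndepSets.iIndep (fun n => (hrow n).comap_le) π ?_ ?_ ?_
  · rintro n _ ⟨A, b, rfl⟩ _ ⟨A', b', rfl⟩ ⟨ω₀, h1, h2⟩
    have h1 : ∀ k ∈ A, B n k ω₀ = b k := h1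
    have h2 : ∀ k ∈ A', B n k ω₀ = b' k := h2
    -- A common point `ω₀` supplies values consistent with both cylinders; empty intersections need
    -- no treatment.
    refine ⟨A ∪ A', fun k => B n k ω₀, ?_⟩
    ext ω
    simp only [Set.mem_inter_iff, Set.mem_ofPred_eq, Finset.mem_union]
    constructor
    · rintro ⟨h3, h4⟩ k (hk | hk)
      · rw [h3 k hk, h1 k hk]
      · rw [h4 k hk, h2 k hk]
    · exact fun h => ⟨fun k hk => (h k (Or.inl hk)).trans (h1 k hk),
        fun k hk => (h k (Or.inr hk)).trans (h2 k hk)⟩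
  · intro n
    refine le_antisymm ?_ (MeasurableSpace.generateFrom_le ?_)
    · rw [← measurable_iff_comap_le]
      refine @measurable_pi_lambda _ _ _ (MeasurableSpace.generateFrom (π n)) _ _ fun k => ?_
      refine @measurable_to_countable' _ _ _ _ (MeasurableSpace.generateFrom (π n)) _ fun x => ?_
      refine MeasurableSpace.measurableSet_generateFrom ⟨{k}, fun _ => x, ?_⟩
      ext ω; simp
    · rintro _ ⟨A, b, rfl⟩
      refine ⟨{r | ∀ k ∈ A, r k = b k}, ?_, rfl⟩
      have : {r : ℕ → ℕ | ∀ k ∈ A, r k = b k} = ⋂ k ∈ A, (fun r => r k) ⁻¹' {b k} := by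
        ext ω; simp
      rw [this]
      exact Finset.measurableSet_biInter _ fun k _ =>
        measurable_pi_apply k (measurableSet_singleton _)
  · rw [iIndepSets_iff]
    intro s f hf
    choose! A b hAb using hf
    set G : ℤ → ℝ → ℝ := fun n p => ∏ k ∈ A n, bernoulliWeight p (b n k) with hG
    have hGm : ∀ n, Measurable (G n) := fun n =>
      Finset.measurable_prod _ fun k _ => measurable_bernoulliWeight _
    have hind := (hM.coeff_indep.comp G hGm).integral_finset_prod
      (fun n => (hGm n).comp (hM.measurable_coeff n)) s
    set r : Finset (ℤ × ℕ) := (s.sigma A).image fun x => (x.1, x.2) with hr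
    have hrm : ∀ p : ℤ × ℕ, p ∈ r ↔ p.1 ∈ s ∧ p.2 ∈ A p.1 := by
      rintro ⟨n, k⟩
      simp [hr]
    have hone : ∀ n ∈ s, μ.real (f n) = ∫ ω, G n (φ n ω) ∂μ := by
      intro n hn
      have h1 := hM.measureReal_cylinder ((A n).image fun k => (n, k)) fun p => b p.1 p.2
      have h2 : {ω | ∀ i ∈ (A n).image fun k => (n, k), B i.1 i.2 ω = b i.1 i.2} = f n := by
        rw [hAb n hn]; ext ω; simp
      rw [h2] at h1
      rw [h1]
      refine integral_congr_ae (Eventually.of_forall fun ω => ?_)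
      simp only
      rw [Finset.prod_image fun a _ b _ h => (Prod.ext_iff.1 h).2]
    have hall : μ.real (⋂ n ∈ s, f n) = ∫ ω, ∏ n ∈ s, G n (φ n ω) ∂μ := by
      have h1 := hM.measureReal_cylinder r fun p => b p.1 p.2
      have h2 : {ω | ∀ i ∈ r, B i.1 i.2 ω = b i.1 i.2} = ⋂ n ∈ s, f n := by
        ext ω
        simp only [Set.mem_ofPred_eq, Set.mem_iInter, Prod.forall, hrm]
        refine forall_congr' fun n => ⟨fun h hn => ?_, fun h k hk => ?_⟩
        · rw [hAb n hn]
          exact fun k hk => h k ⟨hn, hk⟩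
        · have h3 := h hk.1
          rw [hAb n hk.1] at h3
          exact h3 k hk.2
      rw [h2] at h1
      rw [h1]
      refine integral_congr_ae (Eventually.of_forall fun ω => ?_)
      simp only
      rw [Finset.prod_finset_product r s A hrm]
    have hreal : μ.real (⋂ n ∈ s, f n) = ∏ n ∈ s, μ.real (f n) := by
      rw [hall, Finset.prod_congr rfl hone]
      exact hind
    rw [← ENNReal.toReal_eq_toReal_iff' (measure_ne_top _ _)
      (ENNReal.prod_ne_top fun _ _ => measure_ne_top _ _), ENNReal.toReal_prod]
    exact hreal

/-- A finite subfamily splits into rows and innovations. The two groups are independent of each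
other by hypothesis, and each group is independent within itself. -/
theorem iIndepFun_sources (hM : Model μ φ Z B) :
    iIndepFun (sources (fun (n : ℕ) => B n) (fun (n : ℕ) => Z n)) μ := by
  rw [iIndepFun_iff_measure_inter_preimage_eq_mul]
  intro S sets hS
  set f := sources (fun (n : ℕ) => B n) (fun (n : ℕ) => Z n) with hf
  have hrows := iIndepFun_iff_measure_inter_preimage_eq_mul.1
    (hM.iIndepFun_rows.precomp (g := fun n : ℕ => (n : ℤ)) Nat.cast_injective)
    S.toLeft (sets := fun n => sets (.inl n)) (fun n hn => hS _ (Finset.mem_toLeft.1 hn))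
  have hZ : iIndepFun (fun (n : ℕ) => f (.inr n)) μ := by
    have h1 := (hM.innov_indep.precomp (g := fun n : ℕ => (n : ℤ)) Nat.cast_injective)
    exact h1.comp (fun _ (x : ℕ) (_ : ℕ) => x) fun _ => measurable_of_countable _
  have hinn := iIndepFun_iff_measure_inter_preimage_eq_mul.1 hZ
    S.toRight (sets := fun n => sets (.inr n)) (fun n hn => hS _ (Finset.mem_toRight.1 hn))
  have hsplit : ⋂ i ∈ S, f i ⁻¹' sets i = (⋂ n ∈ S.toLeft, f (.inl n) ⁻¹' sets (.inl n)) ∩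
      ⋂ n ∈ S.toRight, f (.inr n) ⁻¹' sets (.inr n) := by
    ext ω
    simp only [Set.mem_iInter, Set.mem_inter_iff, Finset.mem_toLeft, Finset.mem_toRight,
      Sum.forall]
  have hindep := (IndepFun_iff_Indep _ _ _).1 hM.thin_indep_innov
  have hprod : μ ((⋂ n ∈ S.toLeft, f (.inl n) ⁻¹' sets (.inl n)) ∩
      ⋂ n ∈ S.toRight, f (.inr n) ⁻¹' sets (.inr n)) =
      μ (⋂ n ∈ S.toLeft, f (.inl n) ⁻¹' sets (.inl n)) *
      μ (⋂ n ∈ S.toRight, f (.inr n) ⁻¹' sets (.inr n)) := by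
    refine (Indep_iff _ _ _).1 hindep _ _ ?_ ?_
    · refine Finset.measurableSet_biInter _ fun n hn => ?_
      refine ⟨(fun (r : ℤ × ℕ → ℕ) (k : ℕ) => r ((n : ℤ), k)) ⁻¹' sets (.inl n), ?_, rfl⟩
      exact (measurable_pi_lambda _ fun k => measurable_pi_apply _)
        (hS _ (Finset.mem_toLeft.1 hn))
    · refine Finset.measurableSet_biInter _ fun n hn => ?_
      refine ⟨(fun (r : ℤ → ℕ) (_ : ℕ) => r n) ⁻¹' sets (.inr n), ?_, rfl⟩
      exact (measurable_pi_lambda _ fun k => measurable_pi_apply _)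
        (hS _ (Finset.mem_toRight.1 hn))
  rw [hsplit, hprod]
  conv_rhs => rw [← Finset.toLeft_disjSum_toRight (u := S), Finset.prod_disjSum]
  exact congrArg₂ (· * ·) hrows hinn

end Model

end RCINAR

/-! ### Conditional law of large numbers and the remaining properties of the noise -/

/-- Orthogonality kills the mixed terms, so the sum has second moment at most `z` and the average
has mean absolute value at most `1 / √z`. -/
theorem tendsto_integral_abs_average {Ω : Type*} [MeasurableSpace Ω] {μ : Measure Ω}
    [IsProbabilityMeasure μ] {D : ℕ → Ω → ℝ} (hm : ∀ j, Measurable (D j))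
    (hb : ∀ j ω, |D j ω| ≤ 1) (ho : ∀ j j', j ≠ j' → ∫ ω, D j ω * D j' ω ∂μ = 0) :
    Tendsto (fun z : ℕ => ∫ ω, |(∑ j ∈ Finset.range z, D j ω) / z| ∂μ) atTop (𝓝 0) := by
  have hi : ∀ j j', Integrable (fun ω => D j ω * D j' ω) μ := fun j j' =>
    Integrable.of_bound ((hm j).mul (hm j')).aestronglyMeasurable 1
      (Eventually.of_forall fun ω => by
        rw [Real.norm_eq_abs, abs_mul]
        exact mul_le_one₀ (hb j ω) (abs_nonneg _) (hb j' ω))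
  have hsq : ∀ z : ℕ, (fun ω => (∑ j ∈ Finset.range z, D j ω) ^ 2) =
      fun ω => ∑ j ∈ Finset.range z, ∑ j' ∈ Finset.range z, D j ω * D j' ω := by
    intro z; funext ω; rw [sq, Finset.sum_mul_sum]
  have hsqi : ∀ z : ℕ, Integrable (fun ω => (∑ j ∈ Finset.range z, D j ω) ^ 2) μ := by
    intro z
    rw [hsq]
    exact integrable_finsetSum _ fun j _ => integrable_finsetSum _ fun j' _ => hi j j'
  have hsec : ∀ z : ℕ, ∫ ω, (∑ j ∈ Finset.range z, D j ω) ^ 2 ∂μ ≤ z := by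
    intro z
    rw [hsq, integral_finsetSum _ fun j _ => integrable_finsetSum _ fun j' _ => hi j j']
    have h1 : ∀ j ∈ Finset.range z,
        ∫ ω, ∑ j' ∈ Finset.range z, D j ω * D j' ω ∂μ ≤ 1 := by
      intro j hj
      rw [integral_finsetSum _ fun j' _ => hi j j',
        Finset.sum_eq_single_of_mem j hj fun j' _ hjj => ho j j' hjj.symm]
      calc ∫ ω, D j ω * D j ω ∂μ ≤ ∫ _, (1 : ℝ) ∂μ := by
            refine integral_mono (hi j j) (integrable_const _) fun ω => ?_
            have h2 := hb j ω
            have h3 := abs_mul_abs_self (D j ω)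
            simp only
            rw [← h3]
            exact mul_le_one₀ h2 (abs_nonneg _) h2
        _ = 1 := by simp
    calc _ ≤ ∑ _j ∈ Finset.range z, (1 : ℝ) := Finset.sum_le_sum h1
      _ = z := by simp
  have hbound : ∀ z : ℕ, 0 < z →
      ∫ ω, |(∑ j ∈ Finset.range z, D j ω) / z| ∂μ ≤ (√(z : ℝ))⁻¹ := by
    intro z hz
    have hz' : (0 : ℝ) < z := by exact_mod_cast hz
    set r := √(z : ℝ) with hr
    have hr0 : 0 < r := Real.sqrt_pos.2 hz'
    have hrz : (z : ℝ) = r ^ 2 := (Real.sq_sqrt hz'.le).symm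
    -- The pointwise AM–GM inequality with the scale `r = √z` replaces Cauchy–Schwarz.
    have hpt : ∀ ω, |(∑ j ∈ Finset.range z, D j ω) / z| ≤
        (∑ j ∈ Finset.range z, D j ω) ^ 2 * ((r ^ 3)⁻¹ / 2) + r⁻¹ / 2 := by
      intro ω
      rw [hrz, abs_div, abs_of_pos (pow_pos hr0 2)]
      set S := ∑ j ∈ Finset.range z, D j ω
      rw [← sq_abs S]
      have h1 : |S| ^ 2 * ((r ^ 3)⁻¹ / 2) + r⁻¹ / 2 - |S| / r ^ 2 =
          (|S| - r) ^ 2 * ((r ^ 3)⁻¹ / 2) := by field_simp; ring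
      have h2 : 0 ≤ (|S| - r) ^ 2 * ((r ^ 3)⁻¹ / 2) := by positivity
      linarith
    calc _ ≤ ∫ ω, ((∑ j ∈ Finset.range z, D j ω) ^ 2 * ((r ^ 3)⁻¹ / 2) + r⁻¹ / 2) ∂μ :=
          integral_mono_of_nonneg (Eventually.of_forall fun ω => abs_nonneg _)
            (((hsqi z).mul_const _).add (integrable_const _)) (Eventually.of_forall hpt)
      _ = (∫ ω, (∑ j ∈ Finset.range z, D j ω) ^ 2 ∂μ) * ((r ^ 3)⁻¹ / 2) + r⁻¹ / 2 := by
          rw [integral_add ((hsqi z).mul_const _) (integrable_const _), integral_mul_const]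
          simp
      _ ≤ r ^ 2 * ((r ^ 3)⁻¹ / 2) + r⁻¹ / 2 := by
          gcongr
          exact (hsec z).trans_eq hrz
      _ = r⁻¹ := by field_simp; ring
  have hlim : Tendsto (fun z : ℕ => (√(z : ℝ))⁻¹) atTop (𝓝 0) :=
    tendsto_inv_atTop_zero.comp (Real.tendsto_sqrt_atTop.comp tendsto_natCast_atTop_atTop)
  refine tendsto_of_tendsto_of_tendsto_of_le_of_le' tendsto_const_nhds hlim
    (Eventually.of_forall fun z => integral_nonneg fun ω => abs_nonneg _) ?_
  filter_upwards [eventually_gt_atTop 0] with z hz using hbound z hz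

namespace RCINAR

variable {Ω : Type*} [MeasurableSpace Ω] {μ : Measure Ω} [IsProbabilityMeasure μ]
  {φ : ℤ → Ω → ℝ} {Z : ℤ → Ω → ℕ} {B : ℤ → ℕ → Ω → ℕ}

namespace Model

theorem integral_family (hM : Model μ φ Z B) {J : Type*} (s : Finset J) {e : J → ℤ × ℕ}
    (he : Function.Injective e) (b : J → ℕ) {g : Ω → ℝ}
    (hg : Measurable[environmentSigma φ] g) {C : ℝ} (hC : ∀ ω, |g ω| ≤ C) :
    ∫ ω, g ω * ({ω | ∀ j ∈ s, B (e j).1 (e j).2 ω = b j}).indicator (fun _ => (1 : ℝ)) ω ∂μ =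
      ∫ ω, g ω * ∏ j ∈ s, bernoulliWeight (φ (e j).1 ω) (b j) ∂μ := by
  have h := hM.integral_cylinder (s.map ⟨e, he⟩) (Function.extend e b 0) hg hC
  simp only [Finset.forall_mem_map, Finset.prod_map, Function.Embedding.coeFn_mk,
    he.extend_apply] at h
  exact h

theorem measureReal_family (hM : Model μ φ Z B) {J : Type*} (s : Finset J) {e : J → ℤ × ℕ}
    (he : Function.Injective e) (b : J → ℕ) :
    μ.real {ω | ∀ j ∈ s, B (e j).1 (e j).2 ω = b j} =
      ∫ ω, ∏ j ∈ s, bernoulliWeight (φ (e j).1 ω) (b j) ∂μ := by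
  have h := hM.measureReal_cylinder (s.map ⟨e, he⟩) (Function.extend e b 0)
  simp only [Finset.forall_mem_map, Finset.prod_map, Function.Embedding.coeFn_mk,
    he.extend_apply] at h
  exact h

/-- Given the environment, the entries of row `n` are i.i.d., so each point mass is a mean over `φ
n` that does not see which distinct labels were chosen. -/
theorem map_row_eq (hM : Model μ φ Z B) (n : ℤ) {c : ℕ} {e e' : Fin c → ℕ}
    (he : Function.Injective e) (he' : Function.Injective e') :
    μ.map (fun ω j => B n (e j) ω) = μ.map (fun ω j => B n (e' j) ω) := by
  have hmeas : ∀ e : Fin c → ℕ, Measurable fun ω j => B n (e j) ω := fun e =>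
    measurable_pi_lambda _ fun j => hM.measurable_thin n _
  have key : ∀ e : Fin c → ℕ, Function.Injective e → ∀ b : Fin c → ℕ,
      (μ.map (fun ω j => B n (e j) ω)).real {b} =
        ∫ ω, ∏ j, bernoulliWeight (φ n ω) (b j) ∂μ := by
    intro e he b
    rw [map_measureReal_apply (hmeas e) (measurableSet_singleton b)]
    have h := hM.measureReal_family Finset.univ (e := fun j => (n, e j))
      (fun a b h => he (Prod.ext_iff.1 h).2) b
    rw [← h]
    congr 1
    ext ω
    simp [funext_iff]
  have : IsProbabilityMeasure (μ.map (fun ω j => B n (e j) ω)) :=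
    Measure.isProbabilityMeasure_map (hmeas e).aemeasurable
  have : IsProbabilityMeasure (μ.map (fun ω j => B n (e' j) ω)) :=
    Measure.isProbabilityMeasure_map (hmeas e').aemeasurable
  refine Measure.ext_of_singleton fun b => ?_
  rw [← ENNReal.toReal_eq_toReal_iff' (measure_ne_top _ _) (measure_ne_top _ _)]
  exact (key e he b).trans (key e' he' b).symm

theorem measure_sum_thin (hM : Model μ φ Z B) (n : ℤ) (A : Finset ℕ) (y : ℕ) :
    μ {ω | ∑ k ∈ A, B n k ω = y} = μ {ω | ∑ k ∈ Finset.range A.card, B n k ω = y} := by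
  have hmeas : ∀ e : Fin A.card → ℕ, Measurable fun ω j => B n (e j) ω := fun e =>
    measurable_pi_lambda _ fun j => hM.measurable_thin n _
  have h := congrArg (fun ν => ν {b : Fin A.card → ℕ | ∑ j, b j = y})
    (hM.map_row_eq n (A.orderEmbOfFin rfl).injective Fin.val_injective)
  rw [Measure.map_apply (hmeas _) (Set.to_countable _).measurableSet,
    Measure.map_apply (hmeas _) (Set.to_countable _).measurableSet] at h
  have h1 : ∀ ω, ∑ j, B n (A.orderEmbOfFin rfl j) ω = ∑ k ∈ A, B n k ω := by
    intro ω
    conv_rhs => rw [← Finset.map_orderEmbOfFin_univ A rfl, Finset.sum_map]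
    rfl
  have h2 : ∀ ω, ∑ j : Fin A.card, B n (j : ℕ) ω = ∑ k ∈ Finset.range A.card, B n k ω :=
    fun ω => Fin.sum_univ_eq_sum_range (fun k => B n k ω) _
  simpa only [Set.preimage_ofPred_eq, h1, h2] using h

theorem integrable_coeff (hM : Model μ φ Z B) (n : ℤ) : Integrable (φ n) μ :=
  Integrable.of_bound (hM.measurable_coeff n).aestronglyMeasurable 1
    (Eventually.of_forall fun ω => by
      rw [Real.norm_eq_abs, abs_of_nonneg (hM.coeff_mem n ω).1]; exact (hM.coeff_mem n ω).2)

theorem integral_coeff_lt_one (hM : Model μ φ Z B) (h : μ {ω | φ 0 ω = 1} < 1) :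
    ∫ ω, φ 0 ω ∂μ < 1 := by
  by_contra! hcon
  have h1 : ∫ ω, (1 - φ 0 ω) ∂μ = 0 := by
    refine le_antisymm ?_ (integral_nonneg fun ω => sub_nonneg.2 (hM.coeff_mem 0 ω).2)
    rw [integral_sub (integrable_const _) (hM.integrable_coeff 0)]
    simpa using hcon
  rw [integral_eq_zero_iff_of_nonneg (fun ω => sub_nonneg.2 (hM.coeff_mem 0 ω).2)
    ((integrable_const _).sub (hM.integrable_coeff 0))] at h1
  refine h.ne ((prob_compl_eq_zero_iff
    (hM.measurable_coeff 0 (measurableSet_singleton 1))).1 ?_)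
  rw [← mem_ae_iff]
  filter_upwards [h1] with ω hω
  have hω : 1 - φ 0 ω = 0 := hω
  show φ 0 ω = 1
  linarith

theorem measureReal_survival (hM : Model μ φ Z B) (i K k : ℕ) :
    μ.real {ω | ∀ l ∈ Finset.Ioc i (i + K), B l k ω = 1} = (∫ ω, φ 0 ω ∂μ) ^ K := by
  have h := hM.measureReal_family (Finset.Ioc i (i + K)) (e := fun l : ℕ => ((l : ℤ), k))
    (fun a b h => Nat.cast_injective (Prod.ext_iff.1 h).1) fun _ => 1
  simp only [bernoulliWeight, if_true] at h
  rw [h, (hM.coeff_indep.precomp (g := fun n : ℕ => (n : ℤ))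
    Nat.cast_injective).integral_finset_prod (fun n => hM.measurable_coeff n)]
  rw [Finset.prod_congr rfl fun (l : ℕ) _ => (hM.coeff_ident l).integral_eq]
  simp

theorem measureReal_extinction (hM : Model μ φ Z B) (n : ℤ) (x : ℕ) :
    μ.real {ω | ∑ k ∈ Finset.range x, B n k ω = 0} = ∫ ω, (1 - φ 0 ω) ^ x ∂μ := by
  have h := hM.measureReal_family (Finset.range x) (e := fun k : ℕ => (n, k))
    (fun a b h => (Prod.ext_iff.1 h).2) fun _ => 0
  simp only [bernoulliWeight, if_true, zero_ne_one, if_false, Finset.prod_const,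
    Finset.card_range] at h
  simp only [Finset.sum_eq_zero_iff]
  rw [h]
  exact ((hM.coeff_ident n).comp (u := fun p : ℝ => (1 - p) ^ x) (by fun_prop)).integral_eq

theorem integral_extinction_pos (hM : Model μ φ Z B) (h : μ {ω | φ 0 ω = 1} < 1) (x : ℕ) :
    0 < ∫ ω, (1 - φ 0 ω) ^ x ∂μ := by
  have h0 : ∀ ω, 0 ≤ 1 - φ 0 ω := fun ω => sub_nonneg.2 (hM.coeff_mem 0 ω).2
  have h1 : ∀ ω, 1 - φ 0 ω ≤ 1 := fun ω => sub_le_self _ (hM.coeff_mem 0 ω).1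
  have hi : Integrable (fun ω => (1 - φ 0 ω) ^ x) μ :=
    Integrable.of_bound ((measurable_const.sub (hM.measurable_coeff 0)).pow_const
      x).aestronglyMeasurable 1 (Eventually.of_forall fun ω => by
        rw [Real.norm_eq_abs, abs_of_nonneg (pow_nonneg (h0 ω) x)]
        exact pow_le_one₀ (h0 ω) (h1 ω))
  refine (integral_nonneg fun ω => pow_nonneg (h0 ω) x).lt_of_ne' fun hcon => ?_
  rw [integral_eq_zero_iff_of_nonneg (fun ω => pow_nonneg (h0 ω) x) hi] at hcon
  refine h.ne ((prob_compl_eq_zero_iff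
    (hM.measurable_coeff 0 (measurableSet_singleton 1))).1 ?_)
  rw [← mem_ae_iff]
  filter_upwards [hcon] with ω hω
  have hω : (1 - φ 0 ω) ^ x = 0 := hω
  have h2 := eq_zero_of_pow_eq_zero hω
  show φ 0 ω = 1
  linarith

/-- With `Λ` the product of the coefficients and `I j` the survival indicators, `I j * I j'` for
distinct `j`, `j'` and `Λ * I j` all have mean `∫ Λ ^ 2`. The differences `I j - Λ` are thus
orthogonal. -/
theorem average (hM : Model μ φ Z B) (i K : ℕ) : ∃ Λ : Ω → ℝ, Measurable Λ ∧ (∀ ω, 0 ≤ Λ ω) ∧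
    (∀ ω, Λ ω ≤ 1) ∧ Tendsto (fun z : ℕ => ∫ ω, |(∑ j ∈ Finset.range z,
      if ∀ l ∈ Finset.Ioc i (i + K), B (l : ℤ) (Nat.pair i j) ω = 1 then (1 : ℝ) else 0) / z
        - Λ ω| ∂μ) atTop (𝓝 0) := by
  classical
  set s := Finset.Ioc i (i + K) with hs
  set Λ : Ω → ℝ := fun ω => ∏ l ∈ s, φ l ω with hΛ
  have hΛm : Measurable[environmentSigma φ] Λ :=
    @Finset.measurable_prod _ _ _ _ _ _ (environmentSigma φ) _ s
      fun l _ => measurable_coeff_environment (l : ℤ)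
  have hΛm' : Measurable Λ := Finset.measurable_prod _ fun l _ => hM.measurable_coeff l
  have h0 : ∀ ω, 0 ≤ Λ ω := fun ω => Finset.prod_nonneg fun l _ => (hM.coeff_mem l ω).1
  have h1 : ∀ ω, Λ ω ≤ 1 := fun ω => Finset.prod_le_one (fun l _ => (hM.coeff_mem l ω).1)
    fun l _ => (hM.coeff_mem l ω).2
  have hΛa : ∀ ω, |Λ ω| ≤ 1 := fun ω => by rw [abs_of_nonneg (h0 ω)]; exact h1 ω
  set E : ℕ → Set Ω := fun j => {ω | ∀ l ∈ s, B (l : ℤ) (Nat.pair i j) ω = 1} with hE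
  set I : ℕ → Ω → ℝ := fun j => (E j).indicator fun _ => 1 with hI
  have hEm : ∀ j, MeasurableSet (E j) := fun j => by
    have : E j = ⋂ l ∈ s, B (l : ℤ) (Nat.pair i j) ⁻¹' {1} := by ext ω; simp [hE]
    rw [this]
    exact Finset.measurableSet_biInter _ fun l _ =>
      hM.measurable_thin _ _ (measurableSet_singleton _)
  have hIm : ∀ j, Measurable (I j) := fun j => measurable_const.indicator (hEm j)
  have hI0 : ∀ j ω, 0 ≤ I j ω := fun j ω => Set.indicator_nonneg (fun _ _ => zero_le_one) ω
  have hI1 : ∀ j ω, I j ω ≤ 1 := fun j ω => Set.indicator_le_self' (fun _ _ => zero_le_one) ω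
  have hIa : ∀ j ω, |I j ω| ≤ 1 := fun j ω => by rw [abs_of_nonneg (hI0 j ω)]; exact hI1 j ω
  have hint : ∀ f g : Ω → ℝ, Measurable f → Measurable g → (∀ ω, |f ω| ≤ 1) → (∀ ω, |g ω| ≤ 1) →
      Integrable (fun ω => f ω * g ω) μ := fun f g hf hg hf1 hg1 =>
    Integrable.of_bound (hf.mul hg).aestronglyMeasurable 1 (Eventually.of_forall fun ω => by
      rw [Real.norm_eq_abs, abs_mul]
      exact mul_le_one₀ (hf1 ω) (abs_nonneg _) (hg1 ω))
  have hmixed : ∀ j, ∫ ω, Λ ω * I j ω ∂μ = ∫ ω, Λ ω * Λ ω ∂μ := by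
    intro j
    have h := hM.integral_family s (e := fun l : ℕ => ((l : ℤ), Nat.pair i j))
      (fun a b h => Nat.cast_injective (Prod.ext_iff.1 h).1) (fun _ => 1) hΛm hΛa
    simp only [bernoulliWeight, if_true] at h
    exact h
  have hpair : ∀ j j', j ≠ j' → ∫ ω, I j ω * I j' ω ∂μ = ∫ ω, Λ ω * Λ ω ∂μ := by
    intro j j' hjj
    have h := hM.integral_family (s ×ˢ {j, j'})
      (e := fun p : ℕ × ℕ => ((p.1 : ℤ), Nat.pair i p.2))
      (fun a b h => Prod.ext (Nat.cast_injective (Prod.ext_iff.1 h).1)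
        (Nat.pair_eq_pair.1 (Prod.ext_iff.1 h).2).2) (fun _ => 1)
      (g := fun _ => 1) measurable_const (C := 1) (by simp)
    simp only [bernoulliWeight, if_true, one_mul, Finset.prod_product, Finset.prod_pair hjj,
      Finset.prod_mul_distrib] at h
    rw [← h]
    refine integral_congr_ae (Eventually.of_forall fun ω => ?_)
    simp only [hI, ← Set.inter_indicator_mul, mul_one]
    congr 1
    ext ω
    simp only [hE, Set.mem_inter_iff, Set.mem_ofPred_eq, Finset.mem_product, Finset.mem_insert,
      Finset.mem_singleton, Prod.forall]
    constructor
    · rintro ⟨h1, h2⟩ l k ⟨hl, rfl | rfl⟩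
      · exact h1 l hl
      · exact h2 l hl
    · exact fun h => ⟨fun l hl => h l j ⟨hl, Or.inl rfl⟩, fun l hl => h l j' ⟨hl, Or.inr rfl⟩⟩
  refine ⟨Λ, hΛm', h0, h1, ?_⟩
  have hlim := tendsto_integral_abs_average (μ := μ) (D := fun j ω => I j ω - Λ ω)
    (fun j => (hIm j).sub hΛm')
    (fun j ω => abs_sub_le_of_nonneg_of_le (hI0 j ω) (hI1 j ω) (h0 ω) (h1 ω)) fun j j' hjj => by
      have e1 : ∀ ω, (I j ω - Λ ω) * (I j' ω - Λ ω) =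
          (I j ω * I j' ω - Λ ω * I j ω) - (Λ ω * I j' ω - Λ ω * Λ ω) := fun ω => by ring
      simp only [e1]
      have i1 := hint _ _ (hIm j) (hIm j') (hIa j) (hIa j')
      have i2 := fun j => hint _ _ hΛm' (hIm j) hΛa (hIa j)
      have i3 := hint _ _ hΛm' hΛm' hΛa hΛa
      have i4 : Integrable (fun ω => I j ω * I j' ω - Λ ω * I j ω) μ := i1.sub (i2 j)
      have i5 : Integrable (fun ω => Λ ω * I j' ω - Λ ω * Λ ω) μ := (i2 j').sub i3
      rw [integral_sub i4 i5, integral_sub i1 (i2 j),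
        integral_sub (i2 j') i3, hpair j j' hjj, hmixed, hmixed]
      ring
  refine hlim.congr' ?_
  filter_upwards [eventually_gt_atTop 0] with z hz
  have hz' : (z : ℝ) ≠ 0 := by exact_mod_cast hz.ne'
  refine integral_congr_ae (Eventually.of_forall fun ω => ?_)
  have e2 : ∀ j, I j ω =
      if ∀ l ∈ s, B (l : ℤ) (Nat.pair i j) ω = 1 then (1 : ℝ) else 0 := fun j => by
    simp only [hI, hE, Set.indicator_apply, Set.mem_ofPred_eq]
  simp only [Finset.sum_sub_distrib, Finset.sum_const, Finset.card_range, nsmul_eq_mul, e2]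
  congr 1
  field_simp

theorem driving (hM : Model μ φ Z B) (hB : ∀ n k ω, B n k ω ≤ 1) (h : μ {ω | φ 0 ω = 1} < 1) :
    Driving μ (fun (n : ℕ) => B n) (fun (n : ℕ) => Z n) where
  measurable_thin n k := hM.measurable_thin n k
  measurable_innov n := hM.measurable_innov n
  thin_le_one n k ω := hB n k ω
  indep := hM.iIndepFun_sources
  ident n := hM.innov_ident n
  exchangeable n A y := hM.measure_sum_thin n A y
  survival := by
    -- The mean survival probability may be 0, while `survival` asks for a positive rate.
    refine ⟨max (∫ ω, φ 0 ω ∂μ) (1 / 2), lt_max_of_lt_right (by norm_num),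
      max_lt (hM.integral_coeff_lt_one h) (by norm_num), fun i K k => ?_⟩
    rw [hM.measureReal_survival]
    exact pow_le_pow_left₀ (integral_nonneg fun ω => (hM.coeff_mem 0 ω).1) (le_max_left _ _) K
  extinction x := ⟨_, hM.integral_extinction_pos h x,
    fun n => (hM.measureReal_extinction n x).ge⟩
  average i K := by
    obtain ⟨Λ, h1, h2, h3, h4⟩ := hM.average i K
    refine ⟨Λ, h1, h2, h3, ?_⟩
    convert h4

end Model

end RCINAR

/-! ### The original process as a labelled population -/

namespace RCINAR

section Pathwise

variable {Ω : Type*} {Z : ℤ → Ω → ℕ} {B B' : ℤ → ℕ → Ω → ℕ} {ω : Ω}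

theorem thinning_congr (h : ∀ n k, B n k ω = B' n k ω) (n : ℤ) (x : ℕ) :
    thinning B n x ω = thinning B' n x ω :=
  Finset.sum_congr rfl fun k _ => h n k

theorem process_congr (h : ∀ n k, B n k ω = B' n k ω) (n : ℕ) :
    process Z B n ω = process Z B' n ω := by
  induction n with
  | zero => rfl
  | succ n ih => rw [process, process, ih, thinning_congr h]

theorem regenTime_congr (h : ∀ n k, B n k ω = B' n k ω) (n : ℕ) :
    regenTime Z B n ω = regenTime Z B' n ω := by
  induction n with
  | zero => rfl
  | succ n ih => simp only [regenTime, ih, thinning_congr h, process_congr h]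

theorem epochSum_congr (h : ∀ n k, B n k ω = B' n k ω) (n : ℕ) :
    epochSum Z B n ω = epochSum Z B' n ω := by
  simp only [epochSum, regenTime_congr h, process_congr h]

theorem lt_regenTime_one (i : ℕ) : (i : ℕ∞) < regenTime Z B 1 ω ↔
    ∀ j : ℕ, 2 ≤ j → j ≤ i → thinning B j (process Z B (j - 1) ω) ω ≠ 0 := by
  rw [regenTime, ← not_iff_not, not_lt]
  push Not
  constructor
  · intro h
    by_contra! hcon
    refine absurd h (not_le.2 (lt_of_lt_of_le (b := ((i + 1 : ℕ) : ℕ∞)) ?_ (le_sInf ?_)))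
    · exact_mod_cast Nat.lt_succ_self i
    · rintro _ ⟨j, rfl, hj, h0⟩
      have hj : 1 < j := by
        have hj : ((1 : ℕ) : ℕ∞) < (j : ℕ∞) := hj
        exact_mod_cast hj
      by_contra hlt
      have hlt : j ≤ i := by
        by_contra h2
        exact hlt (by exact_mod_cast (by omega : i + 1 ≤ j))
      exact hcon j hj hlt h0
  · rintro ⟨j, hj, hji, h0⟩
    have h1 : ((1 : ℕ) : ℕ∞) < (j : ℕ∞) := by exact_mod_cast hj
    have h2 : (j : ℕ∞) ≤ (i : ℕ∞) := by exact_mod_cast hji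
    exact le_trans (sInf_le ⟨j, rfl, h1, h0⟩) h2

/-- Labelling the living at time `n` by `1, …, X_n` turns the thinning sum into the survivor count.
Regeneration tests start at time 2 because `ν_0 = 1` and the inequality defining `ν_1` is strict. -/
theorem epochSum_one : epochSum Z B 1 ω =
    ⨆ N, (partialEpochSum (fun n => path (fun n : ℕ => B n)
      (fun n ω => Finset.Icc 1 (process Z B n ω)) n ω) N : ℝ≥0∞) := by
  classical
  have hs : ∀ j : ℕ, 2 ≤ j → survivors (fun n : ℕ => B n)
      (fun n ω => Finset.Icc 1 (process Z B n ω)) j ω =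
      thinning B j (process Z B (j - 1) ω) ω := by
    intro j hj
    obtain ⟨j, rfl⟩ : ∃ i, j = i + 1 := ⟨j - 1, by omega⟩
    rfl
  have hterm : ∀ n : ℕ, (if regenTime Z B (1 - 1) ω ≤ (n : ℕ∞) ∧ (n : ℕ∞) < regenTime Z B 1 ω
      then (process Z B n ω : ℝ≥0∞) else 0) =
      ((if 1 ≤ n ∧ ∀ i, 2 ≤ i → i ≤ n → survivors (fun n : ℕ => B n)
        (fun n ω => Finset.Icc 1 (process Z B n ω)) i ω ≠ 0 then
        (Finset.Icc 1 (process Z B n ω)).card else 0 : ℕ) : ℝ≥0∞) := by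
    intro n
    have h1 : regenTime Z B (1 - 1) ω ≤ (n : ℕ∞) ↔ 1 ≤ n := by
      have : ((1 : ℕ) : ℕ∞) ≤ (n : ℕ∞) ↔ 1 ≤ n := Nat.cast_le
      exact this
    have h2 : (∀ i, 2 ≤ i → i ≤ n → survivors (fun n : ℕ => B n)
        (fun n ω => Finset.Icc 1 (process Z B n ω)) i ω ≠ 0) ↔ (n : ℕ∞) < regenTime Z B 1 ω := by
      rw [lt_regenTime_one]
      exact forall_congr' fun i => imp_congr_right fun hi => by rw [hs i hi]
    rw [Nat.cast_ite, Nat.cast_zero, Nat.card_Icc, Nat.add_sub_cancel]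
    simp only [h1, h2]
  have hadd : ∀ f : ℕ → ℝ≥0∞, ⨆ N, ∑ n ∈ Finset.range N, f n =
      ⨆ N, ∑ n ∈ Finset.range (N + 1), f n := fun f =>
    (Monotone.iSup_nat_add (fun a b h => Finset.sum_le_sum_of_subset (Finset.range_mono h)) 1).symm
  rw [epochSum, ENNReal.tsum_eq_iSup_nat, hadd]
  refine iSup_congr fun N => ?_
  rw [partialEpochSum, Nat.cast_sum]
  refine Finset.sum_congr rfl fun n _ => ?_
  refine Eq.trans ?_ ((hterm n).trans ?_)
  · congr
  · refine congrArg Nat.cast ?_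
    split_ifs <;> first | rfl | (exfalso; tauto)

theorem measurable_process (n : ℕ) :
    Measurable[history (fun n : ℕ => B n) (fun n : ℕ => Z n) (past n)] (process Z B n) := by
  induction n with
  | zero =>
    have : process Z B 0 = fun _ => 0 := rfl
    rw [this]
    exact measurable_const
  | succ n ih =>
    have ih' := ih.mono (history_mono (past_mono (Nat.le_succ n))) le_rfl
    have h1 := measurable_finset_sum_random
      (m := history (fun n : ℕ => B n) (fun n : ℕ => Z n) (past (n + 1)))
      (A := fun ω => Finset.Icc 1 (process Z B n ω)) (b := fun k => B ((n + 1 : ℕ) : ℤ) k)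
      (fun k => by
        have h2 := ih' (Set.to_countable {x | k ∈ Finset.Icc 1 x}).measurableSet
        exact h2)
      (fun k => measurable_thin_history (B := fun n : ℕ => B n) (Z := fun n : ℕ => Z n)
        (n := n + 1) (S := past (n + 1)) (le_refl (n + 1)) k)
    have h2 := measurable_innov_history (B := fun n : ℕ => B n) (Z := fun n : ℕ => Z n)
        (n := n + 1) (S := past (n + 1)) (le_refl (n + 1))
    exact (measurable_of_countable fun p : ℕ × ℕ => p.1 + p.2).comp (h1.prodMk h2)

theorem labelProcess_process : LabelProcess (fun n : ℕ => B n) (fun n : ℕ => Z n)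
    (fun n ω => Finset.Icc 1 (process Z B n ω)) where
  zero ω := by simp [process]
  adapted n k := by
    have h := measurable_process (Z := Z) (B := B) n
      (Set.to_countable {x | k ∈ Finset.Icc 1 x}).measurableSet
    exact h
  card_succ n ω := by
    rw [Nat.card_Icc, Nat.add_sub_cancel]
    rfl

end Pathwise

variable {Ω : Type*} [MeasurableSpace Ω] {μ : Measure Ω} [IsProbabilityMeasure μ]
  {φ : ℤ → Ω → ℝ} {Z : ℤ → Ω → ℕ} {B : ℤ → ℕ → Ω → ℕ}

/-- The tail was computed for permanent labels; it passes to the renumbered process since both are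
label processes for the same noise. -/
theorem Model.exists_tail_epochSum_of_le_one (hM : Model μ φ Z B) (hB : ∀ n k ω, B n k ω ≤ 1)
    (h : μ {ω | φ 0 ω = 1} < 1) {F : ℝ → ℝ} {α : ℝ} (hF : RegularTail F α) (hα : 0 < α)
    (hFZ : ∀ t, F t = μ.real {ω | t < (Z 0 ω : ℝ)}) :
    ∃ c : ℝ, 0 < c ∧ Tendsto (fun t => μ.real {ω | ENNReal.ofReal t < epochSum Z B 1 ω} / F t)
      atTop (𝓝 c) := by
  have hD := hM.driving hB h
  obtain ⟨c, hc, hlim⟩ := hD.exists_tail_contribution hF hα hFZ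
  refine ⟨c, hc, hlim.congr fun t => ?_⟩
  have h1 := LabelProcess.measure_epoch_eq hD (labelProcess_living hD.thin_le_one) labelProcess_process
    (ENNReal.ofReal t)
  simp only [iSup_partialEpochSum hD.thin_le_one, ← epochSum_one] at h1
  rw [measureReal_def, h1, ← measureReal_def]

theorem Model.exists_tail_epochSum (hM : Model μ φ Z B) (h : μ {ω | φ 0 ω = 1} < 1) {F : ℝ → ℝ}
    {α : ℝ} (hF : RegularTail F α) (hα : 0 < α) (hFZ : ∀ t, F t = μ.real {ω | t < (Z 0 ω : ℝ)}) :
    ∃ c : ℝ, 0 < c ∧ Tendsto (fun t => μ.real {ω | ENNReal.ofReal t < epochSum Z B 1 ω} / F t)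
      atTop (𝓝 c) := by
  obtain ⟨c, hc, hlim⟩ :=
    hM.clip.exists_tail_epochSum_of_le_one (fun _ _ _ => min_le_right _ _) h hF hα hFZ
  have hae : ∀ t, μ.real {ω | ENNReal.ofReal t < epochSum Z (fun n k ω => min (B n k ω) 1) 1 ω} =
      μ.real {ω | ENNReal.ofReal t < epochSum Z B 1 ω} := by
    intro t
    refine measureReal_congr ?_
    filter_upwards [hM.ae_thin_le_one] with ω hω
    have h1 : ∀ n k, min (B n k ω) 1 = B n k ω := fun n k => min_eq_left (hω n k)
    have h2 := epochSum_congr (Z := Z) (B := fun n k ω => min (B n k ω) 1) h1 1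
    exact congrArg (ENNReal.ofReal t < ·) h2
  simp only [hae] at hlim
  exact ⟨c, hc, hlim⟩

end RCINAR

/-! ### Conclusion -/

theorem RegularlyVarying.regularTail {Ω : Type*} [MeasurableSpace Ω] {μ : Measure Ω}
    [IsProbabilityMeasure μ] {X : Ω → ℝ} {h : ℝ → ℝ} {α : ℝ} (hh : RegularlyVarying h α)
    (hX : Tendsto (fun t : ℝ => h t * μ.real {ω | t < X ω}) atTop (𝓝 1)) :
    RegularTail (fun t => μ.real {ω | t < X ω}) α := by
  have hanti : Antitone fun t => μ.real {ω | t < X ω} := fun s t hst =>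
    measureReal_mono fun ω hω => lt_of_le_of_lt hst hω
  refine ⟨hanti, fun t => ?_, fun t => measureReal_le_one, fun l hl =>
    hh.tendsto_ratio_of_mul one_pos hX hl⟩
  -- The product tends to 1, so the tail is nonzero at arbitrarily large `s`, and by monotonicity
  -- everywhere.
  have h1 : ∀ᶠ s in atTop, (0 : ℝ) < h s * μ.real {ω | s < X ω} := hX.eventually (lt_mem_nhds one_pos)
  obtain ⟨s, h2, hts⟩ := (h1.and (eventually_ge_atTop t)).exists
  refine lt_of_lt_of_le (measureReal_nonneg.lt_of_ne' fun h0 => ?_) (hanti hts)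
  rw [h0, mul_zero] at h2
  exact h2.false

theorem mainTheorem5 {Ω : Type*} [MeasurableSpace Ω] (μ : Measure Ω) [IsProbabilityMeasure μ]
    (φ : ℤ → Ω → ℝ) (Z : ℤ → Ω → ℕ) (B : ℤ → ℕ → Ω → ℕ) (hmodel : RCINAR.Model μ φ Z B)
    (hA1 : μ {ω | φ 0 ω = 1} < 1)
    (α : ℝ) (hα : 0 < α) (h : ℝ → ℝ) (hh : RegularlyVarying h α)
    (hA2 : Tendsto (fun t : ℝ => h t * μ.real {ω | t < (Z 0 ω : ℝ)}) atTop (𝓝 1)) :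
    (∃ c : ℝ, 0 < c ∧
      Tendsto (fun t : ℝ => h t * μ.real {ω | ENNReal.ofReal t < RCINAR.epochSum Z B 1 ω})
        atTop (𝓝 c)) ∧
    RegularlyVarying (fun t : ℝ => μ.real {ω | ENNReal.ofReal t < RCINAR.epochSum Z B 1 ω})
      (-α) := by
  have hF := hh.regularTail hA2
  obtain ⟨c, hc, hlim⟩ := hmodel.exists_tail_epochSum hA1 hF hα fun _ => rfl
  have hmain : Tendsto (fun t : ℝ => h t *
      μ.real {ω | ENNReal.ofReal t < RCINAR.epochSum Z B 1 ω}) atTop (𝓝 c) := by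
    have h1 := hA2.mul hlim
    rw [one_mul] at h1
    refine h1.congr fun t => ?_
    have h2 := (hF.pos t).ne'
    field_simp
  exact ⟨⟨c, hc, hmain⟩, hh.of_mul hc hmain⟩
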